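/- Let $L,T,\sigma>0$, $\mathcal Z=\mathbb Z^2\setminus\{0\}$, and let $(e_k)_{k\in\mathbb Z^2}$ be the orthonormal basis $e_k(x)=\omega_{k_1}(x_1)\omega_{k_2}(x_2)$ of $L^2([0,L]^2)$, where $\omega_m(z)=\sqrt{2/L}\,\sin(2\pi mz/L)$ for $m>0$, $\omega_0=1/\sqrt L$ and $\omega_m(z)=\sqrt{2/L}\,\cos(2\pi mz/L)$ for $m<0$. Put $\mu_k=(2\pi|k|/L)^2$, so that $-\Delta e_k=\mu_ke_k$. For $a\in\mathbb R$ let $\mathcal H^a$ be the space of (formal) series $v=\sum_{k\in\mathcal Z}v_ke_k$ with $\|v\|_{\mathcal H^a}^2=\sum_{k\in\mathcal Z}\mu_k^av_k^2<\infty$; for $a\ge 0$ these are mean-zero functions in $L^2([0,L]^2)$. Let $e^{-t\Delta^2}\sum_k v_ke_k=\sum_k e^{-t\mu_k^2}v_ke_k$. Let $(\beta_k)_{k\in\mathcal Z}$ be independent real Brownian motions on a probability space $(\Omega,\mathcal F,\mathbb P)$ and $W=\sum_{k\in\mathcal Z}\beta_ke_k$ the cylindrical Wiener process. An admissible regularization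 of the noise is a family of real numbers $(\alpha^{(\varepsilon)}_k)_{\varepsilon>0,\,k\in\mathcal Z}$ that is bounded uniformly in $k$ and $\varepsilon$, such that $\alpha_k^{(\varepsilon)}$ depends only on $\varepsilon$ and $|k|$, for every $\varepsilon>0$ there is $\delta(\varepsilon)>0$ with $\alpha^{(\varepsilon)}_k=\mathcal O(|k|^{-\delta(\varepsilon)})$ as $|k|\to\infty$, and $\alpha^{(\varepsilon)}_k\to1$ as $\varepsilon\to0$ for every $k$. Set $$Z_\varepsilon(t)=\sum_{k\in\mathcal Z}\alpha^{(\varepsilon)}_k\int_0^te^{-(t-s)\mu_k^2}\,d\beta_k(s)\,e_k,\qquad Z(t)=\sum_{k\in\mathcal Z}\int_0^te^{-(t-s)\mu_k^2}\,d\beta_k(s)\,e_k .$$ Let $u_0\in\mathcal H^1$, and for every $\varepsilon>0$ let $u_\varepsilon$ be the mild solution on $[0,T]$ of the surface growth equation with regularized noise $W_\varepsilon=\sum_{k\in\mathcal Z}\alpha^{(\varepsilon)}_k\beta_ke_k$, $$\partial_tu_\varepsilon=-\Delta^2u_\varepsilon-\nabla\cdot\frac{\nabla u_\varepsilon}{1+|\nabla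 u_\varepsilon|^2}+\sigma\,\partial_tW_\varepsilon,\qquad u_\varepsilon(0)=u_0,$$ that is, the process with almost surely continuous paths in $\mathcal H^1$ such that, for every $t\in[0,T]$, almost surely $$u_\varepsilon(t)=e^{-t\Delta^2}u_0-\int_0^te^{-(t-s)\Delta^2}\,\nabla\cdot\frac{\nabla u_\varepsilon(s)}{1+|\nabla u_\varepsilon(s)|^2}\,ds+\sigma Z_\varepsilon(t).$$ Theorem. The linear equation $\partial_tu=-\Delta^2u+\sigma\,\partial_tW$, $u(0)=u_0$, has a mild solution $u(t)=e^{-t\Delta^2}u_0+\sigma Z(t)$ on $[0,T]$ with almost surely continuous paths in $\mathcal H^0$, and for every admissible regularization and every $1<p<\infty$ one has $u_\varepsilon\to u$ in $L^p(\Omega,C^0([0,T]\times[0,L]^2))$ as $\varepsilon\to0$, in the following sense: for every $\varepsilon>0$ the difference $u_\varepsilon-u$ is almost surely represented by a continuous function on $[0,T]\times[0,L]^2$, this defines an element of $L^p(\Omega,C^0([0,T]\times[0,L]^2))$, and $$\lim_{\varepsilon\to0}\ \mathbb E\Bigl[\ \sup_{(t,x)\in[0,T]\times[0,L]^2}|u_\varepsilon(t,x)-u(t,x)|^p\Bigr]=0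 .$$ -/

import Mathlib

open MeasureTheory ProbabilityTheory Filter Topology Set
open scoped NNReal ENNReal Gradient

noncomputable section

namespace SurfaceGrowth

/-! ### The periodic square and its Fourier basis -/

/-- The Euclidean plane. -/
abbrev Plane : Type := EuclideanSpace ℝ (Fin 2)

/-- The closed square `[0, L]²`. -/
def square (L : ℝ) : Set Plane := {x | ∀ i, x i ∈ Icc 0 L}

lemma isCompact_square (L : ℝ) : IsCompact (square L) := by
  have h : IsCompact (Set.pi univ fun _ : Fin 2 => Icc (0 : ℝ) L) :=
    isCompact_univ_pi fun _ => isCompact_Icc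
  have h2 : square L = (WithLp.toLp 2) '' (Set.pi univ fun _ : Fin 2 => Icc (0 : ℝ) L) := by
    ext x
    constructor
    · intro hx
      exact ⟨x.ofLp, fun i _ => hx i, rfl⟩
    · rintro ⟨y, hy, rfl⟩ i
      exact hy i (mem_univ i)
  rw [h2]
  exact h.image (PiLp.continuous_toLp 2 _)

instance (L : ℝ) : CompactSpace (square L) :=
  isCompact_iff_compactSpace.mp (isCompact_square L)

/-- Lebesgue measure on the square `[0, L]²`. -/
def squareMeasure (L : ℝ) : Measure Plane := volume.restrict (square L)

instance (L : ℝ) : IsFiniteMeasure (squareMeasure L) :=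
  ⟨by simpa [squareMeasure] using (isCompact_square L).measure_lt_top⟩

/-- The real Hilbert space `L²([0, L]²)`. -/
abbrev L2 (L : ℝ) : Type := Lp ℝ 2 (squareMeasure L)

/-- The orthonormal trigonometric system of `L²([0, L])`: sines for positive, cosines for negative
indices, and the constant. -/
def trig (L : ℝ) (m : ℤ) (z : ℝ) : ℝ :=
  if 0 < m then √(2 / L) * Real.sin (2 * Real.pi * m / L * z)
  else if m = 0 then 1 / √L
  else √(2 / L) * Real.cos (2 * Real.pi * m / L * z)

/-- The orthonormal basis `e_k(x) = ω_{k₁}(x₁) ω_{k₂}(x₂)`, `k ∈ ℤ²`, of `L²([0, L]²)`. -/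
def basis (L : ℝ) (k : ℤ × ℤ) (x : Plane) : ℝ := trig L k.1 (x 0) * trig L k.2 (x 1)

/-- The index set `ℤ² \ {0}`. -/
abbrev Mode : Type := {k : ℤ × ℤ // k ≠ 0}

/-- The Euclidean length `|k|`. -/
def modeNorm (k : Mode) : ℝ := √((k.1.1 : ℝ) ^ 2 + (k.1.2 : ℝ) ^ 2)

/-- The eigenvalue `μ_k = (2π|k|/L)²` of `-Δ`. -/
def eigenvalue (L : ℝ) (k : Mode) : ℝ := (2 * Real.pi * modeNorm k / L) ^ 2

/-- The Fourier coefficient `∫_{[0,L]²} v e_k dx`. -/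
def coeff (L : ℝ) (v : L2 L) (k : ℤ × ℤ) : ℝ := ∫ x, v x * basis L k x ∂(squareMeasure L)

/-- The family of Fourier coefficients with index in `ℤ² \ {0}`. -/
def coeffs (L : ℝ) (v : L2 L) (k : Mode) : ℝ := coeff L v k.1

/-- `v ∈ L²` belongs to `H^a`, `a ≥ 0`: it has mean zero and `∑_{k ≠ 0} μ_k^a v_k² < ∞`. -/
def MemH (L a : ℝ) (v : L2 L) : Prop :=
  coeff L v 0 = 0 ∧ Summable fun k : Mode => eigenvalue L k ^ a * coeffs L v k ^ 2

/-- The norm `(∑_{k ≠ 0} μ_k^a v_k²)^{1/2}` of `H^a`. -/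
def normH (L a : ℝ) (v : L2 L) : ℝ :=
  √(∑' k : Mode, eigenvalue L k ^ a * coeffs L v k ^ 2)

/-- `w` is a continuous path `[0, T] → H^a`. -/
def ContinuousPathH (L a T : ℝ) (w : ℝ → L2 L) : Prop :=
  (∀ t ∈ Icc 0 T, MemH L a (w t)) ∧
    ∀ t ∈ Icc 0 T, Tendsto (fun s => normH L a (w s - w t)) (𝓝[Icc 0 T] t) (𝓝 0)

lemma contDiff_trig (L : ℝ) (m : ℤ) : ContDiff ℝ 1 (trig L m) := by
  unfold trig
  split_ifs
  · fun_prop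
  · fun_prop
  · fun_prop

lemma continuous_gradient_basis (L : ℝ) (k : ℤ × ℤ) : Continuous (∇ (basis L k)) := by
  have h : ContDiff ℝ 1 (basis L k) := by
    unfold basis
    have h0 : ContDiff ℝ 1 fun x : Plane => x 0 := by fun_prop
    have h1 : ContDiff ℝ 1 fun x : Plane => x 1 := by fun_prop
    exact ((contDiff_trig L k.1).comp h0).mul ((contDiff_trig L k.2).comp h1)
  exact (InnerProductSpace.toDual ℝ Plane).symm.continuous.comp (h.continuous_fderiv one_ne_zero)

lemma memLp_gradient_basis (L : ℝ) (k : ℤ × ℤ) : MemLp (∇ (basis L k)) 2 (squareMeasure L) := by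
  obtain ⟨C, hC⟩ := (isCompact_square L).exists_bound_of_continuousOn
    (continuous_gradient_basis L k).continuousOn
  refine MemLp.of_bound (continuous_gradient_basis L k).aestronglyMeasurable C ?_
  exact (ae_restrict_iff' (isCompact_square L).measurableSet).2 (Eventually.of_forall hC)

/-- The gradient `∇v = ∑_{k ≠ 0} v_k ∇e_k` of `v ∈ H¹`. The terms are pairwise orthogonal and the
series converges in `L²([0, L]²; ℝ²)` exactly if `∑ μ_k v_k² < ∞`. -/
def grad (L : ℝ) (v : L2 L) : Lp Plane 2 (squareMeasure L) :=
  ∑' k : Mode, coeffs L v k • (memLp_gradient_basis L k.1).toLp (∇ (basis L k.1))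

/-! ### The semigroup and the nonlinearity -/

/-- The semigroup generated by `-Δ²`, acting on Fourier coefficients. -/
def semigroup (L t : ℝ) (c : Mode → ℝ) : Mode → ℝ :=
  fun k => Real.exp (-t * eigenvalue L k ^ 2) * c k

/-- The vector field `f(z) = z / (1 + |z|²)` on the plane. -/
def slope (z : Plane) : Plane := (1 + ‖z‖ ^ 2)⁻¹ • z

/-- The distribution `∇ · (∇v / (1 + |∇v|²)) ∈ H^{-1}` for `v ∈ H¹`, given by its Fourier
coefficients: the divergence of `g` has the coefficients `-∫ g · ∇e_k dx`. -/
def nonlinearity (L : ℝ) (v : L2 L) : Mode → ℝ :=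
  fun k => -∫ x, inner ℝ (slope (grad L v x)) (∇ (basis L k.1) x) ∂(squareMeasure L)

/-! ### Noise -/

variable {Ω : Type*} [MeasurableSpace Ω]

/-- The Brownian motions `β_k`, `k ∈ ℤ² \ {0}`, are independent; they define the cylindrical Wiener
process `W = ∑_{k ≠ 0} β_k e_k`. -/
structure IsCylindricalWiener (P : Measure Ω) (β : Mode → ℝ≥0 → Ω → ℝ) : Prop where
  brownian : ∀ k, IsBrownianReal (β k) P
  indep : iIndepFun (fun k ω t => β k t ω) P

/-- `X = ∫_0^t g(s) dB(s)`, the Itô integral of a continuous deterministic integrand `g`: the limit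
in `L²(Ω)` of the left-point sums along the partitions of `[0, t]` into `n` equal intervals. -/
def IsWienerIntegral (P : Measure Ω) (B : ℝ≥0 → Ω → ℝ) (g : ℝ → ℝ) (t : ℝ) (X : Ω → ℝ) : Prop :=
  MemLp X 2 P ∧
    Tendsto
      (fun n : ℕ => eLpNorm
        (fun ω => ∑ i ∈ Finset.range n, g (i * t / n) *
          (B (((i + 1 : ℕ) * t / n : ℝ)).toNNReal ω - B ((i * t / n : ℝ)).toNNReal ω) - X ω) 2 P)
      atTop (𝓝 0)

/-- The `L²([0, L]²)`-valued random variable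
`Z = ∑_{k ≠ 0} a_k (∫_0^t e^{-(t-s) μ_k²} dβ_k(s)) e_k`. -/
structure IsStochasticConvolution (L : ℝ) (P : Measure Ω) (β : Mode → ℝ≥0 → Ω → ℝ) (a : Mode → ℝ)
    (t : ℝ) (Z : Ω → L2 L) : Prop where
  measurable : AEStronglyMeasurable Z P
  mean_zero : ∀ᵐ ω ∂P, coeff L (Z ω) 0 = 0
  coeffs_eq : ∀ k, IsWienerIntegral P (β k)
    (fun s => a k * Real.exp (-(t - s) * eigenvalue L k ^ 2)) t (fun ω => coeffs L (Z ω) k)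

/-- The admissible regularizations of the noise: `W_ε = ∑_{k ≠ 0} α_k^{(ε)} β_k e_k`, `ε > 0`. -/
structure IsRegularization (α : ℝ → Mode → ℝ) : Prop where
  bounded : ∃ C : ℝ, ∀ ε > 0, ∀ k, |α ε k| ≤ C
  decay : ∀ ε > 0, ∃ δ : ℝ, 0 < δ ∧ ∃ C : ℝ, ∀ k, |α ε k| ≤ C * modeNorm k ^ (-δ)
  radial : ∀ ε > 0, ∀ k l, modeNorm k = modeNorm l → α ε k = α ε l
  tendsto_one : ∀ k, Tendsto (fun ε => α ε k) (𝓝[>] 0) (𝓝 1)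

/-! ### Mild solutions -/

/-- `u` is a mild solution on `[0, T]`, with continuous paths in `H¹`, of
`∂_t u = -Δ²u - ∇ · (∇u / (1 + |∇u|²)) + σ ∂_t W_a`, `u(0) = u₀`, with `W_a = ∑_{k ≠ 0} a_k β_k e_k`:
`u(t) = e^{-tΔ²} u₀ - ∫_0^t e^{-(t-s)Δ²} ∇ · (∇u(s) / (1 + |∇u(s)|²)) ds
  + σ ∫_0^t e^{-(t-s)Δ²} dW_a(s)`. -/
structure IsMildSolution (L T σ : ℝ) (P : Measure Ω) (β : Mode → ℝ≥0 → Ω → ℝ) (a : Mode → ℝ)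
    (u₀ : L2 L) (u : ℝ → Ω → L2 L) : Prop where
  measurable : ∀ t ∈ Icc 0 T, AEStronglyMeasurable (u t) P
  continuous : ∀ᵐ ω ∂P, ContinuousPathH L 1 T (fun t => u t ω)
  equation : ∃ Z : ℝ → Ω → L2 L,
    (∀ t ∈ Icc 0 T, IsStochasticConvolution L P β a t (Z t)) ∧
    ∀ t ∈ Icc 0 T, ∀ᵐ ω ∂P, ∀ k,
      coeffs L (u t ω) k = semigroup L t (coeffs L u₀) k
        - (∫ s in (0 : ℝ)..t, semigroup L (t - s) (nonlinearity L (u s ω)) k)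
        + σ * coeffs L (Z t ω) k

/-- `u` is a (mild) solution on `[0, T]`, with continuous paths in `H⁰`, of the linear equation
`∂_t u = -Δ²u + σ ∂_t W`, `u(0) = u₀`, with space-time white noise `∂_t W`:
`u(t) = e^{-tΔ²} u₀ + σ ∫_0^t e^{-(t-s)Δ²} dW(s)`. -/
structure IsLinearSolution (L T σ : ℝ) (P : Measure Ω) (β : Mode → ℝ≥0 → Ω → ℝ)
    (u₀ : L2 L) (u : ℝ → Ω → L2 L) : Prop where
  measurable : ∀ t ∈ Icc 0 T, AEStronglyMeasurable (u t) P
  continuous : ∀ᵐ ω ∂P, ContinuousPathH L 0 T (fun t => u t ω)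
  equation : ∃ Z : ℝ → Ω → L2 L,
    (∀ t ∈ Icc 0 T, IsStochasticConvolution L P β (fun _ => 1) t (Z t)) ∧
    ∀ t ∈ Icc 0 T, ∀ᵐ ω ∂P, ∀ k,
      coeffs L (u t ω) k = semigroup L t (coeffs L u₀) k + σ * coeffs L (Z t ω) k

/-- The continuous function `d` on `[0, T] × [0, L]²` represents the path `w : [0, T] → L²`. -/
def Represents (L T : ℝ) (w : ℝ → L2 L) (d : C(Icc (0 : ℝ) T × square L, ℝ)) : Prop :=
  ∀ t : Icc (0 : ℝ) T, ∀ᵐ x ∂(volume : Measure Plane), ∀ hx : x ∈ square L,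
    w t x = d (t, ⟨x, hx⟩)

end SurfaceGrowth

end

open SurfaceGrowth

noncomputable section

namespace SurfaceGrowth

/-! ### The trigonometric system -/

/-! Mode by mode the mild formulation gives `u_ε - u` = drift + `σ (Z_ε - Z)`, and the initial
values cancel. The two terms vanish for different reasons.

Noise. `Z_ε - Z` is the Gaussian field with coefficients `α_k - 1`. One mode of the stochastic
convolution has standard deviation of order `|k|^{-2}`. Interpolating this decay with the regularity
in time and space bounds the increments of the mode by a small Hölder power of the distance times
`|k|^{-3/2}`. Equivalence of Gaussian moments and dyadic chaining on the cube of `(t, x)`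
(`eLpNorm_sup_le`, `eLpNorm_partialField_le`) then control every moment of the supremum by `√(∑ (α_k
- 1)² |k|^{-3})`. The lattice sum of `|k|^{-3}` converges in dimension two, so dominated convergence
finishes this term (`IsRegularization.tendsto_tsum`).

Drift. The vector field `z / (1 + |z|²)` is bounded by `1/2` and tends to zero as `|z| → ∞`. As `ε →
0` the gradient of `u_ε` becomes infinitely rough: the variance of the first partial derivative of
`Z_ε(t, x)` dominates a fixed multiple of a logarithmically divergent lattice sum, uniformly in `x`
and in `t ≥ s₀ > 0` (`exists_modes_le_sum`, `variance_lower_bound`). So `|∇u_ε|` is large with high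
probability and the nonlinearity averages out.

To make this precise, `∇u_ε` is split into a finite Gaussian sum `g` over a set `F` of modes and a
remainder. The remainder consists of the initial value, of the drift, which is bounded
deterministically because the nonlinearity is bounded, and of the noise outside `F`, which has small
variance thanks to the decay of `α^{(ε)}`. Its second moment is bounded uniformly in `ε`
(`lintegral_norm_grad_sub_le`), whereas the variance of `g` can be made as large as desired. The
pointwise inequality `norm_slope_le_add` combines Chebyshev for the remainder with small-ball bounds
for `g`; no independence between the two is needed. Hence each Fourier coefficient of the
nonlinearity is small in mean after time `s₀`, and each mode of the drift tends to zero in mean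
(`tendsto_lintegral_driftPath`).

The modes of the drift are bounded by a multiple of `μ_k^{1/2 - 2}`, hence of `|k|^{-3}`, uniformly
in everything. Summation over the modes gives convergence of the supremum in mean, and the
deterministic bound upgrades this to all `L^p` (`tendsto_eLpNorm_driftField`). -/

lemma trig_of_pos (L : ℝ) {m : ℤ} (h : 0 < m) (z : ℝ) :
    trig L m z = √(2 / L) * Real.sin (2 * Real.pi * m / L * z) := by simp [trig, h]

lemma trig_zero (L : ℝ) (z : ℝ) : trig L 0 z = 1 / √L := by simp [trig]

lemma trig_of_neg (L : ℝ) {m : ℤ} (h : m < 0) (z : ℝ) :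
    trig L m z = √(2 / L) * Real.cos (2 * Real.pi * m / L * z) := by
  simp [trig, h.ne, not_lt.2 h.le]

lemma continuous_trig (L : ℝ) (m : ℤ) : Continuous (trig L m) := (contDiff_trig L m).continuous

/-- Negating the index swaps sine and cosine of the same frequency, and since cosines carry negative
indices the sign in `cos' = -sin` is absorbed by `m`. Thus the partial derivatives of `e_k` are
again multiples of basis functions. -/
lemma hasDerivAt_trig (L : ℝ) (m : ℤ) (z : ℝ) :
    HasDerivAt (trig L m) (2 * Real.pi * m / L * trig L (-m) z) z := by
  have hlin : HasDerivAt (fun z : ℝ => 2 * Real.pi * m / L * z) (2 * Real.pi * m / L) z := by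
    simpa using (hasDerivAt_id z).const_mul (2 * Real.pi * m / L)
  rcases lt_trichotomy m 0 with h | h | h
  · have e : trig L m = fun z => √(2 / L) * Real.cos (2 * Real.pi * m / L * z) :=
      funext (trig_of_neg L h)
    rw [e, trig_of_pos L (by omega : 0 < -m)]
    refine (hlin.cos.const_mul (√(2 / L))).congr_deriv ?_
    have : 2 * Real.pi * ((-m : ℤ) : ℝ) / L * z = -(2 * Real.pi * m / L * z) := by push_cast; ring
    rw [this, Real.sin_neg]; ring
  · subst h
    have e : trig L 0 = fun _ => 1 / √L := funext (trig_zero L)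
    rw [e]
    simpa using hasDerivAt_const z (1 / √L)
  · have e : trig L m = fun z => √(2 / L) * Real.sin (2 * Real.pi * m / L * z) :=
      funext (trig_of_pos L h)
    rw [e, trig_of_neg L (by omega : -m < 0)]
    refine (hlin.sin.const_mul (√(2 / L))).congr_deriv ?_
    have : 2 * Real.pi * ((-m : ℤ) : ℝ) / L * z = -(2 * Real.pi * m / L * z) := by push_cast; ring
    rw [this, Real.cos_neg]; ring

/-- This is `sin² + cos² = 1`; the normalisation of the constant makes it true for `m = 0` as well.
It later makes the variance of the slope independent of the point. -/
lemma trig_sq_add_trig_neg_sq {L : ℝ} (hL : 0 < L) (m : ℤ) (z : ℝ) :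
    trig L m z ^ 2 + trig L (-m) z ^ 2 = 2 / L := by
  have key : ∀ m : ℤ, 0 < m → trig L m z ^ 2 + trig L (-m) z ^ 2 = 2 / L := by
    intro m h
    rw [trig_of_pos L h, trig_of_neg L (by omega : -m < 0)]
    have : 2 * Real.pi * ((-m : ℤ) : ℝ) / L * z = -(2 * Real.pi * m / L * z) := by push_cast; ring
    rw [this, Real.cos_neg, mul_pow, mul_pow, Real.sq_sqrt (by positivity), ← mul_add,
      Real.sin_sq_add_cos_sq, mul_one]
  rcases lt_trichotomy m 0 with h | h | h
  · have := key (-m) (by omega)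
    rw [neg_neg] at this
    linarith
  · subst h
    rw [neg_zero, trig_zero, div_pow, Real.sq_sqrt hL.le]; ring
  · exact key m h

lemma abs_trig_le {L : ℝ} (hL : 0 < L) (m : ℤ) (z : ℝ) : |trig L m z| ≤ √(2 / L) := by
  refine Real.abs_le_sqrt ?_
  linarith [trig_sq_add_trig_neg_sq hL m z, sq_nonneg (trig L (-m) z)]

lemma integral_cos_int {L : ℝ} (hL : 0 < L) (j : ℤ) :
    ∫ z in (0 : ℝ)..L, Real.cos (2 * Real.pi * j / L * z) = if j = 0 then L else 0 := by
  split_ifs with h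
  · simp [h]
  · have hj : (j : ℝ) ≠ 0 := by exact_mod_cast h
    have hc : 2 * Real.pi * j / L ≠ 0 := by positivity
    rw [intervalIntegral.integral_comp_mul_left (fun z => Real.cos z) hc, integral_cos]
    have : 2 * Real.pi * j / L * L = j * (2 * Real.pi) := by field_simp
    rw [this, mul_zero, Real.sin_zero, Real.sin_eq_zero_iff.2 ⟨2 * j, by push_cast; ring⟩]
    simp

lemma integral_sin_int {L : ℝ} (hL : 0 < L) (j : ℤ) :
    ∫ z in (0 : ℝ)..L, Real.sin (2 * Real.pi * j / L * z) = 0 := by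
  by_cases h : j = 0
  · simp [h]
  · have hj : (j : ℝ) ≠ 0 := by exact_mod_cast h
    have hc : 2 * Real.pi * j / L ≠ 0 := by positivity
    rw [intervalIntegral.integral_comp_mul_left (fun z => Real.sin z) hc, integral_sin]
    have : 2 * Real.pi * j / L * L = j * (2 * Real.pi) := by field_simp
    rw [this, mul_zero, Real.cos_zero, Real.cos_int_mul_two_pi]
    simp

/-- Product-to-sum formulas leave only frequencies `m ± n`, and a full period kills each of them
unless it is zero. For indices of equal sign `m + n` never vanishes, so only the diagonal survives.
-/
lemma integral_trig_mul_trig {L : ℝ} (hL : 0 < L) (m n : ℤ) :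
    ∫ z in (0 : ℝ)..L, trig L m z * trig L n z = if m = n then 1 else 0 := by
  have hs : √(2 / L) * √(2 / L) = 2 / L := Real.mul_self_sqrt (by positivity)
  have hs1 : 1 / √L * (1 / √L) = 1 / L := by
    rw [div_mul_div_comm, one_mul, Real.mul_self_sqrt hL.le]
  have ic : ∀ j : ℤ, IntervalIntegrable (fun z => Real.cos (2 * Real.pi * j / L * z)) volume 0 L :=
    fun j => Continuous.intervalIntegrable (by fun_prop) _ _
  have is : ∀ j : ℤ, IntervalIntegrable (fun z => Real.sin (2 * Real.pi * j / L * z)) volume 0 L :=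
    fun j => Continuous.intervalIntegrable (by fun_prop) _ _
  have ss : ∀ m n : ℤ, ∫ z in (0 : ℝ)..L, (√(2 / L) * Real.sin (2 * Real.pi * m / L * z)) *
      (√(2 / L) * Real.sin (2 * Real.pi * n / L * z)) =
      (1 / L) * ((if m - n = 0 then L else 0) - (if m + n = 0 then L else 0)) := by
    intro m n
    rw [← integral_cos_int hL, ← integral_cos_int hL, ← intervalIntegral.integral_sub (ic _) (ic _),
      ← intervalIntegral.integral_const_mul]
    congr 1; ext z
    have e1 : 2 * Real.pi * ((m - n : ℤ) : ℝ) / L * z =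
      2 * Real.pi * m / L * z - 2 * Real.pi * n / L * z := by push_cast; ring
    have e2 : 2 * Real.pi * ((m + n : ℤ) : ℝ) / L * z =
      2 * Real.pi * m / L * z + 2 * Real.pi * n / L * z := by push_cast; ring
    rw [e1, e2, Real.cos_sub, Real.cos_add, mul_mul_mul_comm, hs]; ring
  have cc : ∀ m n : ℤ, ∫ z in (0 : ℝ)..L, (√(2 / L) * Real.cos (2 * Real.pi * m / L * z)) *
      (√(2 / L) * Real.cos (2 * Real.pi * n / L * z)) =
      (1 / L) * ((if m - n = 0 then L else 0) + (if m + n = 0 then L else 0)) := by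
    intro m n
    rw [← integral_cos_int hL, ← integral_cos_int hL, ← intervalIntegral.integral_add (ic _) (ic _),
      ← intervalIntegral.integral_const_mul]
    congr 1; ext z
    have e1 : 2 * Real.pi * ((m - n : ℤ) : ℝ) / L * z =
      2 * Real.pi * m / L * z - 2 * Real.pi * n / L * z := by push_cast; ring
    have e2 : 2 * Real.pi * ((m + n : ℤ) : ℝ) / L * z =
      2 * Real.pi * m / L * z + 2 * Real.pi * n / L * z := by push_cast; ring
    rw [e1, e2, Real.cos_sub, Real.cos_add, mul_mul_mul_comm, hs]; ring
  have sc : ∀ m n : ℤ, ∫ z in (0 : ℝ)..L, (√(2 / L) * Real.sin (2 * Real.pi * m / L * z)) *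
      (√(2 / L) * Real.cos (2 * Real.pi * n / L * z)) = 0 := by
    intro m n
    have : ∫ z in (0 : ℝ)..L, (1 / L) * (Real.sin (2 * Real.pi * (m + n : ℤ) / L * z) +
        Real.sin (2 * Real.pi * (m - n : ℤ) / L * z)) = 0 := by
      rw [intervalIntegral.integral_const_mul, intervalIntegral.integral_add (is _) (is _),
        integral_sin_int hL, integral_sin_int hL]; simp
    rw [← this]
    congr 1; ext z
    have e1 : 2 * Real.pi * ((m - n : ℤ) : ℝ) / L * z =
      2 * Real.pi * m / L * z - 2 * Real.pi * n / L * z := by push_cast; ring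
    have e2 : 2 * Real.pi * ((m + n : ℤ) : ℝ) / L * z =
      2 * Real.pi * m / L * z + 2 * Real.pi * n / L * z := by push_cast; ring
    rw [e1, e2, Real.sin_sub, Real.sin_add, mul_mul_mul_comm, hs]; ring
  have hL0 : L ≠ 0 := hL.ne'
  rcases lt_trichotomy m 0 with hm | hm | hm <;> rcases lt_trichotomy n 0 with hn | hn | hn
  · simp only [trig_of_neg L hm, trig_of_neg L hn, cc]
    rw [if_neg (by omega : m + n ≠ 0)]
    by_cases h : m = n
    · simp [h, hL0]
    · simp [h, sub_eq_zero]
  · subst hn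
    simp only [trig_of_neg L hm, trig_zero, if_neg hm.ne, intervalIntegral.integral_const_mul,
      intervalIntegral.integral_mul_const, integral_cos_int hL, mul_zero, zero_mul]
  · simp only [trig_of_neg L hm, trig_of_pos L hn, if_neg (by omega : m ≠ n)]
    refine Eq.trans ?_ (sc n m)
    congr 1; ext z; ring
  · subst hm
    simp only [trig_of_neg L hn, trig_zero, if_neg hn.ne', intervalIntegral.integral_const_mul,
      integral_cos_int hL, if_neg hn.ne, mul_zero]
  · subst hm; subst hn
    simp only [trig_zero, hs1, intervalIntegral.integral_const]
    simp [hL0]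
  · subst hm
    simp only [trig_of_pos L hn, trig_zero, if_neg hn.ne, intervalIntegral.integral_const_mul,
      integral_sin_int hL, mul_zero]
  · simp only [trig_of_pos L hm, trig_of_neg L hn, if_neg (by omega : m ≠ n), sc]
  · subst hn
    simp only [trig_of_pos L hm, trig_zero, if_neg hm.ne', intervalIntegral.integral_const_mul,
      intervalIntegral.integral_mul_const, integral_sin_int hL, mul_zero, zero_mul]
  · simp only [trig_of_pos L hm, trig_of_pos L hn, ss]
    rw [if_neg (by omega : m + n ≠ 0)]
    by_cases h : m = n
    · simp [h, hL0]
    · simp [h, sub_eq_zero]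

/-! ### Integration over the square -/

lemma squareMeasure_eq_map {L : ℝ} :
    squareMeasure L = (Measure.pi fun _ : Fin 2 => volume.restrict (Icc 0 L)).map
      (WithLp.toLp 2) := by
  have h := (MeasurableEquiv.toLp 2 (Fin 2 → ℝ)).measurableEmbedding.restrict_map volume (square L)
  rw [MeasurableEquiv.coe_toLp] at h
  rw [← Measure.restrict_pi_pi, ← volume_pi, squareMeasure,
    ← (PiLp.volume_preserving_toLp (Fin 2)).map_eq, h]
  congr 2
  ext x
  simp only [square, mem_preimage, mem_ofPred_eq, mem_univ_pi]

lemma integral_square {E : Type*} [NormedAddCommGroup E] [NormedSpace ℝ E] {L : ℝ}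
    (f : Plane → E) :
    ∫ x, f x ∂squareMeasure L =
      ∫ y, f (WithLp.toLp 2 y) ∂(Measure.pi fun _ : Fin 2 => volume.restrict (Icc 0 L)) := by
  rw [squareMeasure_eq_map]
  exact integral_map_equiv (MeasurableEquiv.toLp 2 (Fin 2 → ℝ)) f

lemma integral_square_mul {L : ℝ} (hL : 0 < L) (f g : ℝ → ℝ) :
    ∫ x, f (x 0) * g (x 1) ∂squareMeasure L =
      (∫ z in (0 : ℝ)..L, f z) * ∫ z in (0 : ℝ)..L, g z := by
  rw [integral_square]
  have := integral_fintype_prod_eq_prod (𝕜 := ℝ) (ι := Fin 2) (E := fun _ => ℝ)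
    (μ := fun _ : Fin 2 => (volume : Measure ℝ).restrict (Icc 0 L)) (fun i => ![f, g] i)
  simp only [Fin.prod_univ_two, Matrix.cons_val_zero, Matrix.cons_val_one] at this
  rw [intervalIntegral.integral_of_le hL.le, intervalIntegral.integral_of_le hL.le,
    ← integral_Icc_eq_integral_Ioc, ← integral_Icc_eq_integral_Ioc]
  exact this

lemma continuous_basis (L : ℝ) (k : ℤ × ℤ) : Continuous (basis L k) := by
  unfold basis
  have h0 : Continuous fun x : Plane => x 0 := by fun_prop
  have h1 : Continuous fun x : Plane => x 1 := by fun_prop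
  exact ((continuous_trig L _).comp h0).mul ((continuous_trig L _).comp h1)

lemma memLp_of_continuous {E : Type*} [NormedAddCommGroup E] {L : ℝ} {f : Plane → E}
    (hf : Continuous f) (h : SecondCountableTopologyEither Plane E) (p : ℝ≥0∞) :
    MemLp f p (squareMeasure L) := by
  obtain ⟨C, hC⟩ := (isCompact_square L).exists_bound_of_continuousOn hf.continuousOn
  refine MemLp.of_bound hf.aestronglyMeasurable C ?_
  exact (ae_restrict_iff' (isCompact_square L).measurableSet).2 (Eventually.of_forall hC)

lemma memLp_basis (L : ℝ) (k : ℤ × ℤ) : MemLp (basis L k) 2 (squareMeasure L) :=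
  memLp_of_continuous (continuous_basis L k) inferInstance 2

lemma integral_basis_mul_basis {L : ℝ} (hL : 0 < L) (k l : ℤ × ℤ) :
    ∫ x, basis L k x * basis L l x ∂squareMeasure L = if k = l then 1 else 0 := by
  have : (fun x : Plane => basis L k x * basis L l x) =
      fun x : Plane => (fun z => trig L k.1 z * trig L l.1 z) (x 0) *
        (fun z => trig L k.2 z * trig L l.2 z) (x 1) := by
    ext x; simp only [basis]; ring
  rw [this, integral_square_mul hL (fun z => trig L k.1 z * trig L l.1 z)
    (fun z => trig L k.2 z * trig L l.2 z), integral_trig_mul_trig hL, integral_trig_mul_trig hL]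
  by_cases h1 : k.1 = l.1 <;> by_cases h2 : k.2 = l.2 <;> simp [h1, h2, Prod.ext_iff]

/-- The function `e_k` as an element of `L²`. -/
def basisL2 (L : ℝ) (k : ℤ × ℤ) : L2 L := (memLp_basis L k).toLp (basis L k)

lemma inner_basisL2 (L : ℝ) (k : ℤ × ℤ) (v : L2 L) : inner ℝ (basisL2 L k) v = coeff L v k := by
  rw [L2.inner_def, coeff]
  refine integral_congr_ae ?_
  filter_upwards [(memLp_basis L k).coeFn_toLp] with x hx
  rw [basisL2, hx]; rfl

lemma orthonormal_basisL2 {L : ℝ} (hL : 0 < L) : Orthonormal ℝ (basisL2 L) := by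
  rw [orthonormal_iff_ite]
  intro k l
  rw [inner_basisL2, coeff, ← integral_basis_mul_basis hL k l]
  refine integral_congr_ae ?_
  filter_upwards [(memLp_basis L l).coeFn_toLp] with x hx
  rw [basisL2, hx, mul_comm]

/-! ### Completeness of the trigonometric system -/

/-- The normalised Haar measure of the unit torus. -/
abbrev torusMeasure : Measure (UnitAddTorus (Fin 2)) :=
  Measure.pi fun _ => (AddCircle.haarAddCircle : Measure UnitAddCircle)

/-- The measurable map from the unit torus onto `(0, L]²`. -/
def torusToPlane (L : ℝ) (θ : UnitAddTorus (Fin 2)) : Plane :=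
  WithLp.toLp 2 (L • (UnitAddTorus.measurableEquivPiIoc (0 : Fin 2 → ℝ) θ).1)

/-- Scaling by `L` multiplies Lebesgue measure by `L^{-2}`, and half-open and closed squares differ
by a null set. This transports completeness of the characters of the torus to the square. -/
lemma map_torusToPlane {L : ℝ} (hL : 0 < L) :
    AEMeasurable (torusToPlane L) torusMeasure ∧
    torusMeasure.map (torusToPlane L) =
      ENNReal.ofReal |(L ^ 2)⁻¹| • squareMeasure L := by
  have h1 := UnitAddTorus.measurePreserving_equivPiIoc (0 : Fin 2 → ℝ)
  have hS : MeasurableSet {x : Fin 2 → ℝ | ∀ i, x i ∈ Ioc ((0 : Fin 2 → ℝ) i) ((0 : Fin 2 → ℝ) i + 1)} :=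
    MeasurableSet.univ_pi' (fun i => measurableSet_Ioc)
  set S : Set (Fin 2 → ℝ) := {x | ∀ i, x i ∈ Ioc ((0 : Fin 2 → ℝ) i) ((0 : Fin 2 → ℝ) i + 1)} with hSd
  have h2 : MeasurePreserving (Subtype.val : S → (Fin 2 → ℝ)) (Measure.comap Subtype.val volume)
      (volume.restrict S) := ⟨measurable_subtype_coe, map_comap_subtype_coe hS volume⟩
  have h3 : MeasurePreserving (fun x : Fin 2 → ℝ => L • x) (volume.restrict S)
      (ENNReal.ofReal |(L ^ 2)⁻¹| • Measure.pi fun _ : Fin 2 => volume.restrict (Icc 0 L)) := by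
    refine ⟨by fun_prop, ?_⟩
    have hm : MeasurableEmbedding (fun x : Fin 2 → ℝ => L • x) :=
      (Homeomorph.smulOfNeZero L hL.ne').measurableEmbedding
    have hpre : S = (fun x : Fin 2 → ℝ => L • x) ⁻¹' (univ.pi fun _ => Ioc 0 L) := by
      ext x
      simp only [hSd, mem_ofPred_eq, mem_preimage, mem_univ_pi, Pi.smul_apply, smul_eq_mul, mem_Ioc,
        Pi.zero_apply, zero_add]
      refine forall_congr' fun i => and_congr (by simp [hL]) ?_
      constructor
      · intro h; nlinarith
      · intro h; exact le_of_mul_le_mul_left (by linarith) hL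
    have := hm.restrict_map volume (univ.pi fun _ => Ioc 0 L)
    rw [← hpre, Measure.map_addHaar_smul volume hL.ne'] at this
    rw [← this, Measure.restrict_smul, ← Measure.restrict_pi_pi, ← volume_pi]
    simp only [Module.finrank_fintype_fun_eq_card, Fintype.card_fin]
    congr 1
    refine Measure.restrict_congr_set ?_
    exact Measure.ae_eq_set_pi (I := univ) (μ := fun _ : Fin 2 => (volume : Measure ℝ))
      fun _ _ => Ioc_ae_eq_Icc
  have h4 : MeasurePreserving (WithLp.toLp 2 : (Fin 2 → ℝ) → Plane)
      (ENNReal.ofReal |(L ^ 2)⁻¹| • Measure.pi fun _ : Fin 2 => volume.restrict (Icc 0 L))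
      (ENNReal.ofReal |(L ^ 2)⁻¹| • squareMeasure L) := by
    refine ⟨by fun_prop, ?_⟩
    rw [Measure.map_smul, squareMeasure_eq_map]
  have := h4.comp (h3.comp (h2.comp h1))
  exact ⟨this.measurable.aemeasurable, this.map_eq⟩

lemma torusToPlane_div {L : ℝ} (hL : 0 < L) (θ : UnitAddTorus (Fin 2)) :
    (fun i => ((torusToPlane L θ i / L : ℝ) : UnitAddCircle)) = θ := by
  have : ∀ i, torusToPlane L θ i / L =
      (UnitAddTorus.measurableEquivPiIoc (0 : Fin 2 → ℝ) θ).1 i := by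
    intro i
    simp only [torusToPlane, Pi.smul_apply, smul_eq_mul]
    field_simp
  simp only [this]
  exact (UnitAddTorus.measurableEquivPiIoc (0 : Fin 2 → ℝ)).symm_apply_apply θ

/-- Euler's formula: the characters of frequency `n` lie in the complex span of the sine and cosine
with indices `±n`. -/
lemma exists_fourier_eq_trig {L : ℝ} (hL : 0 < L) (n : ℤ) :
    ∃ a b : ℂ, ∀ y : ℝ, fourier n ((y / L : ℝ) : UnitAddCircle) =
      a * (trig L n y : ℂ) + b * (trig L (-n) y : ℂ) := by
  have hs : √(2 / L) ≠ 0 := (Real.sqrt_pos.2 (by positivity)).ne'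
  have hs' : ((√(2 / L) : ℝ) : ℂ) ≠ 0 := by exact_mod_cast hs
  have key : ∀ y : ℝ, fourier n ((y / L : ℝ) : UnitAddCircle) =
      (Real.cos (2 * Real.pi * n / L * y) : ℂ) + (Real.sin (2 * Real.pi * n / L * y) : ℂ) * Complex.I := by
    intro y
    rw [fourier_coe_apply, Complex.ofReal_cos, Complex.ofReal_sin, ← Complex.exp_mul_I]
    congr 1
    push_cast
    ring
  rcases lt_trichotomy n 0 with h | h | h
  · refine ⟨1 / √(2 / L), -Complex.I / √(2 / L), fun y => ?_⟩
    rw [key, trig_of_neg L h, trig_of_pos L (by omega : 0 < -n)]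
    have : 2 * Real.pi * ((-n : ℤ) : ℝ) / L * y = -(2 * Real.pi * n / L * y) := by push_cast; ring
    rw [this, Real.sin_neg]
    push_cast
    field_simp
  · subst h
    refine ⟨√L, 0, fun y => ?_⟩
    have : (√L : ℂ) ≠ 0 := by exact_mod_cast (Real.sqrt_pos.2 hL).ne'
    rw [key, trig_zero]
    push_cast
    simp [this]
  · refine ⟨Complex.I / √(2 / L), 1 / √(2 / L), fun y => ?_⟩
    rw [key, trig_of_pos L h, trig_of_neg L (by omega : -n < 0)]
    have : 2 * Real.pi * ((-n : ℤ) : ℝ) / L * y = -(2 * Real.pi * n / L * y) := by push_cast; ring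
    rw [this, Real.cos_neg]
    push_cast
    field_simp
    ring

/-- Pulled back to the torus, each complex Fourier coefficient of `v` is a combination of the four
real coefficients with indices `(±n 0, ±n 1)`, hence zero; the Fourier series in `L²` of the torus
then gives `v = 0`. -/
lemma eq_zero_of_coeff_eq_zero {L : ℝ} (hL : 0 < L) (v : L2 L) (hv : ∀ k, coeff L v k = 0) :
    v = 0 := by
  obtain ⟨hτ, hmap⟩ := map_torusToPlane hL
  have hc : ENNReal.ofReal |(L ^ 2)⁻¹| ≠ 0 := by
    rw [Ne, ENNReal.ofReal_eq_zero, not_le]; positivity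
  have hvm : MemLp (fun y => (v y : ℂ)) 2 (squareMeasure L) := (Lp.memLp v).ofReal
  have hvm' : MemLp (fun y => (v y : ℂ)) 2 (torusMeasure.map (torusToPlane L)) := by
    rw [hmap]; exact hvm.smul_measure ENNReal.ofReal_ne_top
  have hg : MemLp (fun θ => (v (torusToPlane L θ) : ℂ)) 2 torusMeasure :=
    (memLp_map_measure_iff hvm'.1 hτ).1 hvm'
  have hint : ∀ k, Integrable (fun y => (v y : ℂ) * (basis L k y : ℂ)) (squareMeasure L) := by
    intro k
    exact (((Lp.memLp v).integrable_mul (memLp_basis L k)).ofReal (𝕜 := ℂ)).congr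
      (Eventually.of_forall fun x => by simp)
  have hz : ∀ k, ∫ y, (v y : ℂ) * (basis L k y : ℂ) ∂squareMeasure L = 0 := by
    intro k
    have := hv k
    rw [coeff] at this
    have h2 : ∫ y, (v y : ℂ) * (basis L k y : ℂ) ∂squareMeasure L =
      ((∫ y, v y * basis L k y ∂squareMeasure L : ℝ) : ℂ) := by
      rw [← integral_complex_ofReal]; simp
    rw [h2, this]; simp
  have hcoef : ∀ n, UnitAddTorus.mFourierCoeff (fun θ => (v (torusToPlane L θ) : ℂ)) n = 0 := by
    intro n
    obtain ⟨a, b, hab⟩ := exists_fourier_eq_trig hL (-n 0)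
    obtain ⟨a', b', hab'⟩ := exists_fourier_eq_trig hL (-n 1)
    set F : Plane → ℂ := fun y =>
      (a * a') * ((v y : ℂ) * (basis L (-n 0, -n 1) y : ℂ)) +
      (a * b') * ((v y : ℂ) * (basis L (-n 0, n 1) y : ℂ)) +
      ((b * a') * ((v y : ℂ) * (basis L (n 0, -n 1) y : ℂ)) +
      (b * b') * ((v y : ℂ) * (basis L (n 0, n 1) y : ℂ))) with hF
    have hFi : Integrable F (squareMeasure L) :=
      (((hint _).const_mul _).add ((hint _).const_mul _)).add
        (((hint _).const_mul _).add ((hint _).const_mul _))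
    have e : ∀ θ, UnitAddTorus.mFourier (-n) θ • (v (torusToPlane L θ) : ℂ) =
        F (torusToPlane L θ) := by
      intro θ
      have h1 : UnitAddTorus.mFourier (-n) θ =
          fourier (-n 0) ((torusToPlane L θ 0 / L : ℝ) : UnitAddCircle) *
          fourier (-n 1) ((torusToPlane L θ 1 / L : ℝ) : UnitAddCircle) := by
        conv_lhs => rw [← torusToPlane_div hL θ]
        simp [UnitAddTorus.mFourier, Fin.prod_univ_two]
      rw [h1, hab, hab', hF]
      simp only [basis, neg_neg, smul_eq_mul]
      push_cast
      ring
    rw [UnitAddTorus.mFourierCoeff]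
    simp_rw [e]
    change ∫ θ, F (torusToPlane L θ) ∂torusMeasure = 0
    rw [← integral_map hτ (by rw [hmap]; exact (hFi.smul_measure ENNReal.ofReal_ne_top).1), hmap,
      integral_smul_measure]
    have h3 : ∫ y, F y ∂squareMeasure L = 0 := by
      have i1 := ((hint (-n 0, -n 1)).const_mul (a * a'))
      have i2 := ((hint (-n 0, n 1)).const_mul (a * b'))
      have i3 := ((hint (n 0, -n 1)).const_mul (b * a'))
      have i4 := ((hint (n 0, n 1)).const_mul (b * b'))
      have s1 := integral_add (i1.add i2) (i3.add i4)
      have s2 := integral_add i1 i2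
      have s3 := integral_add i3 i4
      simp only [integral_const_mul, hz, mul_zero, add_zero] at s2 s3
      simp only [Pi.add_apply] at s1
      rw [hF, s1, s2, s3, add_zero]
    rw [h3, smul_zero]
  have hG : hg.toLp = 0 := by
    have h := UnitAddTorus.hasSum_mFourier_series_L2 (d := Fin 2) hg.toLp
    refine h.unique ?_
    have e : ∀ n, UnitAddTorus.mFourierCoeff hg.toLp n = 0 := by
      intro n
      rw [← hcoef n]
      refine integral_congr_ae ?_
      filter_upwards [hg.coeFn_toLp] with θ hθ
      rw [hθ]
    simp only [e, zero_smul]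
    exact hasSum_zero
  have h1 : (fun θ => (v (torusToPlane L θ) : ℂ)) =ᵐ[torusMeasure] 0 := by
    filter_upwards [hg.coeFn_toLp, Lp.coeFn_zero ℂ 2 torusMeasure] with θ h2 h3
    rw [← h2, hG, h3]
  have h2 : ∀ᵐ y ∂(torusMeasure.map (torusToPlane L)), (v y : ℂ) = 0 := by
    have h3 : eLpNorm (fun y => (v y : ℂ)) 2 (torusMeasure.map (torusToPlane L)) = 0 := by
      rw [eLpNorm_map_measure hvm'.1 hτ]
      exact (eLpNorm_congr_ae h1).trans eLpNorm_zero
    exact (eLpNorm_eq_zero_iff hvm'.1 two_ne_zero).1 h3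
  rw [hmap] at h2
  -- The scaling factor of the measure is nonzero, so null sets of the image measure are null sets
  -- of the square.
  replace h2 := (Measure.absolutelyContinuous_smul hc).ae_le h2
  refine Lp.ext ?_
  filter_upwards [h2, Lp.coeFn_zero ℝ 2 (squareMeasure L)] with y h3 h4
  rw [h4]
  exact_mod_cast h3

/-! ### Fourier coefficients -/

lemma coeff_add (L : ℝ) (v w : L2 L) (k : ℤ × ℤ) :
    coeff L (v + w) k = coeff L v k + coeff L w k := by
  simp only [← inner_basisL2, inner_add_right]

lemma coeff_sub (L : ℝ) (v w : L2 L) (k : ℤ × ℤ) :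
    coeff L (v - w) k = coeff L v k - coeff L w k := by
  simp only [← inner_basisL2, inner_sub_right]

lemma coeff_smul (L : ℝ) (c : ℝ) (v : L2 L) (k : ℤ × ℤ) :
    coeff L (c • v) k = c * coeff L v k := by
  simp only [← inner_basisL2, inner_smul_right]

lemma coeffs_add (L : ℝ) (v w : L2 L) (k : Mode) :
    coeffs L (v + w) k = coeffs L v k + coeffs L w k := coeff_add L v w k.1

lemma coeffs_sub (L : ℝ) (v w : L2 L) (k : Mode) :
    coeffs L (v - w) k = coeffs L v k - coeffs L w k := coeff_sub L v w k.1

lemma coeffs_smul (L : ℝ) (c : ℝ) (v : L2 L) (k : Mode) :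
    coeffs L (c • v) k = c * coeffs L v k := coeff_smul L c v k.1

lemma continuous_coeff (L : ℝ) (k : ℤ × ℤ) : Continuous fun v : L2 L => coeff L v k := by
  simp only [← inner_basisL2]; fun_prop

lemma continuous_coeffs (L : ℝ) (k : Mode) : Continuous fun v : L2 L => coeffs L v k :=
  continuous_coeff L k.1

lemma ext_coeffs {L : ℝ} (hL : 0 < L) {v w : L2 L} (h0 : coeff L v 0 = coeff L w 0)
    (h : ∀ k, coeffs L v k = coeffs L w k) : v = w := by
  rw [← sub_eq_zero]
  refine eq_zero_of_coeff_eq_zero hL _ fun k => ?_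
  rw [coeff_sub, sub_eq_zero]
  by_cases hk : k = 0
  · rw [hk, h0]
  · exact h ⟨k, hk⟩

lemma coeff_basisL2 {L : ℝ} (hL : 0 < L) (k l : ℤ × ℤ) :
    coeff L (basisL2 L k) l = if l = k then 1 else 0 := by
  rw [← inner_basisL2]
  exact orthonormal_iff_ite.1 (orthonormal_basisL2 hL) l k

lemma orthonormal_basisL2_mode {L : ℝ} (hL : 0 < L) :
    Orthonormal ℝ (fun k : Mode => basisL2 L k.1) :=
  (orthonormal_basisL2 hL).comp _ Subtype.val_injective

lemma summable_coeffs_sq {L : ℝ} (hL : 0 < L) (v : L2 L) :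
    Summable fun k : Mode => coeffs L v k ^ 2 := by
  have := (orthonormal_basisL2_mode hL).inner_products_summable v
  simpa [inner_basisL2, coeffs] using this

lemma tsum_coeffs_sq_le {L : ℝ} (hL : 0 < L) (v : L2 L) :
    ∑' k : Mode, coeffs L v k ^ 2 ≤ ‖v‖ ^ 2 := by
  have := (orthonormal_basisL2_mode hL).tsum_inner_products_le v
  simpa [inner_basisL2, coeffs] using this

/-- The element of `L²` with the given Fourier coefficients. -/
def ofCoeffs (L : ℝ) (c : Mode → ℝ) : L2 L := ∑' k : Mode, c k • basisL2 L k.1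

/-- An orthogonal series converges if the squared norms of its terms are summable. -/
lemma summable_of_orthogonal {E ι : Type*} [NormedAddCommGroup E] [InnerProductSpace ℝ E]
    [CompleteSpace E] {f : ι → E} (ho : Pairwise fun i j => inner ℝ (f i) (f j) = 0)
    (hs : Summable fun i => ‖f i‖ ^ 2) :
    Summable f ∧ ‖∑' i, f i‖ ^ 2 = ∑' i, ‖f i‖ ^ 2 := by
  classical
  have hn : ∀ s : Finset ι, ‖∑ i ∈ s, f i‖ ^ 2 = ∑ i ∈ s, ‖f i‖ ^ 2 := by
    intro s
    rw [← real_inner_self_eq_norm_sq, sum_inner]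
    refine Finset.sum_congr rfl fun i hi => ?_
    rw [inner_sum, Finset.sum_eq_single i (fun j _ hj => ho (Ne.symm hj)) (fun h => absurd hi h),
      real_inner_self_eq_norm_sq]
  have h1 : Summable f := by
    rw [summable_iff_vanishing_norm] at hs ⊢
    intro ε hε
    obtain ⟨s, hs⟩ := hs (ε ^ 2) (by positivity)
    refine ⟨s, fun t ht => ?_⟩
    have h := hs t ht
    rw [Real.norm_of_nonneg (Finset.sum_nonneg fun i _ => by positivity), ← hn] at h
    exact lt_of_pow_lt_pow_left₀ 2 hε.le h
  refine ⟨h1, ?_⟩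
  have h2 : Tendsto (fun s : Finset ι => ‖∑ i ∈ s, f i‖ ^ 2) atTop (𝓝 (‖∑' i, f i‖ ^ 2)) :=
    (h1.hasSum.norm).pow 2
  simp only [hn] at h2
  exact tendsto_nhds_unique h2 hs.hasSum

lemma summable_smul_basisL2 {L : ℝ} (hL : 0 < L) {c : Mode → ℝ} (hc : Summable fun k => c k ^ 2) :
    Summable fun k : Mode => c k • basisL2 L k.1 := by
  refine (summable_of_orthogonal (fun k l hkl => ?_) ?_).1
  · beta_reduce
    rw [inner_smul_left, inner_smul_right, (orthonormal_basisL2_mode hL).2 hkl]; simp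
  · refine hc.congr fun k => ?_
    rw [norm_smul, (orthonormal_basisL2_mode hL).1 k, mul_one, Real.norm_eq_abs, sq_abs]

lemma coeff_ofCoeffs {L : ℝ} (hL : 0 < L) {c : Mode → ℝ} (hc : Summable fun k => c k ^ 2)
    (l : ℤ × ℤ) : coeff L (ofCoeffs L c) l = ∑' k : Mode, if l = k.1 then c k else 0 := by
  have h := (summable_smul_basisL2 hL hc).hasSum
  have h2 := h.mapL (innerSL ℝ (basisL2 L l))
  simp only [innerSL_apply_apply, inner_basisL2, coeff_smul, coeff_basisL2 hL, mul_ite, mul_one,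
    mul_zero] at h2
  exact h2.tsum_eq.symm

lemma coeff_zero_ofCoeffs {L : ℝ} (hL : 0 < L) {c : Mode → ℝ} (hc : Summable fun k => c k ^ 2) :
    coeff L (ofCoeffs L c) 0 = 0 := by
  rw [coeff_ofCoeffs hL hc]
  simp [fun k : Mode => (Ne.symm k.2)]

lemma coeffs_ofCoeffs {L : ℝ} (hL : 0 < L) {c : Mode → ℝ} (hc : Summable fun k => c k ^ 2)
    (l : Mode) : coeffs L (ofCoeffs L c) l = c l := by
  rw [coeffs, coeff_ofCoeffs hL hc, tsum_eq_single l]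
  · simp
  · intro k hk
    rw [if_neg]
    exact fun h => hk (Subtype.ext h.symm)

lemma modeNorm_sq (k : Mode) : modeNorm k ^ 2 = (k.1.1 : ℝ) ^ 2 + (k.1.2 : ℝ) ^ 2 :=
  Real.sq_sqrt (by positivity)

lemma one_le_modeNorm (k : Mode) : 1 ≤ modeNorm k := by
  have h : (1 : ℤ) ≤ k.1.1 ^ 2 + k.1.2 ^ 2 := by
    by_contra! h
    have h1 : k.1.1 = 0 := by nlinarith [sq_nonneg k.1.1, sq_nonneg k.1.2]
    have h2 : k.1.2 = 0 := by nlinarith [sq_nonneg k.1.1, sq_nonneg k.1.2]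
    exact k.2 (Prod.ext h1 h2)
  have h' : (1 : ℝ) ≤ (k.1.1 : ℝ) ^ 2 + (k.1.2 : ℝ) ^ 2 := by exact_mod_cast h
  rw [modeNorm]
  exact Real.one_le_sqrt.2 h'

lemma eigenvalue_eq (L : ℝ) (k : Mode) :
    eigenvalue L k = (2 * Real.pi / L) ^ 2 * modeNorm k ^ 2 := by
  rw [eigenvalue]; ring

lemma eigenvalue_pos {L : ℝ} (hL : 0 < L) (k : Mode) : 0 < eigenvalue L k := by
  have := one_le_modeNorm k
  rw [eigenvalue]; positivity

/-! ### Gradients -/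

/-- The explicit gradient of `e_k`. -/
lemma hasGradientAt_basis (L : ℝ) (k : ℤ × ℤ) (x : Plane) :
    HasGradientAt (basis L k) (WithLp.toLp 2
      ![2 * Real.pi * k.1 / L * trig L (-k.1) (x 0) * trig L k.2 (x 1),
        trig L k.1 (x 0) * (2 * Real.pi * k.2 / L * trig L (-k.2) (x 1))]) x := by
  rw [hasGradientAt_iff_hasFDerivAt]
  have h0 : HasFDerivAt (fun x : Plane => x 0) (PiLp.proj (𝕜 := ℝ) 2 (fun _ : Fin 2 => ℝ) 0) x :=
    (PiLp.proj (𝕜 := ℝ) 2 (fun _ : Fin 2 => ℝ) 0).hasFDerivAt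
  have h1 : HasFDerivAt (fun x : Plane => x 1) (PiLp.proj (𝕜 := ℝ) 2 (fun _ : Fin 2 => ℝ) 1) x :=
    (PiLp.proj (𝕜 := ℝ) 2 (fun _ : Fin 2 => ℝ) 1).hasFDerivAt
  have h2 := ((hasDerivAt_trig L k.1 (x 0)).comp_hasFDerivAt x h0).mul
    ((hasDerivAt_trig L k.2 (x 1)).comp_hasFDerivAt x h1)
  refine h2.congr_fderiv ?_
  ext y
  simp [InnerProductSpace.toDual_apply_apply, PiLp.inner_apply, Fin.sum_univ_two]
  ring

lemma gradient_basis (L : ℝ) (k : ℤ × ℤ) (x : Plane) :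
    ∇ (basis L k) x = WithLp.toLp 2
      ![2 * Real.pi * k.1 / L * trig L (-k.1) (x 0) * trig L k.2 (x 1),
        trig L k.1 (x 0) * (2 * Real.pi * k.2 / L * trig L (-k.2) (x 1))] :=
  (hasGradientAt_basis L k x).gradient

lemma integral_inner_gradient_basis {L : ℝ} (hL : 0 < L) (k l : Mode) :
    ∫ x, inner ℝ (∇ (basis L k.1) x) (∇ (basis L l.1) x) ∂squareMeasure L =
      if k = l then eigenvalue L k else 0 := by
  have e : ∀ x : Plane, inner ℝ (∇ (basis L k.1) x) (∇ (basis L l.1) x) =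
      (2 * Real.pi / L) ^ 2 * (k.1.1 * l.1.1) *
        (basis L (-k.1.1, k.1.2) x * basis L (-l.1.1, l.1.2) x) +
      (2 * Real.pi / L) ^ 2 * (k.1.2 * l.1.2) *
        (basis L (k.1.1, -k.1.2) x * basis L (l.1.1, -l.1.2) x) := by
    intro x
    rw [gradient_basis, gradient_basis]
    simp [PiLp.inner_apply, Fin.sum_univ_two, basis]
    ring
  simp only [e]
  have hi : ∀ k l, Integrable (fun x => basis L k x * basis L l x) (squareMeasure L) :=
    fun k l => (memLp_basis L k).integrable_mul (memLp_basis L l)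
  rw [integral_add ((hi _ _).const_mul _) ((hi _ _).const_mul _), integral_const_mul,
    integral_const_mul, integral_basis_mul_basis hL, integral_basis_mul_basis hL]
  by_cases h : k = l
  · subst h
    simp only [if_true, eigenvalue_eq, modeNorm_sq]
    ring
  · rw [if_neg, if_neg, if_neg h]
    · simp
    · intro h'; apply h; simp only [Prod.mk.injEq, neg_inj] at h'
      exact Subtype.ext (Prod.ext h'.1 h'.2)
    · intro h'; apply h; simp only [Prod.mk.injEq, neg_inj] at h'
      exact Subtype.ext (Prod.ext h'.1 h'.2)

/-- The vector field `∇e_k` as an element of `L²`. -/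
def gradL2 (L : ℝ) (k : Mode) : Lp Plane 2 (squareMeasure L) :=
  (memLp_gradient_basis L k.1).toLp (∇ (basis L k.1))

lemma coeFn_gradL2 (L : ℝ) (k : Mode) : gradL2 L k =ᵐ[squareMeasure L] ∇ (basis L k.1) :=
  (memLp_gradient_basis L k.1).coeFn_toLp

lemma inner_gradL2 {L : ℝ} (hL : 0 < L) (k l : Mode) :
    inner ℝ (gradL2 L k) (gradL2 L l) = if k = l then eigenvalue L k else 0 := by
  rw [L2.inner_def, ← integral_inner_gradient_basis hL]
  refine integral_congr_ae ?_
  filter_upwards [coeFn_gradL2 L k, coeFn_gradL2 L l] with x h1 h2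
  rw [h1, h2]

lemma norm_gradL2_sq {L : ℝ} (hL : 0 < L) (k : Mode) : ‖gradL2 L k‖ ^ 2 = eigenvalue L k := by
  rw [← real_inner_self_eq_norm_sq, inner_gradL2 hL, if_pos rfl]

lemma summable_smul_gradL2 {L : ℝ} (hL : 0 < L) {c : Mode → ℝ}
    (hc : Summable fun k => eigenvalue L k * c k ^ 2) :
    Summable (fun k => c k • gradL2 L k) ∧
      ‖∑' k, c k • gradL2 L k‖ ^ 2 = ∑' k, eigenvalue L k * c k ^ 2 := by
  have e : ∀ k, ‖c k • gradL2 L k‖ ^ 2 = eigenvalue L k * c k ^ 2 := by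
    intro k
    rw [norm_smul, mul_pow, norm_gradL2_sq hL, Real.norm_eq_abs, sq_abs, mul_comm]
  simp only [← e] at hc ⊢
  refine summable_of_orthogonal (fun k l hkl => ?_) hc
  beta_reduce
  rw [inner_smul_left, inner_smul_right, inner_gradL2 hL, if_neg hkl]; simp

lemma grad_eq (L : ℝ) (v : L2 L) : grad L v = ∑' k, coeffs L v k • gradL2 L k := rfl

lemma MemH.summable_one {L : ℝ} {v : L2 L} (h : MemH L 1 v) :
    Summable fun k => eigenvalue L k * coeffs L v k ^ 2 := by
  simpa only [Real.rpow_one] using h.2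

lemma normH_one (L : ℝ) (v : L2 L) :
    normH L 1 v = √(∑' k : Mode, eigenvalue L k * coeffs L v k ^ 2) := by
  simp only [normH, Real.rpow_one]

lemma normH_zero (L : ℝ) (v : L2 L) : normH L 0 v = √(∑' k : Mode, coeffs L v k ^ 2) := by
  simp only [normH, Real.rpow_zero, one_mul]

/-- If `v ∈ H¹` and `c` are coefficients of an `H¹` function then `‖∇v - ∑ c_k ∇e_k‖` is the
weighted `ℓ²` norm of the difference of the coefficients. -/
lemma norm_grad_sub_tsum {L : ℝ} (hL : 0 < L) {v : L2 L} (hv : MemH L 1 v) {c : Mode → ℝ}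
    (hc : Summable fun k => eigenvalue L k * c k ^ 2) :
    ‖grad L v - ∑' k, c k • gradL2 L k‖ ^ 2 =
      ∑' k, eigenvalue L k * (coeffs L v k - c k) ^ 2 := by
  have h1 := summable_smul_gradL2 hL hv.summable_one
  have h2 := summable_smul_gradL2 hL hc
  have h3 : Summable fun k => eigenvalue L k * (coeffs L v k - c k) ^ 2 := by
    refine Summable.of_nonneg_of_le (fun k => mul_nonneg (eigenvalue_pos hL k).le (sq_nonneg _))
      (fun k => ?_) ((hv.summable_one.mul_left 2).add (hc.mul_left 2))
    nlinarith [eigenvalue_pos hL k, mul_nonneg (eigenvalue_pos hL k).le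
      (sq_nonneg (coeffs L v k + c k))]
  rw [grad_eq, ← h1.1.tsum_sub h2.1, ← (summable_smul_gradL2 hL h3).2]
  simp only [sub_smul]

lemma norm_grad_sub {L : ℝ} (hL : 0 < L) {v w : L2 L} (hv : MemH L 1 v) (hw : MemH L 1 w) :
    ‖grad L v - grad L w‖ = normH L 1 (v - w) := by
  rw [normH_one, ← Real.sqrt_sq (norm_nonneg (grad L v - grad L w)), grad_eq L w,
    norm_grad_sub_tsum hL hv hw.summable_one]
  simp only [coeffs_sub]

lemma MemH.sub_one {L : ℝ} (hL : 0 < L) {v w : L2 L} (hv : MemH L 1 v) (hw : MemH L 1 w) :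
    MemH L 1 (v - w) := by
  refine ⟨by rw [coeff_sub, hv.1, hw.1, sub_zero], ?_⟩
  simp only [Real.rpow_one]
  refine Summable.of_nonneg_of_le (fun k => mul_nonneg (eigenvalue_pos hL k).le (sq_nonneg _))
      (fun k => ?_) ((hv.summable_one.mul_left 2).add (hw.summable_one.mul_left 2))
  rw [coeffs_sub]
  nlinarith [eigenvalue_pos hL k, mul_nonneg (eigenvalue_pos hL k).le
      (sq_nonneg (coeffs L v k + coeffs L w k))]

lemma abs_coeffs_le_normH {L : ℝ} (hL : 0 < L) {v : L2 L} (hv : MemH L 1 v) (k : Mode) :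
    |coeffs L v k| ≤ normH L 1 v / √(eigenvalue L k) := by
  have hk := eigenvalue_pos hL k
  rw [le_div_iff₀ (Real.sqrt_pos.2 hk), normH_one, mul_comm, ← Real.sqrt_sq_eq_abs,
    ← Real.sqrt_mul hk.le]
  refine Real.sqrt_le_sqrt ?_
  exact hv.summable_one.le_tsum k fun l _ => mul_nonneg (eigenvalue_pos hL l).le (sq_nonneg _)

/-! ### Riemann sums and integrals of continuous processes -/

lemma partition_mem {a b : ℝ} (hab : a ≤ b) {n i : ℕ} (hi : i ≤ n) :
    a + i * (b - a) / n ∈ Icc a b := by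
  have h0 : 0 ≤ (i : ℝ) * (b - a) / n :=
    div_nonneg (mul_nonneg (Nat.cast_nonneg _) (by linarith)) (Nat.cast_nonneg _)
  refine ⟨by linarith, ?_⟩
  have : (i : ℝ) * (b - a) / n ≤ b - a := by
    refine div_le_of_le_mul₀ (Nat.cast_nonneg _) (by linarith) ?_
    rw [mul_comm]
    exact mul_le_mul_of_nonneg_left (by exact_mod_cast hi) (by linarith)
  linarith

lemma partition_mono {a b : ℝ} (hab : a ≤ b) {n i j : ℕ} (h : i ≤ j) :
    a + i * (b - a) / n ≤ a + j * (b - a) / n := by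
  have : (i : ℝ) ≤ j := by exact_mod_cast h
  gcongr

lemma partition_sub {a b : ℝ} {n i : ℕ} :
    (a + (i + 1 : ℕ) * (b - a) / n) - (a + i * (b - a) / n) = (b - a) / n := by
  push_cast; ring

/-- The integral over `[a, b]` is the sum of the integrals over the intervals of the equidistant
partition. -/
lemma sum_integral_partition {E : Type*} [NormedAddCommGroup E] [NormedSpace ℝ E] {h : ℝ → E}
    {a b : ℝ} (hab : a ≤ b) (hc : ContinuousOn h (Icc a b)) {n : ℕ} (hn : n ≠ 0) :
    ∑ i ∈ Finset.range n, ∫ s in (a + i * (b - a) / n)..(a + (i + 1 : ℕ) * (b - a) / n), h s =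
      ∫ s in a..b, h s := by
  have := intervalIntegral.sum_integral_adjacent_intervals (μ := volume) (f := h)
    (a := fun i : ℕ => a + i * (b - a) / n) (n := n) (fun k hk => by
      refine ContinuousOn.intervalIntegrable_of_Icc (partition_mono hab k.le_succ) ?_
      exact hc.mono (Icc_subset_Icc (partition_mem hab hk.le).1 (partition_mem hab hk).2))
  rw [this]
  have hn' : (n : ℝ) ≠ 0 := by exact_mod_cast hn
  congr 1
  · simp
  · field_simp; ring

/-- Left-point sums only use the process at fixed times, so measurability and norm bounds at each
time pass to the time integral without joint measurability in time and chance. -/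
lemma tendsto_riemannSum {h : ℝ → ℝ} {a b : ℝ} (hab : a ≤ b) (hc : ContinuousOn h (Icc a b)) :
    Tendsto (fun n : ℕ => ∑ i ∈ Finset.range n, (b - a) / n * h (a + i * (b - a) / n)) atTop
      (𝓝 (∫ s in a..b, h s)) := by
  rw [Metric.tendsto_atTop]
  intro ε hε
  have huc := isCompact_Icc.uniformContinuousOn_of_continuous hc
  rw [Metric.uniformContinuousOn_iff] at huc
  -- The extra `1` covers `a = b` and gives the strict inequality at the end.
  have hη : 0 < ε / (b - a + 1) := div_pos hε (by linarith)
  obtain ⟨δ, hδ, hδ'⟩ := huc _ hη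
  obtain ⟨N, hN⟩ := exists_nat_gt ((b - a) / δ)
  refine ⟨N + 1, fun n hn => ?_⟩
  have hn0 : n ≠ 0 := by omega
  have hnp : (0 : ℝ) < n := by exact_mod_cast Nat.pos_of_ne_zero hn0
  have hnN : (N : ℝ) < n := by exact_mod_cast hn
  have hmesh : (b - a) / n < δ := by
    rw [div_lt_iff₀ hnp]
    rw [div_lt_iff₀ hδ] at hN
    nlinarith
  rw [← sum_integral_partition hab hc hn0, dist_eq_norm, ← Finset.sum_sub_distrib]
  have hterm : ∀ i ∈ Finset.range n, ‖(b - a) / n * h (a + i * (b - a) / n) -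
      ∫ s in (a + i * (b - a) / n)..(a + (i + 1 : ℕ) * (b - a) / n), h s‖ ≤
      ε / (b - a + 1) * ((b - a) / n) := by
    intro i hi
    have hin : i < n := Finset.mem_range.1 hi
    have hle := partition_mono hab (n := n) i.le_succ
    have hsub := Icc_subset_Icc (partition_mem hab hin.le).1 (partition_mem hab (n := n) hin).2
    have hint : IntervalIntegrable h volume (a + i * (b - a) / n) (a + (i + 1 : ℕ) * (b - a) / n) :=
      ContinuousOn.intervalIntegrable_of_Icc hle (hc.mono hsub)
    have e : (b - a) / n * h (a + i * (b - a) / n) = ∫ _ in (a + i * (b - a) / n)..(a + (i + 1 : ℕ) * (b - a) / n), h (a + i * (b - a) / n) := by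
      rw [intervalIntegral.integral_const, partition_sub, smul_eq_mul]
    rw [e, ← intervalIntegral.integral_sub intervalIntegrable_const hint]
    refine (intervalIntegral.norm_integral_le_of_norm_le_const (C := ε / (b - a + 1))
      fun s hs => ?_).trans ?_
    · rw [uIoc_of_le hle] at hs
      rw [← dist_eq_norm]
      refine (hδ' _ (partition_mem hab hin.le) _ (hsub ⟨hs.1.le, hs.2⟩) ?_).le
      rw [dist_comm, Real.dist_eq, abs_of_nonneg (by linarith [hs.1])]
      linarith [hs.2, partition_sub (a := a) (b := b) (n := n) (i := i)]
    · rw [partition_sub, abs_of_nonneg (div_nonneg (by linarith) hnp.le)]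
  refine (norm_sum_le_of_le _ hterm).trans_lt ?_
  rw [Finset.sum_const, Finset.card_range, nsmul_eq_mul]
  have : (n : ℝ) * (ε / (b - a + 1) * ((b - a) / n)) = ε * ((b - a) / (b - a + 1)) := by
    field_simp
  rw [this]
  have : (b - a) / (b - a + 1) < 1 := by rw [div_lt_one (by linarith)]; linarith
  nlinarith

section

variable {Ω : Type*} [MeasurableSpace Ω] {P : Measure Ω}

/-- Minkowski's inequality for the time integral of a process with continuous paths. -/
lemma eLpNorm_intervalIntegral_le {Y : ℝ → Ω → ℝ} {a b : ℝ} (hab : a ≤ b) {p : ℝ≥0∞} (hp : 1 ≤ p)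
    (hc : ∀ᵐ ω ∂P, ContinuousOn (fun s => Y s ω) (Icc a b))
    (hm : ∀ s ∈ Icc a b, AEStronglyMeasurable (Y s) P) {w : ℝ → ℝ} (hw : ContinuousOn w (Icc a b))
    (hw0 : ∀ s ∈ Icc a b, 0 ≤ w s) (hM : ∀ s ∈ Icc a b, eLpNorm (Y s) p P ≤ ENNReal.ofReal (w s)) :
    AEStronglyMeasurable (fun ω => ∫ s in a..b, Y s ω) P ∧
      eLpNorm (fun ω => ∫ s in a..b, Y s ω) p P ≤ ENNReal.ofReal (∫ s in a..b, w s) := by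
  set S : ℕ → Ω → ℝ := fun n ω =>
    ∑ i ∈ Finset.range n, (b - a) / n * Y (a + i * (b - a) / n) ω with hS
  have hSm : ∀ n, AEStronglyMeasurable (S n) P := by
    intro n
    refine Finset.aestronglyMeasurable_fun_sum _ fun i hi => ?_
    exact (hm _ (partition_mem hab (Finset.mem_range.1 hi).le)).const_mul _
  have hlim : ∀ᵐ ω ∂P, Tendsto (fun n => S n ω) atTop (𝓝 (∫ s in a..b, Y s ω)) := by
    filter_upwards [hc] with ω hω using tendsto_riemannSum hab hω
  refine ⟨aestronglyMeasurable_of_tendsto_ae atTop hSm hlim, ?_⟩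
  -- Fatou along the Riemann sums; their norms are bounded by the Riemann sums of `w`, which
  -- converge to its integral.
  refine (Lp.eLpNorm_lim_le_liminf_eLpNorm hSm _ hlim).trans ?_
  have hRS := (ENNReal.continuous_ofReal.tendsto _).comp (tendsto_riemannSum hab hw)
  rw [← hRS.liminf_eq]
  refine liminf_le_liminf (Eventually.of_forall fun n => ?_)
  have hd : 0 ≤ (b - a) / n := div_nonneg (by linarith) (Nat.cast_nonneg _)
  have e : S n = ∑ i ∈ Finset.range n, fun ω => (b - a) / n * Y (a + i * (b - a) / n) ω := by
    ext ω; simp [hS]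
  rw [e]
  refine (eLpNorm_sum_le (fun i hi =>
    (hm _ (partition_mem hab (Finset.mem_range.1 hi).le)).const_mul _) hp).trans ?_
  rw [Function.comp_apply, ENNReal.ofReal_sum_of_nonneg fun i hi =>
    mul_nonneg hd (hw0 _ (partition_mem hab (Finset.mem_range.1 hi).le))]
  refine Finset.sum_le_sum fun i hi => ?_
  refine (eLpNorm_const_smul_le (c := (b - a) / n) (f := Y (a + i * (b - a) / n))).trans ?_
  rw [Real.enorm_of_nonneg hd, ENNReal.ofReal_mul hd]
  gcongr
  exact hM _ (partition_mem hab (Finset.mem_range.1 hi).le)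

/-! ### Centered Gaussian variables -/

/-- The law `N(0, v)` is that of `√v` times a standard normal variable, so every moment norm is a
fixed multiple of the standard deviation. All variance bounds are upgraded to `L^q` in this way. -/
lemma eLpNorm_of_hasLaw_gaussianReal {Y : Ω → ℝ} {v : ℝ≥0} (hY : HasLaw Y (gaussianReal 0 v) P)
    (q : ℝ≥0∞) :
    eLpNorm Y q P = NNReal.sqrt v * eLpNorm id q (gaussianReal 0 1) := by
  have h1 : eLpNorm Y q P = eLpNorm id q (gaussianReal 0 v) := by
    rw [← hY.map_eq, eLpNorm_map_measure aestronglyMeasurable_id hY.aemeasurable]; rfl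
  have h2 : gaussianReal 0 v = (gaussianReal 0 1).map (fun x => (NNReal.sqrt v : ℝ) * x) := by
    rw [gaussianReal_map_const_mul]
    congr 1
    · simp
    · ext; simp
  rw [h1, h2, eLpNorm_map_measure aestronglyMeasurable_id (by fun_prop)]
  have := eLpNorm_const_smul (NNReal.sqrt v : ℝ) (id : ℝ → ℝ) q (gaussianReal 0 1)
  rw [show (‖(NNReal.sqrt v : ℝ)‖ₑ : ℝ≥0∞) = NNReal.sqrt v by
    rw [Real.enorm_of_nonneg (by positivity), ENNReal.ofReal_coe_nnreal]] at this
  rw [← this]; rfl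

lemma eLpNorm_two_gaussianReal : eLpNorm id 2 (gaussianReal 0 1) = 1 := by
  have h : MemLp id 2 (gaussianReal 0 1) := memLp_id_gaussianReal 2
  have h2 : Var[id; gaussianReal 0 1] = 1 := by simp
  rw [variance_of_integral_eq_zero aemeasurable_id (by simp)] at h2
  have h3 := h.eLpNorm_eq_integral_rpow_norm two_ne_zero ENNReal.ofNat_ne_top
  rw [h3]
  simp only [ENNReal.toReal_ofNat, Real.rpow_ofNat, Real.norm_eq_abs, sq_abs]
  rw [h2]; simp

lemma eLpNorm_two_of_hasLaw_gaussianReal {Y : Ω → ℝ} {v : ℝ≥0}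
    (hY : HasLaw Y (gaussianReal 0 v) P) : eLpNorm Y 2 P = NNReal.sqrt v := by
  rw [eLpNorm_of_hasLaw_gaussianReal hY, eLpNorm_two_gaussianReal, mul_one]

/-- A square integrable random variable is centered Gaussian. -/
def IsCenteredGaussian (Y : Ω → ℝ) (P : Measure Ω) : Prop :=
  HasLaw Y (gaussianReal 0 ((eLpNorm Y 2 P).toNNReal ^ 2)) P

lemma isCenteredGaussian_of_hasLaw {Y : Ω → ℝ} {v : ℝ≥0} (hY : HasLaw Y (gaussianReal 0 v) P) :
    IsCenteredGaussian Y P := by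
  unfold IsCenteredGaussian
  rw [eLpNorm_two_of_hasLaw_gaussianReal hY, ENNReal.toNNReal_coe, NNReal.sq_sqrt]
  exact hY

lemma IsCenteredGaussian.memLp {Y : Ω → ℝ} (hY : IsCenteredGaussian Y P) {q : ℝ≥0∞} (hq : q ≠ ∞) :
    MemLp Y q P := by
  refine ⟨hY.aemeasurable.aestronglyMeasurable, ?_⟩
  rw [eLpNorm_of_hasLaw_gaussianReal hY q]
  exact ENNReal.mul_lt_top ENNReal.coe_lt_top (memLp_id_gaussianReal' q hq).2

lemma isCenteredGaussian_of_hasGaussianLaw {Y : Ω → ℝ} (hY : HasGaussianLaw Y P)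
    (h0 : P[Y] = 0) : IsCenteredGaussian Y P := by
  have := hY.map_eq_gaussianReal
  rw [h0] at this
  exact isCenteredGaussian_of_hasLaw ⟨hY.aemeasurable, this⟩

lemma hasLaw_sum_of_iIndepFun [IsProbabilityMeasure P] {ι : Type*} {X : ι → Ω → ℝ} {v : ι → ℝ≥0}
    (hi : iIndepFun X P) (hX : ∀ i, HasLaw (X i) (gaussianReal 0 (v i)) P) (s : Finset ι) :
    HasLaw (fun ω => ∑ i ∈ s, X i ω) (gaussianReal 0 (∑ i ∈ s, v i)) P := by
  classical
  induction s using Finset.induction_on with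
  | empty =>
    refine ⟨by simp, ?_⟩
    simp
  | insert i s his ih =>
    have h1 := (hi.indepFun_finsetSum_of_notMem₀ (fun i => (hX i).aemeasurable) his).symm
    have h2 := gaussianReal_add_gaussianReal_of_indepFun h1 (hX i).map_eq (by
      have := ih.map_eq
      rwa [show (fun ω => ∑ i ∈ s, X i ω) = ∑ i ∈ s, X i by ext ω; simp] at this)
    refine ⟨?_, ?_⟩
    · exact Finset.aemeasurable_fun_sum _ fun i _ => (hX i).aemeasurable
    · rw [Finset.sum_insert his, ← add_zero (0 : ℝ), ← h2]
      congr 1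
      ext ω
      simp [Finset.sum_insert his]

/-- The `L²` norm is continuous. -/
lemma tendsto_eLpNorm_of_tendsto_sub {Y : ℕ → Ω → ℝ} {Z : Ω → ℝ}
    (hYm : ∀ n, AEStronglyMeasurable (Y n) P) (hZ2 : MemLp Z 2 P)
    (hlim : Tendsto (fun n => eLpNorm (Y n - Z) 2 P) atTop (𝓝 0)) :
    Tendsto (fun n => eLpNorm (Y n) 2 P) atTop (𝓝 (eLpNorm Z 2 P)) := by
  have hZ := hZ2.1
  refine tendsto_of_tendsto_of_tendsto_of_le_of_le
    (g := fun n => eLpNorm Z 2 P - eLpNorm (Y n - Z) 2 P)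
    (h := fun n => eLpNorm Z 2 P + eLpNorm (Y n - Z) 2 P) ?_ ?_ ?_ ?_
  · simpa using ENNReal.Tendsto.sub tendsto_const_nhds hlim (Or.inl hZ2.2.ne)
  · simpa using tendsto_const_nhds.add hlim
  · intro n
    refine tsub_le_iff_right.2 ?_
    have := eLpNorm_sub_le (hYm n) ((hYm n).sub hZ) (p := 2) (by norm_num)
    rwa [sub_sub_cancel] at this
  · intro n
    have := eLpNorm_add_le hZ ((hYm n).sub hZ) (p := 2) (by norm_num)
    rwa [add_sub_cancel] at this

/-- An `L²` limit of centered Gaussian variables is centered Gaussian. -/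
lemma IsCenteredGaussian.of_tendsto [IsProbabilityMeasure P] {Y : ℕ → Ω → ℝ} {Z : Ω → ℝ}
    (hY : ∀ n, IsCenteredGaussian (Y n) P) (hZ : AEStronglyMeasurable Z P)
    (hlim : Tendsto (fun n => eLpNorm (Y n - Z) 2 P) atTop (𝓝 0)) : IsCenteredGaussian Z P := by
  have hYm : ∀ n, AEStronglyMeasurable (Y n) P := fun n => (hY n).aemeasurable.aestronglyMeasurable
  have hZ2 : MemLp Z 2 P := by
    obtain ⟨n, hn⟩ := (hlim.eventually (gt_mem_nhds (zero_lt_one' ℝ≥0∞))).exists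
    have h1 : MemLp (Y n - Z) 2 P := ⟨(hYm n).sub hZ, hn.trans ENNReal.one_lt_top⟩
    have := ((hY n).memLp (q := 2) ENNReal.ofNat_ne_top).sub h1
    rwa [sub_sub_cancel] at this
  have hnorm : Tendsto (fun n => (eLpNorm (Y n) 2 P).toNNReal) atTop
      (𝓝 (eLpNorm Z 2 P).toNNReal) := by
    refine (ENNReal.tendsto_toNNReal hZ2.2.ne).comp ?_
    exact tendsto_eLpNorm_of_tendsto_sub hYm hZ2 hlim
  -- Along an almost surely convergent subsequence the characteristic functions converge to that of
  -- `Z` by dominated convergence. They also converge to the Gaussian one, because the variances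
  -- converge.
  obtain ⟨ns, hns, hae⟩ := (tendstoInMeasure_of_tendsto_eLpNorm (p := 2) two_ne_zero hYm hZ
    hlim).exists_seq_tendsto_ae
  refine ⟨hZ.aemeasurable, Measure.ext_of_charFun ?_⟩
  ext t
  have h1 : Tendsto (fun n => charFun (P.map (Y (ns n))) t) atTop (𝓝 (charFun (P.map Z) t)) := by
    simp only [charFun_apply]
    have e : ∀ Y : Ω → ℝ, AEStronglyMeasurable Y P →
        ∫ x, Complex.exp (↑(inner ℝ x t) * Complex.I) ∂(P.map Y) =
        ∫ ω, Complex.exp (↑(inner ℝ (Y ω) t) * Complex.I) ∂P := by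
      intro Y hY
      exact integral_map hY.aemeasurable (by fun_prop)
    simp only [e Z hZ, fun n => e _ (hYm n)]
    refine tendsto_integral_of_dominated_convergence (fun _ => 1) (fun n => ?_)
      (integrable_const _) (fun n => ?_) ?_
    · have hc : Continuous fun x : ℝ => Complex.exp (↑(inner ℝ x t) * Complex.I) := by fun_prop
      exact hc.comp_aestronglyMeasurable (hYm _)
    · exact Eventually.of_forall fun ω => (Complex.norm_exp_ofReal_mul_I _).le
    · filter_upwards [hae] with ω hω
      have hc : Continuous fun x : ℝ => Complex.exp (↑(inner ℝ x t) * Complex.I) := by fun_prop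
      exact (hc.tendsto _).comp hω
  refine tendsto_nhds_unique h1 ?_
  simp only [fun n => (hY n).map_eq, charFun_gaussianReal]
  have hv := ((hnorm.comp hns.tendsto_atTop).pow 2)
  have hv' := (NNReal.continuous_coe.tendsto _).comp hv
  have hc : Continuous fun x : ℝ => Complex.exp (↑t * ↑(0 : ℝ) * Complex.I - ↑x * ↑t ^ 2 / 2) := by
    fun_prop
  exact (hc.tendsto _).comp hv'

end

/-! ### Left-point sums and Ornstein-Uhlenbeck paths -/

/-- The left-point sum of `g` along the path `f` for the partition of `[0, t]` into `n` intervals. -/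
def leftSum (g : ℝ → ℝ) (t : ℝ) (n : ℕ) (f : ℝ≥0 → ℝ) : ℝ :=
  ∑ i ∈ Finset.range n, g (i * t / n) *
    (f (((i + 1 : ℕ) * t / n : ℝ)).toNNReal - f ((i * t / n : ℝ)).toNNReal)

lemma measurable_leftSum (g : ℝ → ℝ) (t : ℝ) (n : ℕ) : Measurable (leftSum g t n) := by
  unfold leftSum; fun_prop

lemma leftSum_const_mul (a : ℝ) (g : ℝ → ℝ) (t : ℝ) (n : ℕ) (f : ℝ≥0 → ℝ) :
    leftSum (fun s => a * g s) t n f = a * leftSum g t n f := by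
  simp only [leftSum, Finset.mul_sum, mul_assoc]

/-- The pathwise solution of `dx = -lam x dt + dφ`, `x(0) = φ(0)`. -/
def ou (lam : ℝ) (φ : ℝ → ℝ) (t : ℝ) : ℝ :=
  φ t - lam * ∫ s in (0 : ℝ)..t, Real.exp (-(t - s) * lam) * φ s

lemma integral_exp_mul_eq (lam : ℝ) (φ : ℝ → ℝ) (a b t : ℝ) :
    ∫ s in a..b, Real.exp (-(t - s) * lam) * φ s =
      Real.exp (-t * lam) * ∫ s in a..b, Real.exp (s * lam) * φ s := by
  rw [← intervalIntegral.integral_const_mul]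
  congr 1; ext s
  rw [← mul_assoc, ← Real.exp_add]
  congr 2; ring

lemma continuous_ou (lam : ℝ) {φ : ℝ → ℝ} (hφ : Continuous φ) : Continuous (ou lam φ) := by
  have h : ou lam φ = fun t => φ t - lam * (Real.exp (-t * lam) *
      ∫ s in (0 : ℝ)..t, Real.exp (s * lam) * φ s) := by
    ext t; rw [ou, integral_exp_mul_eq]
  rw [h]
  have h2 : Continuous fun t => ∫ s in (0 : ℝ)..t, Real.exp (s * lam) * φ s :=
    intervalIntegral.continuous_primitive
      (fun a b => Continuous.intervalIntegrable (by fun_prop) a b) 0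
  fun_prop

lemma integral_lam_exp (lam a b t : ℝ) :
    ∫ s in a..b, lam * Real.exp (-(t - s) * lam) =
      Real.exp (-(t - b) * lam) - Real.exp (-(t - a) * lam) := by
  rw [intervalIntegral.integral_eq_sub_of_hasDerivAt (f := fun s => Real.exp (-(t - s) * lam))]
  · intro s _
    have h : HasDerivAt (fun s : ℝ => -(t - s) * lam) lam s := by
      have := (((hasDerivAt_id s).const_sub t).neg.mul_const lam)
      simpa using this
    simpa [mul_comm] using h.exp
  · exact Continuous.intervalIntegrable (by fun_prop) _ _

/-- Summation by parts moves the increments from the path to the exponential, whose increment over a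
cell is the integral of `lam * exp`. Comparison with the integral in `ou` leaves only the
oscillation of `φ` inside each cell, so the pathwise formula represents the Itô integral. -/
lemma leftSum_sub_ou {lam t : ℝ} (ht : 0 ≤ t) {f : ℝ≥0 → ℝ} {φ : ℝ → ℝ} (hφ : Continuous φ)
    (hφ0 : φ 0 = 0) (hf : ∀ s, 0 ≤ s → φ s = f s.toNNReal) {n : ℕ} (hn : n ≠ 0) :
    leftSum (fun s => Real.exp (-(t - s) * lam)) t n f - ou lam φ t =
      ∑ i ∈ Finset.range n, ∫ s in (i * t / n : ℝ)..((i + 1 : ℕ) * t / n),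
        lam * Real.exp (-(t - s) * lam) * (φ s - φ ((i + 1 : ℕ) * t / n)) := by
  have hpos : ∀ i : ℕ, 0 ≤ (i * t / n : ℝ) := fun i => by positivity
  have e1 : ∀ i : ℕ, ∫ s in (i * t / n : ℝ)..((i + 1 : ℕ) * t / n),
      lam * Real.exp (-(t - s) * lam) * (φ s - φ ((i + 1 : ℕ) * t / n)) =
      lam * (∫ s in (i * t / n : ℝ)..((i + 1 : ℕ) * t / n), Real.exp (-(t - s) * lam) * φ s) -
      (Real.exp (-(t - (i + 1 : ℕ) * t / n) * lam) - Real.exp (-(t - i * t / n) * lam)) *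
        φ ((i + 1 : ℕ) * t / n) := by
    intro i
    simp only [mul_sub]
    rw [intervalIntegral.integral_sub, intervalIntegral.integral_mul_const, integral_lam_exp,
      ← intervalIntegral.integral_const_mul]
    · simp only [mul_assoc]
    · exact Continuous.intervalIntegrable (by fun_prop) _ _
    · exact Continuous.intervalIntegrable (by fun_prop) _ _
  have e2 : ∑ i ∈ Finset.range n, ∫ s in (i * t / n : ℝ)..((i + 1 : ℕ) * t / n),
      Real.exp (-(t - s) * lam) * φ s = ∫ s in (0 : ℝ)..t, Real.exp (-(t - s) * lam) * φ s := by
    have := sum_integral_partition (h := fun s => Real.exp (-(t - s) * lam) * φ s) ht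
      (Continuous.continuousOn (by fun_prop)) hn
    simpa only [zero_add, sub_zero] using this
  have e3 : leftSum (fun s => Real.exp (-(t - s) * lam)) t n f = ∑ i ∈ Finset.range n,
      Real.exp (-(t - i * t / n) * lam) * (φ ((i + 1 : ℕ) * t / n) - φ (i * t / n)) := by
    refine Finset.sum_congr rfl fun i _ => ?_
    rw [hf _ (hpos i), hf _ (hpos (i + 1))]
  simp only [e1]
  rw [Finset.sum_sub_distrib, ← Finset.mul_sum, e2, e3, ou]
  -- The boundary term telescopes to `φ t`, because `φ 0 = 0` and the exponential equals `1` at the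
  -- final time.
  have e4 := Finset.sum_range_sub (fun i : ℕ => Real.exp (-(t - i * t / n) * lam) * φ (i * t / n)) n
  have hnt : (n : ℝ) * t / n = t := by field_simp
  simp only [hnt, sub_self, neg_zero, zero_mul, Real.exp_zero, one_mul, Nat.cast_zero, zero_div,
    hφ0, mul_zero, sub_zero] at e4
  rw [← e4]
  have e5 : ∑ i ∈ Finset.range n, Real.exp (-(t - i * t / n) * lam) *
      (φ ((i + 1 : ℕ) * t / n) - φ (i * t / n)) + ∑ i ∈ Finset.range n,
      (Real.exp (-(t - (i + 1 : ℕ) * t / n) * lam) - Real.exp (-(t - i * t / n) * lam)) *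
        φ ((i + 1 : ℕ) * t / n) = ∑ i ∈ Finset.range n,
      (Real.exp (-(t - (i + 1 : ℕ) * t / n) * lam) * φ ((i + 1 : ℕ) * t / n) -
        Real.exp (-(t - i * t / n) * lam) * φ (i * t / n)) := by
    rw [← Finset.sum_add_distrib]
    refine Finset.sum_congr rfl fun i _ => ?_
    ring
  rw [← e5]
  ring

/-- The three terms are the fresh increment of the path, the damping of that increment, and the
damping of the past. Each will be of order `√(t - t')` in `L²`, with a constant independent of
`lam`. -/
lemma ou_sub_ou {lam t t' : ℝ} {φ : ℝ → ℝ} (hφ : Continuous φ) :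
    ou lam φ t - ou lam φ t' = (φ t - φ t') -
      (∫ s in t'..t, lam * Real.exp (-(t - s) * lam) * (φ s - φ t')) -
      (1 - Real.exp (-(t - t') * lam)) * ou lam φ t' := by
  have i0 : ∀ a b t : ℝ, IntervalIntegrable (fun s => Real.exp (-(t - s) * lam) * φ s) volume a b :=
    fun a b t => Continuous.intervalIntegrable (by fun_prop) _ _
  have e1 : ∫ s in t'..t, lam * Real.exp (-(t - s) * lam) * (φ s - φ t') =
      lam * (∫ s in t'..t, Real.exp (-(t - s) * lam) * φ s) -
        (1 - Real.exp (-(t - t') * lam)) * φ t' := by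
    simp only [mul_sub]
    rw [intervalIntegral.integral_sub, intervalIntegral.integral_mul_const, integral_lam_exp,
      ← intervalIntegral.integral_const_mul]
    · simp only [mul_assoc]; simp
    · exact Continuous.intervalIntegrable (by fun_prop) _ _
    · exact Continuous.intervalIntegrable (by fun_prop) _ _
  have e2 := intervalIntegral.integral_add_adjacent_intervals (i0 0 t' t) (i0 t' t t)
  have e3 : ∫ s in (0 : ℝ)..t', Real.exp (-(t - s) * lam) * φ s =
      Real.exp (-(t - t') * lam) * ∫ s in (0 : ℝ)..t', Real.exp (-(t' - s) * lam) * φ s := by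
    rw [integral_exp_mul_eq, integral_exp_mul_eq, ← mul_assoc, ← Real.exp_add]
    congr 2; ring
  rw [e1, ou, ou, ← e2, e3]
  ring

/-! ### Laws of left-point sums and continuous versions of Brownian paths -/

section

variable {Ω : Type*} [MeasurableSpace Ω] {P : Measure Ω}

/-- The increments over the grid are independent centered Gaussians of variance `t / n`, so the
variances of the weighted terms add up. -/
lemma hasLaw_leftSum [IsProbabilityMeasure P] {B : ℝ≥0 → Ω → ℝ} (hB : IsPreBrownianReal B P)
    (g : ℝ → ℝ) {t : ℝ} (ht : 0 ≤ t) (n : ℕ) :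
    HasLaw (fun ω => leftSum g t n (B · ω))
      (gaussianReal 0 (∑ i ∈ Finset.range n, (t / n * g (i * t / n) ^ 2)).toNNReal) P := by
  set τ : Fin (n + 1) → ℝ≥0 := fun i => ((i : ℕ) * t / n : ℝ).toNNReal with hτ
  have hτm : Monotone τ := by
    intro i j hij
    refine Real.toNNReal_le_toNNReal ?_
    have : ((i : ℕ) : ℝ) ≤ (j : ℕ) := by exact_mod_cast hij
    gcongr
  have h1 := hB.hasIndepIncrements n τ hτm
  have h2 := h1.comp (fun (i : Fin n) x => g ((i : ℕ) * t / n) * x) (fun i => by fun_prop)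
  have h3 : ∀ i : Fin n, HasLaw ((fun x => g ((i : ℕ) * t / n) * x) ∘
      fun ω => B (τ i.succ) ω - B (τ i.castSucc) ω)
      (gaussianReal 0 (t / n * g ((i : ℕ) * t / n) ^ 2).toNNReal) P := by
    intro i
    have h4 := gaussianReal_const_mul (hB.hasLaw_sub (τ i.succ) (τ i.castSucc)) (g ((i : ℕ) * t / n))
    rw [mul_zero] at h4
    have h5 : ∀ j : ℕ, (((j : ℝ) * t / n).toNNReal).1 = (j : ℝ) * t / n :=
      fun j => Real.coe_toNNReal _ (by positivity)
    have h6 : ((i.succ : Fin (n + 1)) : ℕ) * t / n - ((i.castSucc : Fin (n + 1)) : ℕ) * t / n = t / n := by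
      simp; ring
    have h7 : (t / n * g ((i : ℕ) * t / n) ^ 2).toNNReal =
        NNReal.mk (g ((i : ℕ) * t / n) ^ 2) (sq_nonneg _) * nndist (τ i.succ).1 (τ i.castSucc).1 := by
      refine NNReal.eq ?_
      rw [Real.coe_toNNReal _ (by positivity), NNReal.coe_mul, NNReal.coe_mk, coe_nndist,
        Real.dist_eq, hτ, h5, h5, h6, abs_of_nonneg (by positivity), mul_comm]
    rw [h7]
    exact h4
  have h4 := hasLaw_sum_of_iIndepFun h2 h3 Finset.univ
  rw [Finset.sum_range, Real.toNNReal_sum_of_nonneg fun i _ => by positivity]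
  convert h4 using 1
  ext ω
  simp [leftSum, Finset.sum_range, hτ]

/-- The path `f`, replaced by `0` if it is not continuous or does not start in `0`. -/
def contPath (f : ℝ≥0 → ℝ) (t : ℝ) : ℝ :=
  open scoped Classical in if Continuous f ∧ f 0 = 0 then f t.toNNReal else 0

lemma continuous_contPath (f : ℝ≥0 → ℝ) : Continuous (contPath f) := by
  unfold contPath
  split_ifs with h
  · exact h.1.comp continuous_real_toNNReal
  · exact continuous_const

lemma contPath_zero (f : ℝ≥0 → ℝ) : contPath f 0 = 0 := by
  unfold contPath
  split_ifs with h
  · simpa using h.2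
  · rfl

lemma ae_contPath_eq {B : ℝ≥0 → Ω → ℝ} (hB : IsBrownianReal B P) :
    ∀ᵐ ω ∂P, ∀ t, contPath (B · ω) t = B t.toNNReal ω := by
  filter_upwards [hB.cont, hB.eval_zero_ae_eq_zero] with ω h1 h2 t
  rw [contPath, if_pos ⟨h1, h2⟩]

lemma aestronglyMeasurable_contPath {B : ℝ≥0 → Ω → ℝ} (hB : IsBrownianReal B P) (t : ℝ) :
    AEStronglyMeasurable (fun ω => contPath (B · ω) t) P := by
  refine (hB.aemeasurable t.toNNReal).aestronglyMeasurable.congr ?_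
  filter_upwards [ae_contPath_eq hB] with ω h using (h t).symm

lemma eLpNorm_contPath_sub {B : ℝ≥0 → Ω → ℝ} (hB : IsBrownianReal B P) {s t : ℝ} (hs : 0 ≤ s)
    (ht : 0 ≤ t) :
    eLpNorm (fun ω => contPath (B · ω) s - contPath (B · ω) t) 2 P = ENNReal.ofReal √|s - t| := by
  have h := eLpNorm_two_of_hasLaw_gaussianReal (hB.hasLaw_sub s.toNNReal t.toNNReal)
  have e : eLpNorm (fun ω => contPath (B · ω) s - contPath (B · ω) t) 2 P =
      eLpNorm (B s.toNNReal - B t.toNNReal) 2 P := by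
    refine eLpNorm_congr_ae ?_
    filter_upwards [ae_contPath_eq hB] with ω hω
    rw [hω, hω]; rfl
  rw [e, h, ← ENNReal.ofReal_coe_nnreal, Real.coe_sqrt]
  congr 2
  rw [coe_nndist, Real.dist_eq]
  have h5 : ∀ j : ℝ, 0 ≤ j → (j.toNNReal).1 = j := fun j hj => Real.coe_toNNReal _ hj
  rw [h5 _ hs, h5 _ ht]

end

/-! ### The Ornstein-Uhlenbeck process as a Wiener integral -/

section

variable {Ω : Type*} [MeasurableSpace Ω] {P : Measure Ω}

/-- The Ornstein-Uhlenbeck process driven by `B`. -/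
def ouProcess (lam : ℝ) (B : ℝ≥0 → Ω → ℝ) (t : ℝ) (ω : Ω) : ℝ := ou lam (contPath (B · ω)) t

omit [MeasurableSpace Ω] in
lemma continuous_ouProcess (lam : ℝ) (B : ℝ≥0 → Ω → ℝ) (ω : Ω) :
    Continuous fun t => ouProcess lam B t ω := continuous_ou lam (continuous_contPath _)

lemma exp_neg_sub_mul_le_one {lam s t : ℝ} (hlam : 0 ≤ lam) (hst : s ≤ t) :
    Real.exp (-(t - s) * lam) ≤ 1 := by
  rw [Real.exp_le_one_iff]; nlinarith [mul_nonneg (sub_nonneg.2 hst) hlam]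

lemma aestronglyMeasurable_ouProcess {B : ℝ≥0 → Ω → ℝ} (hB : IsBrownianReal B P) (lam : ℝ) {t : ℝ}
    (ht : 0 ≤ t) : AEStronglyMeasurable (ouProcess lam B t) P := by
  have hm := aestronglyMeasurable_contPath hB
  refine (hm t).sub (AEStronglyMeasurable.const_mul ?_ lam)
  have hc : ∀ ω, Continuous fun s => Real.exp (-(t - s) * lam) * contPath (B · ω) s := fun ω => by
    have := continuous_contPath (B · ω)
    fun_prop
  refine aestronglyMeasurable_of_tendsto_ae atTop (f := fun n : ℕ => fun ω =>
    ∑ i ∈ Finset.range n, (t - 0) / n *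
      (Real.exp (-(t - (0 + i * (t - 0) / n)) * lam) * contPath (B · ω) (0 + i * (t - 0) / n)))
    (fun n => ?_) (Eventually.of_forall fun ω => tendsto_riemannSum ht (hc ω).continuousOn)
  exact Finset.aestronglyMeasurable_fun_sum _ fun i _ => ((hm _).const_mul _).const_mul _

/-- In each of the `n` cells of length `t / n` the weight is at most `lam` and the Brownian
increment has `L²` norm at most `√(t / n)`. -/
lemma eLpNorm_leftSum_sub_ouProcess [IsProbabilityMeasure P] {B : ℝ≥0 → Ω → ℝ}
    (hB : IsBrownianReal B P) {lam t : ℝ}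
    (hlam : 0 ≤ lam) (ht : 0 ≤ t) {n : ℕ} (hn : n ≠ 0) :
    eLpNorm (fun ω => leftSum (fun s => Real.exp (-(t - s) * lam)) t n (B · ω) -
      ouProcess lam B t ω) 2 P ≤ ENNReal.ofReal (t * (lam * √(t / n))) := by
  have hm := aestronglyMeasurable_contPath hB
  have h1 : ∀ i ∈ Finset.range n, AEStronglyMeasurable
      (fun ω => ∫ s in (i * t / n : ℝ)..((i + 1 : ℕ) * t / n), lam * Real.exp (-(t - s) * lam) *
        (contPath (B · ω) s - contPath (B · ω) ((i + 1 : ℕ) * t / n))) P ∧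
      eLpNorm (fun ω => ∫ s in (i * t / n : ℝ)..((i + 1 : ℕ) * t / n),
        lam * Real.exp (-(t - s) * lam) *
        (contPath (B · ω) s - contPath (B · ω) ((i + 1 : ℕ) * t / n))) 2 P ≤
        ENNReal.ofReal (∫ _ in (i * t / n : ℝ)..((i + 1 : ℕ) * t / n), lam * √(t / n)) := by
    intro i hi
    have hin := Finset.mem_range.1 hi
    have hle : (i * t / n : ℝ) ≤ (i + 1 : ℕ) * t / n := by
      have := partition_mono ht (n := n) i.le_succ
      simpa using this
    have hlt : ((i + 1 : ℕ) * t / n : ℝ) ≤ t := by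
      have := (partition_mem ht (n := n) (i := i + 1) hin).2
      simpa using this
    have hd : ((i + 1 : ℕ) * t / n : ℝ) - i * t / n = t / n := by push_cast; ring
    have h0 : (0 : ℝ) ≤ i * t / n := by positivity
    refine eLpNorm_intervalIntegral_le hle (by norm_num) (Eventually.of_forall fun ω => ?_)
      (fun s _ => ((hm _).sub (hm _)).const_mul _) continuousOn_const (fun s _ => by positivity)
      fun s hs => ?_
    · have := continuous_contPath (B · ω)
      simp only [Pi.sub_apply]
      exact Continuous.continuousOn (by fun_prop)
    · refine (eLpNorm_const_smul_le (c := lam * Real.exp (-(t - s) * lam))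
        (f := fun ω => contPath (B · ω) s - contPath (B · ω) ((i + 1 : ℕ) * t / n))).trans ?_
      rw [eLpNorm_contPath_sub hB (h0.trans hs.1) (h0.trans hle), Real.enorm_of_nonneg (by positivity),
        ← ENNReal.ofReal_mul (by positivity)]
      refine ENNReal.ofReal_le_ofReal ?_
      have h3 := exp_neg_sub_mul_le_one hlam (hs.2.trans hlt)
      have h4 : |s - (i + 1 : ℕ) * t / n| ≤ t / n := by
        rw [abs_le]; constructor <;> linarith [hs.1, hs.2, h0, hd, (by positivity : 0 ≤ t / n)]
      have h5 := Real.sqrt_le_sqrt h4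
      exact mul_le_mul (mul_le_of_le_one_right hlam h3) h5 (by positivity) hlam
  have e : eLpNorm (fun ω => leftSum (fun s => Real.exp (-(t - s) * lam)) t n (B · ω) -
      ouProcess lam B t ω) 2 P = eLpNorm (∑ i ∈ Finset.range n,
      (fun ω => ∫ s in (i * t / n : ℝ)..((i + 1 : ℕ) * t / n), lam * Real.exp (-(t - s) * lam) *
        (contPath (B · ω) s - contPath (B · ω) ((i + 1 : ℕ) * t / n)))) 2 P := by
    refine eLpNorm_congr_ae ?_
    filter_upwards [ae_contPath_eq hB] with ω hω
    rw [ouProcess, leftSum_sub_ou ht (continuous_contPath _) (contPath_zero _)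
      (fun s _ => hω s) hn]
    simp
  rw [e]
  refine (eLpNorm_sum_le (fun i hi => (h1 i hi).1) (by norm_num)).trans ?_
  refine (Finset.sum_le_sum fun i hi => (h1 i hi).2).trans ?_
  have hd : ∀ i : ℕ, ((i + 1 : ℕ) * t / n : ℝ) - i * t / n = t / n := fun i => by push_cast; ring
  simp only [intervalIntegral.integral_const, hd, smul_eq_mul]
  rw [Finset.sum_const, Finset.card_range, nsmul_eq_mul, ← ENNReal.ofReal_natCast,
    ← ENNReal.ofReal_mul (by positivity)]
  refine le_of_eq ?_
  congr 1
  have : (n : ℝ) ≠ 0 := by exact_mod_cast hn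
  field_simp

lemma tendsto_leftSum_sub_ouProcess [IsProbabilityMeasure P] {B : ℝ≥0 → Ω → ℝ}
    (hB : IsBrownianReal B P) {lam t : ℝ} (hlam : 0 ≤ lam) (ht : 0 ≤ t) :
    Tendsto (fun n : ℕ => eLpNorm ((fun ω => leftSum (fun s => Real.exp (-(t - s) * lam)) t n (B · ω)) -
      ouProcess lam B t) 2 P) atTop (𝓝 0) := by
  have h1 : Tendsto (fun n : ℕ => ENNReal.ofReal (t * (lam * √(t / n)))) atTop (𝓝 0) := by
    rw [← ENNReal.ofReal_zero]
    refine (ENNReal.continuous_ofReal.tendsto _).comp ?_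
    have h2 : Tendsto (fun n : ℕ => t / (n : ℝ)) atTop (𝓝 0) :=
      tendsto_const_div_atTop_nhds_zero_nat t
    have h3 := ((Real.continuous_sqrt.tendsto 0).comp h2).const_mul lam |>.const_mul t
    simpa using h3
  refine tendsto_of_tendsto_of_tendsto_of_le_of_le' tendsto_const_nhds h1
    (Eventually.of_forall fun _ => zero_le) ?_
  filter_upwards [eventually_gt_atTop 0] with n hn
  exact eLpNorm_leftSum_sub_ouProcess hB hlam ht hn.ne'

lemma isCenteredGaussian_ouProcess [IsProbabilityMeasure P] {B : ℝ≥0 → Ω → ℝ}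
    (hB : IsBrownianReal B P) {lam t : ℝ} (hlam : 0 ≤ lam) (ht : 0 ≤ t) :
    IsCenteredGaussian (ouProcess lam B t) P :=
  IsCenteredGaussian.of_tendsto
    (fun n => isCenteredGaussian_of_hasLaw (hasLaw_leftSum hB.toIsPreBrownianReal _ ht n))
    (aestronglyMeasurable_ouProcess hB lam ht) (tendsto_leftSum_sub_ouProcess hB hlam ht)

/-- Itô isometry: the variances of the left-point sums are Riemann sums of the squared exponential.
-/
lemma eLpNorm_ouProcess [IsProbabilityMeasure P] {B : ℝ≥0 → Ω → ℝ}
    (hB : IsBrownianReal B P) {lam t : ℝ} (hlam : 0 < lam) (ht : 0 ≤ t) :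
    eLpNorm (ouProcess lam B t) 2 P =
      ENNReal.ofReal √((1 - Real.exp (-(2 * lam * t))) / (2 * lam)) := by
  have hL := fun n => hasLaw_leftSum hB.toIsPreBrownianReal (fun s => Real.exp (-(t - s) * lam)) ht n
  have h1 := tendsto_eLpNorm_of_tendsto_sub (fun n => (hL n).aemeasurable.aestronglyMeasurable)
    ((isCenteredGaussian_ouProcess hB hlam.le ht).memLp ENNReal.ofNat_ne_top)
    (tendsto_leftSum_sub_ouProcess hB hlam.le ht)
  refine tendsto_nhds_unique h1 ?_
  have h2 : ∫ s in (0 : ℝ)..t, Real.exp (-(t - s) * lam) ^ 2 =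
      (1 - Real.exp (-(2 * lam * t))) / (2 * lam) := by
    have h3 := integral_lam_exp (2 * lam) 0 t t
    rw [intervalIntegral.integral_const_mul] at h3
    have h4 : ∀ s, Real.exp (-(t - s) * lam) ^ 2 = Real.exp (-(t - s) * (2 * lam)) := by
      intro s; rw [← Real.exp_nat_mul]; congr 1; push_cast; ring
    simp only [h4]
    rw [eq_div_iff (by positivity), mul_comm, h3, sub_self, neg_zero, zero_mul, Real.exp_zero]
    congr 3; ring
  have h3 := tendsto_riemannSum ht (h := fun s => Real.exp (-(t - s) * lam) ^ 2)
    (Continuous.continuousOn (by fun_prop))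
  rw [h2] at h3
  have h4 := (ENNReal.continuous_ofReal.comp Real.continuous_sqrt).tendsto _ |>.comp h3
  refine h4.congr fun n => ?_
  simp only [Function.comp_apply]
  rw [eLpNorm_two_of_hasLaw_gaussianReal (hL n), ← ENNReal.ofReal_coe_nnreal, Real.coe_sqrt,
    Real.coe_toNNReal _ (Finset.sum_nonneg fun i _ => by positivity)]
  simp

lemma eLpNorm_ouProcess_le [IsProbabilityMeasure P] {B : ℝ≥0 → Ω → ℝ}
    (hB : IsBrownianReal B P) {lam t : ℝ} (hlam : 0 < lam) (ht : 0 ≤ t) :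
    eLpNorm (ouProcess lam B t) 2 P ≤ ENNReal.ofReal (1 / √lam) := by
  have h1 : 1 / √lam = √(1 / lam) := by rw [Real.sqrt_div zero_le_one, Real.sqrt_one]
  rw [eLpNorm_ouProcess hB hlam ht, h1]
  refine ENNReal.ofReal_le_ofReal (Real.sqrt_le_sqrt ?_)
  rw [div_le_div_iff₀ (by positivity) hlam]
  nlinarith [Real.exp_pos (-(2 * lam * t))]

lemma one_sub_exp_neg_le_sqrt {x : ℝ} (hx : 0 ≤ x) : 1 - Real.exp (-x) ≤ √x := by
  refine Real.le_sqrt_of_sq_le ?_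
  have h1 := Real.add_one_le_exp (-x)
  have h2 := Real.exp_pos (-x)
  have h3 : Real.exp (-x) ≤ 1 := Real.exp_le_one_iff.2 (by linarith)
  nlinarith

/-- Each of the three terms of `ou_sub_ou` is at most `√(t - t')`: the Brownian increment directly,
the integral because the weight has mass at most one, and the damped past because `1 - e^{-x} ≤ √x`
compensates the standard deviation `1 / √lam`. -/
lemma eLpNorm_ouProcess_sub_le [IsProbabilityMeasure P] {B : ℝ≥0 → Ω → ℝ}
    (hB : IsBrownianReal B P) {lam t t' : ℝ} (hlam : 0 < lam) (ht' : 0 ≤ t') (htt : t' ≤ t) :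
    eLpNorm (fun ω => ouProcess lam B t ω - ouProcess lam B t' ω) 2 P ≤
      ENNReal.ofReal (3 * √(t - t')) := by
  have ht := ht'.trans htt
  have hm := aestronglyMeasurable_contPath hB
  have hd : 0 ≤ t - t' := sub_nonneg.2 htt
  set I : Ω → ℝ := fun ω => ∫ s in t'..t, lam * Real.exp (-(t - s) * lam) *
    (contPath (B · ω) s - contPath (B · ω) t') with hI
  have h1 := eLpNorm_intervalIntegral_le (P := P) (p := 2) (a := t') (b := t)
    (Y := fun s ω => lam * Real.exp (-(t - s) * lam) * (contPath (B · ω) s - contPath (B · ω) t'))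
    (w := fun s => lam * Real.exp (-(t - s) * lam) * √(t - t')) htt (by norm_num)
    (Eventually.of_forall fun ω => by
      have := continuous_contPath (B · ω)
      exact Continuous.continuousOn (by fun_prop))
    (fun s _ => ((hm _).sub (hm _)).const_mul _) (Continuous.continuousOn (by fun_prop))
    (fun s _ => by positivity) (fun s hs => by
      refine (eLpNorm_const_smul_le (c := lam * Real.exp (-(t - s) * lam))
        (f := fun ω => contPath (B · ω) s - contPath (B · ω) t')).trans ?_
      rw [eLpNorm_contPath_sub hB (ht'.trans hs.1) ht', Real.enorm_of_nonneg (by positivity),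
        ← ENNReal.ofReal_mul (by positivity)]
      refine ENNReal.ofReal_le_ofReal ?_
      have : |s - t'| ≤ t - t' := by
        rw [abs_of_nonneg (by linarith [hs.1])]; linarith [hs.2]
      gcongr)
  have e : (fun ω => ouProcess lam B t ω - ouProcess lam B t' ω) =
      (fun ω => contPath (B · ω) t - contPath (B · ω) t') - I -
        (1 - Real.exp (-(t - t') * lam)) • ouProcess lam B t' := by
    ext ω
    exact ou_sub_ou (continuous_contPath _)
  have hX := aestronglyMeasurable_ouProcess hB lam ht'
  have hexp : 0 ≤ 1 - Real.exp (-(t - t') * lam) := by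
    linarith [exp_neg_sub_mul_le_one hlam.le htt]
  rw [e]
  refine (eLpNorm_sub_le (((hm t).sub (hm t')).sub h1.1) (hX.const_smul _) (by norm_num)).trans ?_
  refine (add_le_add (eLpNorm_sub_le ((hm t).sub (hm t')) h1.1 (by norm_num))
    eLpNorm_const_smul_le).trans ?_
  have b1 := eLpNorm_contPath_sub hB ht ht'
  rw [abs_of_nonneg hd] at b1
  have b2 : eLpNorm I 2 P ≤ ENNReal.ofReal √(t - t') := by
    refine h1.2.trans (ENNReal.ofReal_le_ofReal ?_)
    rw [intervalIntegral.integral_mul_const, integral_lam_exp]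
    refine mul_le_of_le_one_left (Real.sqrt_nonneg _) ?_
    simp [Real.exp_nonneg]
  have b3 : ‖1 - Real.exp (-(t - t') * lam)‖ₑ * eLpNorm (ouProcess lam B t') 2 P ≤
      ENNReal.ofReal √(t - t') := by
    rw [Real.enorm_of_nonneg hexp]
    refine (mul_le_mul_right (eLpNorm_ouProcess_le hB hlam ht') _).trans ?_
    rw [← ENNReal.ofReal_mul hexp]
    refine ENNReal.ofReal_le_ofReal ?_
    have h2 := one_sub_exp_neg_le_sqrt (mul_nonneg hd hlam.le)
    rw [← neg_mul, Real.sqrt_mul hd] at h2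
    have h3 : 0 < √lam := Real.sqrt_pos.2 hlam
    rw [mul_one_div, div_le_iff₀ h3]
    exact h2
  have := add_le_add (add_le_add b1.le b2) b3
  refine this.trans ?_
  rw [← ENNReal.ofReal_add (by positivity) (by positivity),
    ← ENNReal.ofReal_add (by positivity) (by positivity)]
  refine ENNReal.ofReal_le_ofReal (by linarith)

/-- The Ornstein-Uhlenbeck process is almost surely a measurable function of the path. -/
lemma exists_measurable_ouProcess [IsProbabilityMeasure P] {B : ℝ≥0 → Ω → ℝ}
    (hB : IsBrownianReal B P) {lam t : ℝ} (hlam : 0 ≤ lam) (ht : 0 ≤ t) :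
    ∃ Ψ : (ℝ≥0 → ℝ) → ℝ, Measurable Ψ ∧ ouProcess lam B t =ᵐ[P] fun ω => Ψ (B · ω) := by
  have hL := fun n => hasLaw_leftSum hB.toIsPreBrownianReal (fun s => Real.exp (-(t - s) * lam)) ht n
  obtain ⟨ns, -, hae⟩ := (tendstoInMeasure_of_tendsto_eLpNorm (p := 2) two_ne_zero
    (fun n => (hL n).aemeasurable.aestronglyMeasurable)
    (aestronglyMeasurable_ouProcess hB lam ht)
    (tendsto_leftSum_sub_ouProcess hB hlam ht)).exists_seq_tendsto_ae
  -- Independence of the Brownian motions refers to the product σ-algebra on paths, where continuity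
  -- is not a measurable event. The limsup of left-point sums is a functional measurable there.
  refine ⟨fun f => limsup (fun n => leftSum (fun s => Real.exp (-(t - s) * lam)) t (ns n) f) atTop,
    Measurable.limsup fun n => measurable_leftSum _ _ _, ?_⟩
  filter_upwards [hae] with ω hω using hω.limsup_eq.symm

lemma isWienerIntegral_ouProcess [IsProbabilityMeasure P] {B : ℝ≥0 → Ω → ℝ}
    (hB : IsBrownianReal B P) {lam t : ℝ} (hlam : 0 ≤ lam) (ht : 0 ≤ t) (a : ℝ) :
    IsWienerIntegral P B (fun s => a * Real.exp (-(t - s) * lam)) t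
      (fun ω => a * ouProcess lam B t ω) := by
  refine ⟨((isCenteredGaussian_ouProcess hB hlam ht).memLp ENNReal.ofNat_ne_top).const_mul a, ?_⟩
  have h := ENNReal.Tendsto.const_mul (tendsto_leftSum_sub_ouProcess hB hlam ht)
    (Or.inr (enorm_ne_top (x := a)))
  rw [mul_zero] at h
  refine h.congr fun n => ?_
  rw [← eLpNorm_const_smul]
  congr 1
  ext ω
  have := leftSum_const_mul a (fun s => Real.exp (-(t - s) * lam)) t n (B · ω)
  rw [leftSum] at this
  rw [this]
  simp [mul_sub]

lemma IsWienerIntegral.ae_eq [IsProbabilityMeasure P] {B : ℝ≥0 → Ω → ℝ}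
    (hB : IsBrownianReal B P) {g : ℝ → ℝ} {t : ℝ}
    {X Y : Ω → ℝ} (hX : IsWienerIntegral P B g t X) (hY : IsWienerIntegral P B g t Y) :
    X =ᵐ[P] Y := by
  have hS : ∀ n, AEStronglyMeasurable (fun ω => leftSum g t n (B · ω)) P := fun n => by
    refine AEMeasurable.aestronglyMeasurable ?_
    exact Finset.aemeasurable_fun_sum _ fun i _ =>
      ((hB.aemeasurable _).sub (hB.aemeasurable _)).const_mul _
  have hb : ∀ n, eLpNorm (X - Y) 2 P ≤
      eLpNorm (fun ω => leftSum g t n (B · ω) - Y ω) 2 P +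
      eLpNorm (fun ω => leftSum g t n (B · ω) - X ω) 2 P := by
    intro n
    have h := eLpNorm_sub_le ((hS n).sub hY.1.1) ((hS n).sub hX.1.1) (p := 2) (by norm_num)
    rwa [sub_sub_sub_cancel_left] at h
  have h0 : eLpNorm (X - Y) 2 P = 0 := by
    refine le_antisymm ?_ zero_le
    have h1 := hY.2.add hX.2
    rw [add_zero] at h1
    exact ge_of_tendsto' h1 hb
  have := (eLpNorm_eq_zero_iff (hX.1.1.sub hY.1.1) two_ne_zero).1 h0
  filter_upwards [this] with ω hω
  exact sub_eq_zero.1 hω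

end

/-! ### Gaussian combinations of modes at two times -/

section

variable {Ω : Type*} [MeasurableSpace Ω] {P : Measure Ω}

/-- A linear combination of two values of an Ornstein-Uhlenbeck process is centered Gaussian. -/
lemma isCenteredGaussian_ouProcess_add [IsProbabilityMeasure P] {B : ℝ≥0 → Ω → ℝ}
    (hB : IsBrownianReal B P) {lam t t' : ℝ} (hlam : 0 ≤ lam) (ht : 0 ≤ t) (ht' : 0 ≤ t')
    (c c' : ℝ) :
    IsCenteredGaussian (fun ω => c * ouProcess lam B t ω + c' * ouProcess lam B t' ω) P := by
  set g : ℝ → ℝ → ℝ := fun t s => Real.exp (-(t - s) * lam) with hg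
  have hL := fun t ht n => hasLaw_leftSum (t := t) hB.toIsPreBrownianReal (g t) ht n
  have hX := fun t ht => aestronglyMeasurable_ouProcess (t := t) hB lam ht
  have hLm := fun t ht n => (hL t ht n).aemeasurable.aestronglyMeasurable
  refine IsCenteredGaussian.of_tendsto
    (Y := fun n ω => c * leftSum (g t) t n (B · ω) + c' * leftSum (g t') t' n (B · ω))
    (fun n => isCenteredGaussian_of_hasGaussianLaw ?_ ?_)
    (((hX t ht).const_mul c).add ((hX t' ht').const_mul c')) ?_
  -- Each index contributes four Brownian values, the grid endpoints for `t` and for `t'`; joint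
  -- Gaussianity of the Brownian motion covers the two different grids at once.
  · set τ : ℕ × Fin 4 → ℝ≥0 := fun p => ![(((p.1 + 1 : ℕ) * t / n : ℝ)).toNNReal,
      ((p.1 * t / n : ℝ)).toNNReal, (((p.1 + 1 : ℕ) * t' / n : ℝ)).toNNReal,
      ((p.1 * t' / n : ℝ)).toNNReal] p.2 with hτ
    set a : ℕ × Fin 4 → ℝ := fun p => ![c * g t (p.1 * t / n), -(c * g t (p.1 * t / n)),
      c' * g t' (p.1 * t' / n), -(c' * g t' (p.1 * t' / n))] p.2 with ha
    have h := ((hB.isGaussianProcess.comp_right τ).smul a).hasGaussianLaw_fun_sum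
      (I := Finset.range n ×ˢ Finset.univ)
    refine h.congr (Eventually.of_forall fun ω => ?_)
    beta_reduce
    rw [Finset.sum_product, leftSum, leftSum, Finset.mul_sum, Finset.mul_sum,
      ← Finset.sum_add_distrib]
    refine Finset.sum_congr rfl fun i _ => ?_
    simp only [Fin.sum_univ_four, hτ, ha, Function.comp_apply, smul_eq_mul, Matrix.cons_val]
    ring
  · have hi : ∀ t ht, Integrable (fun ω => leftSum (g t) t n (B · ω)) P := fun t ht =>
      ((isCenteredGaussian_of_hasLaw (hL t ht n)).memLp (q := 1) ENNReal.one_ne_top).integrable le_rfl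
    have h0 : ∀ t ht, ∫ ω, leftSum (g t) t n (B · ω) ∂P = 0 := fun t ht => by
      rw [(hL t ht n).integral_eq, integral_id_gaussianReal]
    rw [integral_add ((hi t ht).const_mul _) ((hi t' ht').const_mul _), integral_const_mul,
      integral_const_mul, h0 t ht, h0 t' ht']
    simp
  · have h1 := ENNReal.Tendsto.const_mul (tendsto_leftSum_sub_ouProcess hB hlam ht)
      (Or.inr (enorm_ne_top (x := c)))
    have h2 := ENNReal.Tendsto.const_mul (tendsto_leftSum_sub_ouProcess hB hlam ht')
      (Or.inr (enorm_ne_top (x := c')))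
    have h3 := h1.add h2
    rw [mul_zero, mul_zero, add_zero] at h3
    refine tendsto_of_tendsto_of_tendsto_of_le_of_le tendsto_const_nhds h3
      (fun _ => zero_le) fun n => ?_
    simp only [← eLpNorm_const_smul]
    refine (le_of_eq ?_).trans (eLpNorm_add_le (((hLm t ht n).sub (hX t ht)).const_smul c)
      (((hLm t' ht' n).sub (hX t' ht')).const_smul c') (by norm_num))
    congr 1
    ext ω
    simp only [Pi.sub_apply, Pi.add_apply, Pi.smul_apply, smul_eq_mul, hg]
    ring

/-- The Ornstein-Uhlenbeck process of the mode `k`, i.e. `∫_0^t e^{-(t-s) μ_k²} dβ_k(s)`. -/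
def modeProcess (L : ℝ) (β : Mode → ℝ≥0 → Ω → ℝ) (k : Mode) (t : ℝ) (ω : Ω) : ℝ :=
  ouProcess (eigenvalue L k ^ 2) (β k) t ω

/-- Finite sums over the modes of linear combinations at two times are centered Gaussian, and the
variances add up. -/
lemma hasLaw_sum_modeProcess [IsProbabilityMeasure P] {β : Mode → ℝ≥0 → Ω → ℝ}
    (hβ : IsCylindricalWiener P β) (L : ℝ) {t t' : ℝ} (ht : 0 ≤ t) (ht' : 0 ≤ t')
    (c c' : Mode → ℝ) (F : Finset Mode) :
    HasLaw (fun ω => ∑ k ∈ F, (c k * modeProcess L β k t ω + c' k * modeProcess L β k t' ω))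
      (gaussianReal 0 (∑ k ∈ F, (eLpNorm (fun ω => c k * modeProcess L β k t ω +
        c' k * modeProcess L β k t' ω) 2 P).toNNReal ^ 2)) P := by
  have hlam : ∀ k, 0 ≤ eigenvalue L k ^ 2 := fun k => sq_nonneg _
  choose Ψ hΨ hΨe using fun k => exists_measurable_ouProcess (hβ.brownian k) (hlam k) ht
  choose Ψ' hΨ' hΨe' using fun k => exists_measurable_ouProcess (hβ.brownian k) (hlam k) ht'
  -- Independence is inherited through the measurable functionals of the paths and then passed to
  -- the processes by almost sure equality.
  have h1 := hβ.indep.comp (fun k f => c k * Ψ k f + c' k * Ψ' k f)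
    (fun k => ((hΨ k).const_mul _).add ((hΨ' k).const_mul _))
  have h2 : iIndepFun (fun k ω => c k * modeProcess L β k t ω + c' k * modeProcess L β k t' ω) P := by
    refine h1.congr fun k => ?_
    filter_upwards [hΨe k, hΨe' k] with ω e1 e2
    simp only [modeProcess, e1, e2, Function.comp_apply]
  exact hasLaw_sum_of_iIndepFun h2 (fun k => isCenteredGaussian_ouProcess_add (hβ.brownian k)
    (hlam k) ht ht' (c k) (c' k)) F

end

/-! ### Dyadic chaining on the unit cube -/

/-- The dyadic point `v / 2^n`. -/
def dyadicPoint (n : ℕ) (v : Fin 3 → ℕ) : Fin 3 → ℝ := fun i => (v i : ℝ) / 2 ^ n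

/-- The lattice approximation of `x` from below with mesh `2^{-n}`. -/
def dyadicFloor (n : ℕ) (x : Fin 3 → ℝ) : Fin 3 → ℕ := fun i => ⌊2 ^ n * x i⌋₊

/-- Refining by one level appends one binary digit per coordinate, so successive approximations of a
point differ only by the increments counted in the chaining. -/
lemma dyadicFloor_succ {x : Fin 3 → ℝ} (hx : ∀ i, x i ∈ Icc (0 : ℝ) 1) (n : ℕ) :
    ∃ e : Fin 3 → Fin 2, dyadicFloor (n + 1) x = fun i => 2 * dyadicFloor n x i + e i := by
  have : ∀ i, ∃ e : Fin 2, dyadicFloor (n + 1) x i = 2 * dyadicFloor n x i + e := by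
    intro i
    simp only [dyadicFloor]
    have h0 : 0 ≤ 2 ^ n * x i := mul_nonneg (by positivity) (hx i).1
    have h1 := Nat.floor_le h0
    have h2 := Nat.lt_floor_add_one (2 ^ n * x i)
    have h3 : (2 : ℝ) ^ (n + 1) * x i = 2 * (2 ^ n * x i) := by ring
    rw [h3]
    set y := 2 ^ n * x i
    by_cases h : 2 * y < 2 * (⌊y⌋₊ : ℝ) + 1
    · refine ⟨0, ?_⟩
      rw [Nat.floor_eq_iff (by linarith)]
      push_cast
      constructor <;> simp <;> linarith
    · refine ⟨1, ?_⟩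
      rw [Nat.floor_eq_iff (by linarith)]
      push_cast
      constructor <;> simp <;> linarith
  choose e he using this
  exact ⟨e, funext he⟩

lemma dyadicFloor_le {x : Fin 3 → ℝ} (hx : ∀ i, x i ∈ Icc (0 : ℝ) 1) (n : ℕ) (i : Fin 3) :
    dyadicFloor n x i ≤ 2 ^ n := by
  refine Nat.floor_le_of_le ?_
  push_cast
  exact mul_le_of_le_one_right (by positivity) (hx i).2

lemma tendsto_dyadicPoint {x : Fin 3 → ℝ} (hx : ∀ i, x i ∈ Icc (0 : ℝ) 1) :
    Tendsto (fun n => dyadicPoint n (dyadicFloor n x)) atTop (𝓝 x) := by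
  rw [tendsto_pi_nhds]
  intro i
  have h1 : Tendsto (fun n : ℕ => x i - (1 / 2 : ℝ) ^ n) atTop (𝓝 (x i)) := by
    simpa using (tendsto_const_nhds (x := x i)).sub
      (tendsto_pow_atTop_nhds_zero_of_lt_one (by norm_num : (0 : ℝ) ≤ 1 / 2) (by norm_num))
  refine tendsto_of_tendsto_of_tendsto_of_le_of_le h1 tendsto_const_nhds (fun n => ?_) fun n => ?_
  · have h2 := Nat.lt_floor_add_one (2 ^ n * x i)
    simp only [dyadicPoint, dyadicFloor]
    rw [one_div, inv_pow, ← one_div, sub_le_iff_le_add, ← add_div, le_div_iff₀ (by positivity)]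
    linarith
  · have h1 := Nat.floor_le (mul_nonneg (by positivity : (0 : ℝ) ≤ 2 ^ n) (hx i).1)
    simp only [dyadicPoint, dyadicFloor]
    rw [div_le_iff₀ (by positivity)]
    linarith

/-- A continuous function on the cube is controlled by its increments along the dyadic points. -/
lemma abs_le_of_dyadic {h : (Fin 3 → ℝ) → ℝ} (hc : Continuous h) {b ρ : ℝ} (hb : 0 ≤ b)
    (hρ : 0 ≤ ρ) (hρ1 : ρ < 1)
    (h0 : ∀ v : Fin 3 → ℕ, (∀ i, v i ≤ 1) → |h (dyadicPoint 0 v)| ≤ b)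
    (hinc : ∀ n, ∀ v : Fin 3 → ℕ, (∀ i, v i ≤ 2 ^ n) → ∀ e : Fin 3 → Fin 2,
      |h (dyadicPoint (n + 1) fun i => 2 * v i + e i) - h (dyadicPoint n v)| ≤ b * ρ ^ n)
    {x : Fin 3 → ℝ} (hx : ∀ i, x i ∈ Icc (0 : ℝ) 1) : |h x| ≤ b * (1 + (1 - ρ)⁻¹) := by
  have hn : ∀ n, |h (dyadicPoint n (dyadicFloor n x))| ≤ b * (1 + ∑ m ∈ Finset.range n, ρ ^ m) := by
    intro n
    induction n with
    | zero =>
      simpa using h0 _ (fun i => by simpa using dyadicFloor_le hx 0 i)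
    | succ n ih =>
      obtain ⟨e, he⟩ := dyadicFloor_succ hx n
      have h1 := hinc n _ (dyadicFloor_le hx n) e
      rw [← he] at h1
      rw [Finset.sum_range_succ]
      have h2 := abs_sub_abs_le_abs_sub (h (dyadicPoint (n + 1) (dyadicFloor (n + 1) x)))
        (h (dyadicPoint n (dyadicFloor n x)))
      linarith
  have hlim := ((hc.tendsto x).comp (tendsto_dyadicPoint hx)).abs
  refine le_of_tendsto' hlim fun n => (hn n).trans ?_
  refine mul_le_mul_of_nonneg_left ?_ hb
  have hs := (summable_geometric_of_lt_one hρ hρ1).sum_le_tsum (Finset.range n)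
    (fun i _ => by positivity)
  rw [tsum_geometric_of_lt_one hρ hρ1] at hs
  linarith

/-- The number `2^{-1/16}`. -/
def chainRatio : ℝ := (1 / 2) ^ (1 / 16 : ℝ)

lemma chainRatio_pow : chainRatio ^ 16 = 1 / 2 := by
  rw [chainRatio, ← Real.rpow_natCast, ← Real.rpow_mul (by norm_num)]
  norm_num

lemma chainRatio_pos : 0 < chainRatio := by unfold chainRatio; positivity

lemma chainRatio_lt_one : chainRatio < 1 :=
  Real.rpow_lt_one (by norm_num) (by norm_num) (by norm_num)

/-- Moment bound for the supremum of a random field on the cube: if the field and its increments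
between neighbouring dyadic points of the level `n` are bounded in `L^q` by `A` and `A 2^{-n/8}`
then the supremum is bounded in `L^q` by a multiple of `A`. -/
lemma eLpNorm_sup_le {Ω : Type*} [MeasurableSpace Ω] {P : Measure Ω} {q : ℕ} (hq : 64 ≤ q)
    {h : (Fin 3 → ℝ) → Ω → ℝ} (hc : ∀ ω, Continuous fun x => h x ω)
    (hm : ∀ x, (∀ i, 0 ≤ x i) → AEStronglyMeasurable (h x) P) {A : ℝ≥0∞}
    (h0 : ∀ v : Fin 3 → ℕ, (∀ i, v i ≤ 1) → eLpNorm (h (dyadicPoint 0 v)) q P ≤ A)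
    (hinc : ∀ n, ∀ v : Fin 3 → ℕ, (∀ i, v i ≤ 2 ^ n) → ∀ e : Fin 3 → Fin 2,
      eLpNorm (h (dyadicPoint (n + 1) fun i => 2 * v i + e i) - h (dyadicPoint n v)) q P ≤
        A * ENNReal.ofReal (chainRatio ^ (2 * n)))
    {S : Ω → ℝ} (hS : ∀ ω, ∀ K, (∀ x : Fin 3 → ℝ, (∀ i, x i ∈ Icc (0 : ℝ) 1) → |h x ω| ≤ K) →
      |S ω| ≤ K) :
    eLpNorm S q P ≤ 136 * ENNReal.ofReal (1 + (1 - chainRatio)⁻¹) * A := by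
  set r := chainRatio with hr
  have hr0 : 0 < r := chainRatio_pos
  have hr1 : r < 1 := chainRatio_lt_one
  have hq0 : q ≠ 0 := by omega
  have hdp : ∀ n v i, 0 ≤ dyadicPoint n v i := fun n v i => by simp only [dyadicPoint]; positivity
  have hpow : ∀ f : Ω → ℝ, eLpNorm f q P ^ q = ∫⁻ ω, ‖f ω‖ₑ ^ q ∂P := by
    intro f
    have := eLpNorm_nnreal_pow_eq_lintegral (f := f) (μ := P) (p := (q : ℝ≥0)) (by exact_mod_cast hq0)
    simpa only [NNReal.coe_natCast, ENNReal.coe_natCast, ENNReal.rpow_natCast] using this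
  set G0 : Finset (Fin 3 → ℕ) := Fintype.piFinset fun _ => Finset.range (1 + 1) with hG0
  set G : ℕ → Finset (Fin 3 → ℕ) := fun n => Fintype.piFinset fun _ => Finset.range (2 ^ n + 1) with hG
  set D : ℕ → (Fin 3 → ℕ) → (Fin 3 → Fin 2) → Ω → ℝ := fun n v e =>
    h (dyadicPoint (n + 1) fun i => 2 * v i + e i) - h (dyadicPoint n v) with hD
  have hDm : ∀ n v e, AEStronglyMeasurable (D n v e) P := fun n v e =>
    (hm _ (hdp _ _)).sub (hm _ (hdp _ _))
  -- With these weights `B` dominates the rescaled `q`-th power of every single increment. For `b =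
  -- B^{1/q}` all increments of level `n` are therefore at most `b * r ^ n`, and the geometric
  -- series bounds the supremum.
  set κ : ℕ → ℝ≥0∞ := fun n => ENNReal.ofReal ((r ^ n)⁻¹ ^ q) with hκ
  set B : Ω → ℝ≥0∞ := fun ω => ∑ v ∈ G0, ‖h (dyadicPoint 0 v) ω‖ₑ ^ q +
    ∑' n, κ n * ∑ v ∈ G n, ∑ e, ‖D n v e ω‖ₑ ^ q with hB
  set c : ℝ := 1 + (1 - r)⁻¹ with hcdef
  have hc0 : 0 < c := by have : 0 < 1 - r := by linarith
                         positivity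
  have hpt : ∀ ω, ‖S ω‖ₑ ^ q ≤ ENNReal.ofReal c ^ q * B ω := by
    intro ω
    by_cases hBt : B ω = ∞
    · rw [hBt, ENNReal.mul_top]
      · exact le_top
      · exact pow_ne_zero _ (by simpa using hc0)
    set b : ℝ := (B ω).toReal ^ (1 / q : ℝ) with hb
    have hb0 : 0 ≤ b := by positivity
    have hbq : b ^ q = (B ω).toReal := by
      rw [hb, ← Real.rpow_natCast, ← Real.rpow_mul ENNReal.toReal_nonneg]
      rw [one_div_mul_cancel (by exact_mod_cast hq0), Real.rpow_one]
    have key : ∀ y : ℝ, ∀ a : ℝ, 0 < a → ENNReal.ofReal (a⁻¹ ^ q) * ‖y‖ₑ ^ q ≤ B ω → |y| ≤ b * a := by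
      intro y a ha hy
      have h1 := ENNReal.toReal_mono hBt hy
      rw [ENNReal.toReal_mul, ENNReal.toReal_pow, toReal_enorm, ENNReal.toReal_ofReal (by positivity),
        ← hbq, ← mul_pow, Real.norm_eq_abs] at h1
      have h2 := le_of_pow_le_pow_left₀ hq0 hb0 h1
      rw [inv_mul_le_iff₀ ha] at h2
      linarith
    have h3 : |S ω| ≤ b * c := by
      refine hS ω _ fun x hx => ?_
      refine abs_le_of_dyadic (hc ω) hb0 hr0.le hr1 (fun v hv => ?_) (fun n v hv e => ?_) hx
      · have := key (h (dyadicPoint 0 v) ω) 1 one_pos (by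
          simp only [inv_one, one_pow, ENNReal.ofReal_one, one_mul, hB]
          refine le_trans ?_ le_self_add
          exact Finset.single_le_sum (f := fun v => ‖h (dyadicPoint 0 v) ω‖ₑ ^ q)
            (fun _ _ => zero_le) (by simp [hG0, hv]))
        simpa using this
      · refine key (D n v e ω) (r ^ n) (by positivity) ?_
        refine le_trans ?_ le_add_self
        refine le_trans ?_ (ENNReal.le_tsum n)
        refine mul_le_mul_right ?_ _
        refine le_trans ?_ (Finset.single_le_sum (f := fun v => ∑ e, ‖D n v e ω‖ₑ ^ q)
          (fun _ _ => zero_le) (by simp [hG, hv] : v ∈ G n))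
        exact Finset.single_le_sum (f := fun e => ‖D n v e ω‖ₑ ^ q)
          (fun _ _ => zero_le) (Finset.mem_univ e)
    have h4 : |S ω| ^ q ≤ c ^ q * (B ω).toReal := by
      rw [← hbq, ← mul_pow, mul_comm]
      exact pow_le_pow_left₀ (abs_nonneg _) h3 q
    rw [← ENNReal.ofReal_toReal hBt, ← ENNReal.ofReal_pow hc0.le, ← ENNReal.ofReal_mul (by positivity),
      Real.enorm_eq_ofReal_abs, ← ENNReal.ofReal_pow (abs_nonneg _)]
    exact ENNReal.ofReal_le_ofReal h4
  have hBi : ∫⁻ ω, B ω ∂P ≤ 136 * A ^ q := by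
    have e1 : ∫⁻ ω, B ω ∂P = ∑ v ∈ G0, ∫⁻ ω, ‖h (dyadicPoint 0 v) ω‖ₑ ^ q ∂P +
        ∑' n, κ n * ∑ v ∈ G n, ∑ e, ∫⁻ ω, ‖D n v e ω‖ₑ ^ q ∂P := by
      have m1 : ∀ v, AEMeasurable (fun ω => ‖h (dyadicPoint 0 v) ω‖ₑ ^ q) P := fun v =>
        ((hm _ (hdp _ _)).enorm).pow_const _
      have m2 : ∀ n v e, AEMeasurable (fun ω => ‖D n v e ω‖ₑ ^ q) P := fun n v e =>
        (hDm n v e).enorm.pow_const _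
      have m3 : ∀ n v, AEMeasurable (fun ω => ∑ e, ‖D n v e ω‖ₑ ^ q) P := fun n v =>
        Finset.aemeasurable_fun_sum _ fun e _ => m2 n v e
      have m4 : ∀ n, AEMeasurable (fun ω => ∑ v ∈ G n, ∑ e, ‖D n v e ω‖ₑ ^ q) P := fun n =>
        Finset.aemeasurable_fun_sum _ fun v _ => m3 n v
      rw [lintegral_add_left' (Finset.aemeasurable_fun_sum _ fun v _ => m1 v),
        lintegral_finsetSum' _ fun v _ => m1 v, lintegral_tsum fun n => (m4 n).const_mul _]
      congr 2
      ext n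
      rw [lintegral_const_mul'' _ (m4 n), lintegral_finsetSum' _ fun v _ => m3 n v]
      congr 2
      ext v
      rw [lintegral_finsetSum' _ fun e _ => m2 n v e]
    rw [e1]
    have b1 : ∑ v ∈ G0, ∫⁻ ω, ‖h (dyadicPoint 0 v) ω‖ₑ ^ q ∂P ≤ 8 * A ^ q := by
      refine (Finset.sum_le_sum (g := fun _ => A ^ q) fun v hv => ?_).trans ?_
      · rw [← hpow]
        refine pow_le_pow_left' (h0 v fun i => ?_) q
        have := Fintype.mem_piFinset.1 hv i
        simp at this; omega
      · rw [Finset.sum_const, hG0, Fintype.card_piFinset]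
        simp
    -- Level `n` has at most `8 * 8 ^ n` points with `8` refinements each. A weighted moment is at
    -- most `A ^ q * r ^ (n * q)`, and `q ≥ 64` gives `r ^ q ≤ 1 / 16`, which beats `8 ^ n`. The
    -- levels sum to `128`, and the `8` vertices of the cube give `136`.
    have b2 : ∀ n, κ n * ∑ v ∈ G n, ∑ e, ∫⁻ ω, ‖D n v e ω‖ₑ ^ q ∂P ≤
        ENNReal.ofReal (64 * (1 / 2) ^ n) * A ^ q := by
      intro n
      have b3 : ∑ v ∈ G n, ∑ e : Fin 3 → Fin 2, ∫⁻ ω, ‖D n v e ω‖ₑ ^ q ∂P ≤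
          ∑ v ∈ G n, ∑ e : Fin 3 → Fin 2, (A * ENNReal.ofReal (r ^ (2 * n))) ^ q := by
        refine Finset.sum_le_sum fun v hv => Finset.sum_le_sum fun e _ => ?_
        rw [← hpow]
        refine pow_le_pow_left' (hinc n v (fun i => ?_) e) q
        have := Fintype.mem_piFinset.1 hv i
        simp at this; omega
      refine (mul_le_mul_right b3 _).trans ?_
      rw [Finset.sum_const, Finset.sum_const, hG, Fintype.card_piFinset]
      simp only [Finset.card_range, Finset.prod_const, Finset.card_univ, Fintype.card_fin,
        Fintype.card_pi, nsmul_eq_mul]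
      rw [mul_pow, ← ENNReal.ofReal_pow (by positivity), hκ, ← ENNReal.ofReal_natCast,
        ← ENNReal.ofReal_natCast]
      have e2 : ENNReal.ofReal ((r ^ n)⁻¹ ^ q) * (ENNReal.ofReal ((2 ^ n + 1) ^ 3 : ℕ) *
          (ENNReal.ofReal (2 ^ 3 : ℕ) * (A ^ q * ENNReal.ofReal ((r ^ (2 * n)) ^ q)))) =
          ENNReal.ofReal ((r ^ n)⁻¹ ^ q * (((2 ^ n + 1) ^ 3 : ℕ) * ((2 ^ 3 : ℕ) * (r ^ (2 * n)) ^ q))) * A ^ q := by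
        rw [ENNReal.ofReal_mul (by positivity), ENNReal.ofReal_mul (by positivity),
          ENNReal.ofReal_mul (by positivity)]
        ring
      refine (le_of_eq e2).trans ?_
      refine mul_le_mul_left (ENNReal.ofReal_le_ofReal ?_) _
      push_cast
      have e3 : (r ^ n)⁻¹ ^ q * (r ^ (2 * n)) ^ q = (r ^ n) ^ q := by
        rw [← mul_pow]; congr 1
        rw [mul_comm 2 n, pow_mul, sq]; field_simp
      have e4 : (r ^ n) ^ q ≤ (1 / 16) ^ n := by
        rw [← pow_mul, mul_comm, pow_mul]
        refine pow_le_pow_left₀ (by positivity) ?_ n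
        refine (pow_le_pow_of_le_one hr0.le hr1.le hq).trans ?_
        rw [show 64 = 16 * 4 by norm_num, pow_mul, hr, chainRatio_pow]
        norm_num
      have e5 : ((2 : ℝ) ^ n + 1) ^ 3 ≤ 8 * 8 ^ n := by
        have h1 : (1 : ℝ) ≤ 2 ^ n := one_le_pow₀ (by norm_num)
        have h2 : ((2 : ℝ) ^ n + 1) ^ 3 ≤ (2 * 2 ^ n) ^ 3 := pow_le_pow_left₀ (by positivity) (by linarith) 3
        refine h2.trans (le_of_eq ?_)
        rw [mul_pow, ← pow_mul, mul_comm n 3, pow_mul]; norm_num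
      calc (r ^ n)⁻¹ ^ q * ((2 ^ n + 1) ^ 3 * (8 * (r ^ (2 * n)) ^ q))
          = (2 ^ n + 1) ^ 3 * 2 ^ 3 * ((r ^ n)⁻¹ ^ q * (r ^ (2 * n)) ^ q) := by ring
        _ = (2 ^ n + 1) ^ 3 * 2 ^ 3 * (r ^ n) ^ q := by rw [e3]
        _ ≤ (8 * 8 ^ n) * 2 ^ 3 * (1 / 16) ^ n := by gcongr
        _ = 64 * (8 * (1 / 16)) ^ n := by rw [mul_pow]; ring
        _ = 64 * (1 / 2) ^ n := by norm_num
    have b4 : ∑' n, ENNReal.ofReal (64 * (1 / 2) ^ n) * A ^ q = 128 * A ^ q := by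
      rw [ENNReal.tsum_mul_right, ← ENNReal.ofReal_tsum_of_nonneg (fun n => by positivity)
        ((summable_geometric_of_lt_one (by norm_num) (by norm_num)).mul_left _), tsum_mul_left,
        tsum_geometric_of_lt_one (by norm_num) (by norm_num)]
      norm_num
    refine (add_le_add b1 (ENNReal.tsum_le_tsum b2)).trans ?_
    rw [b4, ← add_mul]
    norm_num
  have hfin : eLpNorm S q P ^ q ≤ (136 * ENNReal.ofReal c * A) ^ q := by
    rw [hpow]
    refine (lintegral_mono hpt).trans ?_
    rw [lintegral_const_mul' _ _ (ENNReal.pow_ne_top ENNReal.ofReal_ne_top)]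
    refine (mul_le_mul_right hBi _).trans ?_
    rw [mul_pow, mul_pow]
    -- Enlarging `136` to its `q`-th power gives a constant independent of `q` after the root.
    have : (136 : ℝ≥0∞) ≤ 136 ^ q := le_self_pow₀ (by norm_num) hq0
    calc ENNReal.ofReal c ^ q * (136 * A ^ q) = 136 * ENNReal.ofReal c ^ q * A ^ q := by ring
      _ ≤ _ := by gcongr
  exact (ENNReal.pow_le_pow_left_iff hq0).1 hfin

/-! ### Bounds for the basis functions -/

lemma abs_trig_sub_le {L : ℝ} (hL : 0 < L) (m : ℤ) (z z' : ℝ) :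
    |trig L m z - trig L m z'| ≤ √(2 / L) * (2 * Real.pi * |(m : ℝ)| / L) * |z - z'| := by
  have h := Convex.norm_image_sub_le_of_norm_hasDerivWithin_le (s := univ) (f := trig L m)
    (C := √(2 / L) * (2 * Real.pi * |(m : ℝ)| / L))
    (fun x _ => (hasDerivAt_trig L m x).hasDerivWithinAt) (fun x _ => ?_) convex_univ
    (mem_univ z') (mem_univ z)
  · exact h
  · rw [Real.norm_eq_abs, abs_mul, mul_comm]
    have h1 : |2 * Real.pi * (m : ℝ) / L| = 2 * Real.pi * |(m : ℝ)| / L := by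
      rw [abs_div, abs_mul, abs_of_pos hL, abs_of_pos (by positivity : 0 < 2 * Real.pi)]
    rw [h1]
    exact mul_le_mul_of_nonneg_right (abs_trig_le hL _ _) (by positivity)

lemma abs_basis_le {L : ℝ} (hL : 0 < L) (k : ℤ × ℤ) (x : Plane) : |basis L k x| ≤ 2 / L := by
  rw [basis, abs_mul]
  have := mul_le_mul (abs_trig_le hL k.1 (x 0)) (abs_trig_le hL k.2 (x 1)) (abs_nonneg _)
    (Real.sqrt_nonneg _)
  rwa [Real.mul_self_sqrt (by positivity)] at this

lemma abs_fst_le_modeNorm (k : Mode) : |(k.1.1 : ℝ)| ≤ modeNorm k :=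
  Real.abs_le_sqrt (by nlinarith [sq_nonneg (k.1.2 : ℝ)])

lemma abs_snd_le_modeNorm (k : Mode) : |(k.1.2 : ℝ)| ≤ modeNorm k :=
  Real.abs_le_sqrt (by nlinarith [sq_nonneg (k.1.1 : ℝ)])

lemma abs_basis_sub_le {L : ℝ} (hL : 0 < L) (k : Mode) {x y : Plane} {d : ℝ}
    (h0 : |y 0 - x 0| ≤ d) (h1 : |y 1 - x 1| ≤ d) :
    |basis L k.1 y - basis L k.1 x| ≤ 2 / L * (2 * (2 * Real.pi / L)) * modeNorm k * d := by
  have hd : 0 ≤ d := (abs_nonneg _).trans h0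
  have hN := one_le_modeNorm k
  have hN0 : 0 < modeNorm k := by linarith
  have hs : √(2 / L) * √(2 / L) = 2 / L := Real.mul_self_sqrt (by positivity)
  have e : basis L k.1 y - basis L k.1 x =
      trig L k.1.1 (y 0) * (trig L k.1.2 (y 1) - trig L k.1.2 (x 1)) +
      (trig L k.1.1 (y 0) - trig L k.1.1 (x 0)) * trig L k.1.2 (x 1) := by
    simp only [basis]; ring
  have b1 : |trig L k.1.2 (y 1) - trig L k.1.2 (x 1)| ≤ √(2 / L) * (2 * Real.pi * modeNorm k / L) * d := by
    refine (abs_trig_sub_le hL _ _ _).trans ?_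
    have := abs_snd_le_modeNorm k
    gcongr
  have b2 : |trig L k.1.1 (y 0) - trig L k.1.1 (x 0)| ≤ √(2 / L) * (2 * Real.pi * modeNorm k / L) * d := by
    refine (abs_trig_sub_le hL _ _ _).trans ?_
    have := abs_fst_le_modeNorm k
    gcongr
  rw [e]
  refine (abs_add_le _ _).trans ?_
  rw [abs_mul, abs_mul]
  have c1 := mul_le_mul (abs_trig_le hL k.1.1 (y 0)) b1 (abs_nonneg _) (Real.sqrt_nonneg _)
  have c2 := mul_le_mul b2 (abs_trig_le hL k.1.2 (x 1)) (abs_nonneg _) (by positivity)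
  refine (add_le_add c1 c2).trans (le_of_eq ?_)
  calc √(2 / L) * (√(2 / L) * (2 * Real.pi * modeNorm k / L) * d) +
      √(2 / L) * (2 * Real.pi * modeNorm k / L) * d * √(2 / L)
      = (√(2 / L) * √(2 / L)) * (2 * (2 * Real.pi * modeNorm k / L) * d) := by ring
    _ = _ := by rw [hs]; ring

/-- Geometric interpolation with weights `1/4` and `3/4`. Giving up a quarter of the decay
`|k|^{-2}` leaves `|k|^{-3/2}`, whose square is still summable over the planar lattice. -/
lemma le_of_le_of_le_pow_four {x a b m : ℝ} (hx : 0 ≤ x) (ha : x ≤ a) (hb : x ≤ b) (hm : 0 ≤ m)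
    (h : a * b ^ 3 ≤ m ^ 4) : x ≤ m := by
  refine le_of_pow_le_pow_left₀ (n := 4) (by norm_num) hm (le_trans ?_ h)
  calc x ^ 4 = x * x ^ 3 := by ring
    _ ≤ a * b ^ 3 := mul_le_mul ha (pow_le_pow_left₀ hx hb 3) (by positivity) (hx.trans ha)

/-- A constant that depends only on `L` and `T`. -/
def fieldConst (L T : ℝ) : ℝ :=
  2 / L * (1 + 24 * √T / (2 * Real.pi / L) ^ 6) +
    (2 / L * (2 * (2 * Real.pi / L)) * L + 4 / L + 2 / L) / (2 * Real.pi / L) ^ 2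

lemma fieldConst_nonneg {L T : ℝ} (hL : 0 < L) : 0 ≤ fieldConst L T := by
  unfold fieldConst; positivity

/-! ### Variance bounds for single modes -/

section

variable {Ω : Type*} [MeasurableSpace Ω] {P : Measure Ω}

lemma eLpNorm_modeProcess_le [IsProbabilityMeasure P] {β : Mode → ℝ≥0 → Ω → ℝ}
    (hβ : IsCylindricalWiener P β) {L : ℝ} (hL : 0 < L) {t : ℝ} (ht : 0 ≤ t) (k : Mode) :
    eLpNorm (modeProcess L β k t) 2 P ≤
      ENNReal.ofReal (1 / ((2 * Real.pi / L) ^ 2 * modeNorm k ^ 2)) := by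
  have hk := eigenvalue_pos hL k
  have h := eLpNorm_ouProcess_le (hβ.brownian k) (lam := eigenvalue L k ^ 2) (by positivity) ht
  rw [Real.sqrt_sq hk.le] at h
  rwa [← eigenvalue_eq]

lemma aestronglyMeasurable_modeProcess {β : Mode → ℝ≥0 → Ω → ℝ} (hβ : IsCylindricalWiener P β)
    (L : ℝ) {t : ℝ} (ht : 0 ≤ t) (k : Mode) : AEStronglyMeasurable (modeProcess L β k t) P :=
  aestronglyMeasurable_ouProcess (hβ.brownian k) _ ht

/-- The increment bound is of order `ρ ^ 4`, because `√(ρ ^ 8) = ρ ^ 4`, and the stationary bound is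
of order `|k|^{-2}`; the interpolation takes the fourth root of the first times the cube of the
second. -/
lemma eLpNorm_modeProcess_sub_le [IsProbabilityMeasure P] {β : Mode → ℝ≥0 → Ω → ℝ}
    (hβ : IsCylindricalWiener P β) {L T : ℝ} (hL : 0 < L) {t t' : ℝ} (ht' : 0 ≤ t') (htt : t' ≤ t)
    {ρ : ℝ} (hρ : 0 ≤ ρ) (hd : t - t' ≤ T * ρ ^ 8) (k : Mode) :
    eLpNorm (fun ω => modeProcess L β k t ω - modeProcess L β k t' ω) 2 P ≤
      ENNReal.ofReal ((1 + 24 * √T / (2 * Real.pi / L) ^ 6) * ρ / (modeNorm k * √(modeNorm k))) := by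
  have hk := eigenvalue_pos hL k
  have hN := one_le_modeNorm k
  have hN0 : 0 < modeNorm k := by linarith
  have ht := ht'.trans htt
  set c := 2 * Real.pi / L with hc
  have hc0 : 0 < c := by rw [hc]; positivity
  have h1 : eLpNorm (fun ω => modeProcess L β k t ω - modeProcess L β k t' ω) 2 P ≤
      ENNReal.ofReal (3 * √T * ρ ^ 4) := by
    refine (eLpNorm_ouProcess_sub_le (hβ.brownian k) (lam := eigenvalue L k ^ 2) (by positivity)
      ht' htt).trans (ENNReal.ofReal_le_ofReal ?_)
    have : √(t - t') ≤ √T * ρ ^ 4 := by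
      refine (Real.sqrt_le_sqrt hd).trans (le_of_eq ?_)
      rw [show ρ ^ 8 = (ρ ^ 4) ^ 2 by ring, Real.sqrt_mul' _ (by positivity), Real.sqrt_sq (by positivity)]
    linarith
  have h2 : eLpNorm (fun ω => modeProcess L β k t ω - modeProcess L β k t' ω) 2 P ≤
      ENNReal.ofReal (2 / (c ^ 2 * modeNorm k ^ 2)) := by
    refine (eLpNorm_sub_le (aestronglyMeasurable_modeProcess hβ L ht k)
      (aestronglyMeasurable_modeProcess hβ L ht' k) (by norm_num)).trans ?_
    refine (add_le_add (eLpNorm_modeProcess_le hβ hL ht k) (eLpNorm_modeProcess_le hβ hL ht' k)).trans ?_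
    rw [← ENNReal.ofReal_add (by positivity) (by positivity)]
    refine ENNReal.ofReal_le_ofReal (le_of_eq ?_)
    rw [← hc]; ring
  have hfin : eLpNorm (fun ω => modeProcess L β k t ω - modeProcess L β k t' ω) 2 P ≠ ∞ :=
    ne_top_of_le_ne_top ENNReal.ofReal_ne_top h1
  rw [← ENNReal.ofReal_toReal hfin]
  refine ENNReal.ofReal_le_ofReal ?_
  have hs : 0 ≤ √T / c ^ 6 := by positivity
  refine le_of_le_of_le_pow_four ENNReal.toReal_nonneg
    (ENNReal.toReal_le_of_le_ofReal (by positivity) h1)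
    (ENNReal.toReal_le_of_le_ofReal (by positivity) h2) (by positivity) ?_
  have e1 : (modeNorm k * √(modeNorm k)) ^ 4 = modeNorm k ^ 6 := by
    rw [mul_pow, show √(modeNorm k) ^ 4 = (√(modeNorm k) ^ 2) ^ 2 by ring, Real.sq_sqrt hN0.le]
    ring
  have e2 : 3 * √T * ρ ^ 4 * (2 / (c ^ 2 * modeNorm k ^ 2)) ^ 3 =
      (24 * √T / c ^ 6) * ρ ^ 4 / modeNorm k ^ 6 := by
    field_simp; ring
  rw [e2, div_pow (_ * ρ), e1, mul_pow _ ρ]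
  have e3 : 24 * √T / c ^ 6 ≤ (1 + 24 * √T / c ^ 6) ^ 4 := by
    have h0 : 0 ≤ 24 * √T / c ^ 6 := by positivity
    have := le_self_pow₀ (M₀ := ℝ) (a := 1 + 24 * √T / c ^ 6) (by linarith) (n := 4) (by norm_num)
    linarith
  gcongr

/-- Bound for the contribution of one mode to the increments of the field. -/
lemma eLpNorm_mode_increment_le [IsProbabilityMeasure P] {β : Mode → ℝ≥0 → Ω → ℝ}
    (hβ : IsCylindricalWiener P β) {L T : ℝ} (hL : 0 < L) {t t' : ℝ} (ht' : 0 ≤ t')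
    (htt : t' ≤ t) {ρ : ℝ} (hρ : 0 ≤ ρ) (hρ1 : ρ ≤ 1) (hd : t - t' ≤ T * ρ ^ 8) (k : Mode)
    {x y : Plane} (h0 : |y 0 - x 0| ≤ L * ρ ^ 8) (h1 : |y 1 - x 1| ≤ L * ρ ^ 8) (a : ℝ) :
    eLpNorm (fun ω => a * basis L k.1 y * modeProcess L β k t ω +
      (-(a * basis L k.1 x)) * modeProcess L β k t' ω) 2 P ≤
      ENNReal.ofReal (fieldConst L T * ρ * (|a| / (modeNorm k * √(modeNorm k)))) := by
  have hN := one_le_modeNorm k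
  have hN0 : 0 < modeNorm k := by linarith
  have ht := ht'.trans htt
  set c := 2 * Real.pi / L with hc
  have hc0 : 0 < c := by rw [hc]; positivity
  have hX := aestronglyMeasurable_modeProcess hβ L ht k
  have hX' := aestronglyMeasurable_modeProcess hβ L ht' k
  have e : (fun ω => a * basis L k.1 y * modeProcess L β k t ω +
      (-(a * basis L k.1 x)) * modeProcess L β k t' ω) =
      (a * basis L k.1 y) • (fun ω => modeProcess L β k t ω - modeProcess L β k t' ω) +
      (a * (basis L k.1 y - basis L k.1 x)) • modeProcess L β k t' := by
    ext ω; simp only [Pi.add_apply, Pi.smul_apply, smul_eq_mul]; ring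
  rw [e]
  refine (eLpNorm_add_le ((hX.sub hX').const_smul _) (hX'.const_smul _) (by norm_num)).trans ?_
  refine (add_le_add eLpNorm_const_smul_le eLpNorm_const_smul_le).trans ?_
  refine (add_le_add (mul_le_mul_right (eLpNorm_modeProcess_sub_le hβ hL ht' htt hρ hd k) _)
    (mul_le_mul_right (eLpNorm_modeProcess_le hβ hL ht' k) _)).trans ?_
  rw [Real.enorm_eq_ofReal_abs, Real.enorm_eq_ofReal_abs, ← ENNReal.ofReal_mul (abs_nonneg _),
    ← ENNReal.ofReal_mul (abs_nonneg _), ← ENNReal.ofReal_add (by positivity) (by positivity)]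
  refine ENNReal.ofReal_le_ofReal ?_
  rw [← hc, abs_mul, abs_mul]
  have b1 := abs_basis_le hL k.1 y
  -- The geometric mean of the Lipschitz bound, of order `|k| ρ ^ 8`, and the uniform bound `4 / L`.
  -- It costs only `√|k|`, so multiplication by the standard deviation `|k|^{-2}` again leaves
  -- `|k|^{-3/2}`.
  have b2 : |basis L k.1 y - basis L k.1 x| ≤ (2 / L * (2 * c) * L + 4 / L) * (√(modeNorm k) * ρ) := by
    have d1 := abs_basis_sub_le hL k h0 h1
    have d2 : |basis L k.1 y - basis L k.1 x| ≤ 4 / L := by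
      refine (abs_sub _ _).trans ?_
      refine (add_le_add (abs_basis_le hL k.1 y) (abs_basis_le hL k.1 x)).trans (le_of_eq (by ring))
    have hA : 0 ≤ 2 / L * (2 * c) * L := by positivity
    have hB : 0 ≤ 4 / L := by positivity
    set A := 2 / L * (2 * c) * L with hAd
    have d3 : |basis L k.1 y - basis L k.1 x| ≤ A * modeNorm k * ρ ^ 8 := by
      refine d1.trans (le_of_eq ?_); rw [hAd, ← hc]; ring
    refine le_of_pow_le_pow_left₀ (n := 2) (by norm_num) (by positivity) ?_
    have d4 : |basis L k.1 y - basis L k.1 x| ^ 2 ≤ (A * modeNorm k * ρ ^ 8) * (4 / L) := by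
      rw [sq]; exact mul_le_mul d3 d2 (abs_nonneg _) (by positivity)
    refine d4.trans ?_
    rw [mul_pow, mul_pow, Real.sq_sqrt hN0.le]
    have d5 : ρ ^ 8 ≤ ρ ^ 2 := pow_le_pow_of_le_one hρ hρ1 (by norm_num)
    have d6 : A * (4 / L) ≤ (A + 4 / L) ^ 2 := by nlinarith
    calc A * modeNorm k * ρ ^ 8 * (4 / L) = (A * (4 / L)) * (modeNorm k * ρ ^ 8) := by ring
      _ ≤ (A + 4 / L) ^ 2 * (modeNorm k * ρ ^ 2) := by gcongr
  have hsq : √(modeNorm k) * √(modeNorm k) = modeNorm k := Real.mul_self_sqrt hN0.le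
  have hsp : 0 < √(modeNorm k) := Real.sqrt_pos.2 hN0
  have e2 : √(modeNorm k) / modeNorm k ^ 2 = 1 / (modeNorm k * √(modeNorm k)) := by
    rw [div_eq_div_iff (by positivity) (by positivity)]
    calc √(modeNorm k) * (modeNorm k * √(modeNorm k)) = modeNorm k * (√(modeNorm k) * √(modeNorm k)) := by ring
      _ = 1 * modeNorm k ^ 2 := by rw [hsq]; ring
  calc |a| * |basis L k.1 y| * ((1 + 24 * √T / c ^ 6) * ρ / (modeNorm k * √(modeNorm k))) +
      |a| * |basis L k.1 y - basis L k.1 x| * (1 / (c ^ 2 * modeNorm k ^ 2))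
      ≤ |a| * (2 / L) * ((1 + 24 * √T / c ^ 6) * ρ / (modeNorm k * √(modeNorm k))) +
      |a| * ((2 / L * (2 * c) * L + 4 / L) * (√(modeNorm k) * ρ)) * (1 / (c ^ 2 * modeNorm k ^ 2)) := by
        gcongr
    _ = (2 / L * (1 + 24 * √T / c ^ 6)) * ρ * (|a| / (modeNorm k * √(modeNorm k))) +
      ((2 / L * (2 * c) * L + 4 / L) / c ^ 2) * ρ * (|a| * (√(modeNorm k) / modeNorm k ^ 2)) := by
        ring
    _ = (2 / L * (1 + 24 * √T / c ^ 6) + (2 / L * (2 * c) * L + 4 / L) / c ^ 2) * ρ *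
        (|a| / (modeNorm k * √(modeNorm k))) := by rw [e2]; ring
    _ ≤ fieldConst L T * ρ * (|a| / (modeNorm k * √(modeNorm k))) := by
        have : 2 / L * (1 + 24 * √T / c ^ 6) + (2 / L * (2 * c) * L + 4 / L) / c ^ 2 ≤ fieldConst L T := by
          rw [fieldConst, ← hc]
          have h0 : 0 ≤ 2 / L := by positivity
          have := div_le_div_of_nonneg_right (a := 2 / L * (2 * c) * L + 4 / L)
            (b := 2 / L * (2 * c) * L + 4 / L + 2 / L) (by linarith) (sq_nonneg c)
          linarith
        gcongr

/-- The vanishing second term and the factor `1` give the value at a point the same shape as an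
increment with `ρ = 1`, so both are summed over the modes in the same way. -/
lemma eLpNorm_mode_le [IsProbabilityMeasure P] {β : Mode → ℝ≥0 → Ω → ℝ}
    (hβ : IsCylindricalWiener P β) {L T : ℝ} (hL : 0 < L) {t : ℝ} (ht : 0 ≤ t) (k : Mode)
    (x : Plane) (a : ℝ) :
    eLpNorm (fun ω => a * basis L k.1 x * modeProcess L β k t ω +
      0 * modeProcess L β k t ω) 2 P ≤
      ENNReal.ofReal (fieldConst L T * 1 * (|a| / (modeNorm k * √(modeNorm k)))) := by
  have hN := one_le_modeNorm k
  have hN0 : 0 < modeNorm k := by linarith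
  set c := 2 * Real.pi / L with hc
  have hc0 : 0 < c := by rw [hc]; positivity
  have e : (fun ω => a * basis L k.1 x * modeProcess L β k t ω + 0 * modeProcess L β k t ω) =
      (a * basis L k.1 x) • modeProcess L β k t := by
    ext ω; simp
  rw [e]
  refine eLpNorm_const_smul_le.trans ?_
  refine (mul_le_mul_right (eLpNorm_modeProcess_le hβ hL ht k) _).trans ?_
  rw [Real.enorm_eq_ofReal_abs, ← ENNReal.ofReal_mul (abs_nonneg _), abs_mul]
  refine ENNReal.ofReal_le_ofReal ?_
  have b1 := abs_basis_le hL k.1 x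
  have h2 : √(modeNorm k) ≤ modeNorm k := by
    rw [Real.sqrt_le_left hN0.le]; nlinarith
  have h3 : 0 < √(modeNorm k) := Real.sqrt_pos.2 hN0
  calc |a| * |basis L k.1 x| * (1 / (c ^ 2 * modeNorm k ^ 2))
      ≤ |a| * (2 / L) * (1 / (c ^ 2 * (modeNorm k * √(modeNorm k)))) := by
        have : modeNorm k * √(modeNorm k) ≤ modeNorm k ^ 2 := by nlinarith
        gcongr
    _ = ((2 / L) / c ^ 2) * 1 * (|a| / (modeNorm k * √(modeNorm k))) := by field_simp
    _ ≤ _ := by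
        have : (2 / L) / c ^ 2 ≤ fieldConst L T := by
          rw [fieldConst, ← hc]
          have h0 : 0 ≤ 2 / L * (1 + 24 * √T / c ^ 6) := by positivity
          have h1 : 2 / L / c ^ 2 ≤ (2 / L * (2 * c) * L + 4 / L + 2 / L) / c ^ 2 := by
            gcongr
            have : 0 ≤ 2 / L * (2 * c) * L + 4 / L := by positivity
            linarith
          linarith
        gcongr

/-- Moments of a sum over the modes, in terms of the variances. -/
lemma eLpNorm_sum_modes_le [IsProbabilityMeasure P] {β : Mode → ℝ≥0 → Ω → ℝ}
    (hβ : IsCylindricalWiener P β) (L : ℝ) {t t' : ℝ} (ht : 0 ≤ t) (ht' : 0 ≤ t')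
    (c c' : Mode → ℝ) (F : Finset Mode) {y : Mode → ℝ}
    (hy : ∀ k, eLpNorm (fun ω => c k * modeProcess L β k t ω +
        c' k * modeProcess L β k t' ω) 2 P ≤ ENNReal.ofReal (y k)) (q : ℝ≥0∞) :
    eLpNorm (fun ω => ∑ k ∈ F, (c k * modeProcess L β k t ω + c' k * modeProcess L β k t' ω)) q P ≤
      ENNReal.ofReal √(∑ k ∈ F, y k ^ 2) * eLpNorm id q (gaussianReal 0 1) := by
  rw [eLpNorm_of_hasLaw_gaussianReal (hasLaw_sum_modeProcess hβ L ht ht' c c' F) q]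
  refine mul_le_mul_left ?_ _
  rw [← ENNReal.ofReal_coe_nnreal, Real.coe_sqrt]
  refine ENNReal.ofReal_le_ofReal (Real.sqrt_le_sqrt ?_)
  push_cast
  refine Finset.sum_le_sum fun k _ => ?_
  by_cases h : 0 ≤ y k
  · refine pow_le_pow_left₀ (by positivity) ?_ 2
    exact ENNReal.toReal_le_of_le_ofReal h (hy k)
  · have h2 := hy k
    rw [ENNReal.ofReal_of_nonpos (by linarith), nonpos_iff_eq_zero] at h2
    rw [h2]
    simp [sq_nonneg]

end

/-! ### Random continuous functions -/

section

variable {Ω : Type*} [MeasurableSpace Ω] {P : Measure Ω}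

/-- A random continuous function on a compact space is measurable if all its values are. -/
lemma aestronglyMeasurable_continuousMap {K : Type*} [TopologicalSpace K] [CompactSpace K]
    [SecondCountableTopology K] [LocallyCompactSpace K] {f : Ω → C(K, ℝ)}
    (h : ∀ x, AEStronglyMeasurable (fun ω => f ω x) P) : AEStronglyMeasurable f P := by
  borelize C(K, ℝ)
  -- A closed ball is cut out by the evaluations at a countable dense set, and each open set is a
  -- countable union of closed balls; so the evaluations decide measurability.
  have hball : ∀ (g : C(K, ℝ)) (r : ℝ), 0 ≤ r → NullMeasurableSet (f ⁻¹' Metric.closedBall g r) P := by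
    intro g r hr
    obtain ⟨D, hDc, hDd⟩ := TopologicalSpace.exists_countable_dense K
    have e : f ⁻¹' Metric.closedBall g r = ⋂ x ∈ D, {ω | |f ω x - g x| ≤ r} := by
      ext ω
      simp only [mem_preimage, Metric.mem_closedBall, mem_iInter, mem_ofPred_eq]
      rw [ContinuousMap.dist_le hr]
      refine ⟨fun h x _ => h x, fun h x => ?_⟩
      refine hDd.induction (P := fun x => dist (f ω x) (g x) ≤ r) h ?_ x
      exact isClosed_le (by fun_prop) continuous_const
    rw [e]
    refine NullMeasurableSet.biInter hDc fun x _ => ?_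
    exact nullMeasurableSet_le ((h x).aemeasurable.sub_const _).norm aemeasurable_const
  have hnull : NullMeasurable f P := by
    suffices h : Measurable (α := NullMeasurableSpace Ω P) f from fun s hs => h hs
    refine measurable_of_isOpen fun U hU => ?_
    change NullMeasurableSet (f ⁻¹' U) P
    choose! r hr hrU using fun g (hg : g ∈ U) => Metric.nhds_basis_closedBall.mem_iff.1 (hU.mem_nhds hg)
    obtain ⟨D, hDU, hDc, hD⟩ := TopologicalSpace.countable_cover_nhdsWithin
      (f := fun g => Metric.closedBall g (r g)) (s := U)
      (fun g hg => mem_nhdsWithin_of_mem_nhds (Metric.closedBall_mem_nhds g (hr g hg)))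
    have e : U = ⋃ g ∈ D, Metric.closedBall g (r g) :=
      hD.antisymm (iUnion₂_subset fun g hg => hrU g (hDU hg))
    rw [e, preimage_iUnion₂]
    exact NullMeasurableSet.biUnion hDc fun g hg => hball g _ (hr g (hDU hg)).le
  exact hnull.aemeasurable.aestronglyMeasurable

end

/-- The space of continuous functions on `[0, T] × [0, L]²`. -/
abbrev FieldSpace (L T : ℝ) : Type := C(Icc (0 : ℝ) T × square L, ℝ)

section

variable {Ω : Type*} [MeasurableSpace Ω] {P : Measure Ω}

/-- The contribution of the mode `k` to the stochastic convolution. -/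
def modeField (L T : ℝ) (β : Mode → ℝ≥0 → Ω → ℝ) (k : Mode) (ω : Ω) : FieldSpace L T :=
  ⟨fun z => modeProcess L β k z.1 ω * basis L k.1 z.2,
    ((continuous_ouProcess _ _ ω).comp (continuous_subtype_val.comp continuous_fst)).mul
      ((continuous_basis L k.1).comp (continuous_subtype_val.comp continuous_snd))⟩

/-- A partial sum of the stochastic convolution. -/
def partialField (L T : ℝ) (β : Mode → ℝ≥0 → Ω → ℝ) (a : Mode → ℝ) (F : Finset Mode) (ω : Ω) :
    FieldSpace L T := ∑ k ∈ F, a k • modeField L T β k ω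

omit [MeasurableSpace Ω] in
lemma partialField_apply (L T : ℝ) (β : Mode → ℝ≥0 → Ω → ℝ) (a : Mode → ℝ) (F : Finset Mode) (ω : Ω)
    (z : Icc (0 : ℝ) T × square L) :
    partialField L T β a F ω z = ∑ k ∈ F, a k * (modeProcess L β k z.1 ω * basis L k.1 z.2) := by
  rw [partialField, ContinuousMap.sum_apply]
  rfl

lemma aestronglyMeasurable_partialField {β : Mode → ℝ≥0 → Ω → ℝ} (hβ : IsCylindricalWiener P β)
    (L T : ℝ) (a : Mode → ℝ) (F : Finset Mode) :
    AEStronglyMeasurable (partialField L T β a F) P := by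
  refine aestronglyMeasurable_continuousMap fun z => ?_
  simp only [partialField_apply]
  refine Finset.aestronglyMeasurable_fun_sum _ fun k _ => ?_
  exact ((aestronglyMeasurable_modeProcess hβ L z.1.2.1 k).mul_const _).const_mul _

/-- A constant for the moments of order `q` of the stochastic convolution. -/
def momentConst (L T : ℝ) (q : ℕ) : ℝ≥0∞ :=
  136 * ENNReal.ofReal (1 + (1 - chainRatio)⁻¹) *
    (ENNReal.ofReal (fieldConst L T) * eLpNorm id q (gaussianReal 0 1))

lemma momentConst_ne_top (L T : ℝ) (q : ℕ) : momentConst L T q ≠ ∞ := by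
  refine ENNReal.mul_ne_top (ENNReal.mul_ne_top (by norm_num) ENNReal.ofReal_ne_top)
    (ENNReal.mul_ne_top ENNReal.ofReal_ne_top ?_)
  exact (memLp_id_gaussianReal' (q : ℝ≥0∞) (by simp)).eLpNorm_ne_top

/-- The mesh `2^{-(n+1)}` is written as an eighth power to match the scale `ρ ^ 8` of the mode
bounds. -/
lemma dyadicPoint_succ_sub (n : ℕ) (v : Fin 3 → ℕ) (e : Fin 3 → Fin 2) (i : Fin 3) :
    0 ≤ dyadicPoint (n + 1) (fun i => 2 * v i + e i) i - dyadicPoint n v i ∧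
    dyadicPoint (n + 1) (fun i => 2 * v i + e i) i - dyadicPoint n v i ≤
      (chainRatio ^ (2 * (n + 1))) ^ 8 := by
  have h : dyadicPoint (n + 1) (fun i => 2 * v i + e i) i - dyadicPoint n v i =
      ((e i : ℕ) : ℝ) * (1 / 2) ^ (n + 1) := by
    simp only [dyadicPoint]
    push_cast
    rw [one_div_pow, pow_succ]
    field_simp
    ring
  have h1 : (chainRatio ^ (2 * (n + 1))) ^ 8 = (1 / 2) ^ (n + 1) := by
    rw [← chainRatio_pow, ← pow_mul, ← pow_mul]; congr 1; ring
  have h2 : ((e i : ℕ) : ℝ) ≤ 1 := by exact_mod_cast Nat.le_of_lt_succ (e i).2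
  rw [h, h1]
  exact ⟨by positivity, mul_le_of_le_one_left (by positivity) h2⟩

/-- Moments of the supremum of a partial sum of the stochastic convolution. -/
lemma eLpNorm_partialField_le [IsProbabilityMeasure P] {β : Mode → ℝ≥0 → Ω → ℝ}
    (hβ : IsCylindricalWiener P β) {L T : ℝ} (hL : 0 < L) (hT : 0 < T) (a : Mode → ℝ)
    (F : Finset Mode) {q : ℕ} (hq : 64 ≤ q) :
    eLpNorm (partialField L T β a F) q P ≤
      momentConst L T q * ENNReal.ofReal √(∑ k ∈ F, a k ^ 2 / modeNorm k ^ 3) := by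
  -- The field is rescaled to the unit cube: coordinate `0` is time, coordinates `1` and `2` are
  -- space.
  set pt : (Fin 3 → ℝ) → Plane := fun x => WithLp.toLp 2 ![L * x 1, L * x 2] with hpt
  set h : (Fin 3 → ℝ) → Ω → ℝ := fun x ω =>
    ∑ k ∈ F, a k * basis L k.1 (pt x) * modeProcess L β k (T * x 0) ω with hh
  set V := √(∑ k ∈ F, a k ^ 2 / modeNorm k ^ 3) with hV
  set A : ℝ≥0∞ := ENNReal.ofReal (fieldConst L T * V) * eLpNorm id q (gaussianReal 0 1) with hA
  have hf0 := fieldConst_nonneg (T := T) hL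
  have hsum : ∀ ρ : ℝ, 0 ≤ ρ → √(∑ k ∈ F, (fieldConst L T * ρ *
      (|a k| / (modeNorm k * √(modeNorm k)))) ^ 2) = fieldConst L T * V * ρ := by
    intro ρ hρ
    have : ∀ k ∈ F, (fieldConst L T * ρ * (|a k| / (modeNorm k * √(modeNorm k)))) ^ 2 =
        (fieldConst L T * ρ) ^ 2 * (a k ^ 2 / modeNorm k ^ 3) := by
      intro k _
      have hN := one_le_modeNorm k
      rw [mul_pow, div_pow, sq_abs, mul_pow (modeNorm k), Real.sq_sqrt (by linarith), ← pow_succ]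
    rw [Finset.sum_congr rfl this, ← Finset.mul_sum, Real.sqrt_mul (sq_nonneg _),
      Real.sqrt_sq (by positivity)]
    ring
  have hcpt : Continuous pt := by
    refine (PiLp.continuous_toLp 2 _).comp (continuous_pi fun i => ?_)
    fin_cases i <;> simp <;> fun_prop
  have key := eLpNorm_sup_le (P := P) hq (h := h) (A := A) (S := fun ω => ‖partialField L T β a F ω‖)
    ?_ ?_ ?_ ?_ ?_
  · rw [eLpNorm_norm] at key
    refine key.trans (le_of_eq ?_)
    rw [hA, momentConst, ENNReal.ofReal_mul hf0]
    ring
  · intro ω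
    refine continuous_finsetSum _ fun k _ => ?_
    exact (continuous_const.mul ((continuous_basis L k.1).comp hcpt)).mul
      ((continuous_ouProcess _ _ ω).comp (by fun_prop))
  · intro x hx
    refine Finset.aestronglyMeasurable_fun_sum _ fun k _ => ?_
    exact (aestronglyMeasurable_modeProcess hβ L (mul_nonneg hT.le (hx 0)) k).const_mul _
  · intro v _
    have ht : 0 ≤ T * dyadicPoint 0 v 0 := mul_nonneg hT.le (by simp [dyadicPoint])
    have := eLpNorm_sum_modes_le hβ L ht ht (fun k => a k * basis L k.1 (pt (dyadicPoint 0 v)))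
      (fun _ => 0) F (fun k => eLpNorm_mode_le (T := T) hβ hL ht k (pt (dyadicPoint 0 v)) (a k)) q
    rw [hsum 1 zero_le_one, mul_one] at this
    refine (le_of_eq ?_).trans this
    congr 1
    ext ω
    simp [hh]
  · intro n v _ e
    have hd := dyadicPoint_succ_sub n v e
    set y := dyadicPoint (n + 1) fun i => 2 * v i + e i with hy
    set x := dyadicPoint n v with hx
    set ρ := chainRatio ^ (2 * (n + 1)) with hρ
    have hc0 := chainRatio_pos
    have hc1 := chainRatio_lt_one
    have hρ0 : 0 ≤ ρ := by positivity
    have hρ1 : ρ ≤ 1 := pow_le_one₀ hc0.le hc1.le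
    have hx0 : 0 ≤ T * x 0 := mul_nonneg hT.le (by simp only [hx, dyadicPoint]; positivity)
    have hxy : T * x 0 ≤ T * y 0 := mul_le_mul_of_nonneg_left (by linarith [(hd 0).1]) hT.le
    have hdt : T * y 0 - T * x 0 ≤ T * ρ ^ 8 := by
      rw [← mul_sub]; exact mul_le_mul_of_nonneg_left (hd 0).2 hT.le
    have hds : ∀ i, |L * y i - L * x i| ≤ L * ρ ^ 8 := by
      intro i
      rw [← mul_sub, abs_mul, abs_of_pos hL, abs_of_nonneg (hd i).1]
      exact mul_le_mul_of_nonneg_left (hd i).2 hL.le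
    have := eLpNorm_sum_modes_le hβ L (hx0.trans hxy) hx0 (fun k => a k * basis L k.1 (pt y))
      (fun k => -(a k * basis L k.1 (pt x))) F
      (fun k => eLpNorm_mode_increment_le hβ hL hx0 hxy hρ0 hρ1 hdt k (hds 1) (hds 2) (a k)) q
    rw [hsum ρ hρ0] at this
    have e1 : (fun ω => ∑ k ∈ F, (a k * basis L k.1 (pt y) * modeProcess L β k (T * y 0) ω +
        -(a k * basis L k.1 (pt x)) * modeProcess L β k (T * x 0) ω)) = h y - h x := by
      ext ω
      simp only [hh, Pi.sub_apply, ← Finset.sum_sub_distrib]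
      refine Finset.sum_congr rfl fun k _ => by ring
    rw [e1] at this
    refine this.trans ?_
    rw [ENNReal.ofReal_mul (by positivity), hA, mul_right_comm]
    refine mul_le_mul_right (ENNReal.ofReal_le_ofReal ?_) _
    exact pow_le_pow_of_le_one hc0.le hc1.le (by omega)
  · intro ω K hK
    have hK0 : 0 ≤ K := (abs_nonneg _).trans (hK 0 fun i => by simp)
    rw [abs_norm, ContinuousMap.norm_le _ hK0]
    intro z
    have hz := hK ![z.1 / T, z.2.1 0 / L, z.2.1 1 / L] ?_
    · rw [partialField_apply, Real.norm_eq_abs]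
      refine (le_of_eq ?_).trans hz
      have e1 : T * (z.1 / T) = (z.1 : ℝ) := by field_simp
      have e2 : pt ![z.1 / T, z.2.1 0 / L, z.2.1 1 / L] = z.2.1 := by
        ext i
        fin_cases i <;> simp [hpt] <;> field_simp
      simp only [hh, e2, Matrix.cons_val_zero, e1]
      congr 1
      refine Finset.sum_congr rfl fun k _ => by ring
    · have h1 := z.1.2
      have h2 := z.2.2
      intro i
      fin_cases i
      · exact ⟨div_nonneg h1.1 hT.le, (div_le_one hT).2 h1.2⟩
      · exact ⟨div_nonneg (h2 0).1 hL.le, (div_le_one hL).2 (h2 0).2⟩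
      · exact ⟨div_nonneg (h2 1).1 hL.le, (div_le_one hL).2 (h2 1).2⟩

end

/-! ### Continuous functions on the square as elements of `L²` -/

/-- The projection of the plane onto the square. -/
def squareProj {L : ℝ} (hL : 0 < L) : C(Plane, square L) where
  toFun x := ⟨WithLp.toLp 2 fun i => (projIcc 0 L hL.le (x i) : ℝ), fun i => (projIcc 0 L hL.le (x i)).2⟩
  continuous_toFun := by
    refine Continuous.subtype_mk ((PiLp.continuous_toLp 2 _).comp (continuous_pi fun i => ?_)) _
    exact continuous_subtype_val.comp (continuous_projIcc.comp (by fun_prop))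

lemma squareProj_of_mem {L : ℝ} (hL : 0 < L) {x : Plane} (hx : x ∈ square L) :
    squareProj hL x = ⟨x, hx⟩ := by
  refine Subtype.ext ?_
  ext i
  simp [squareProj, projIcc_of_mem hL.le (hx i)]

lemma memLp_comp_squareProj {L : ℝ} (hL : 0 < L) (d : C(square L, ℝ)) :
    MemLp (fun x => d (squareProj hL x)) 2 (squareMeasure L) :=
  memLp_of_continuous (d.comp (squareProj hL)).continuous inferInstance 2

/-- A continuous function on the square as an element of `L²`. -/
def toL2 {L : ℝ} (hL : 0 < L) : C(square L, ℝ) →L[ℝ] L2 L :=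
  LinearMap.mkContinuous
    { toFun := fun d => (memLp_comp_squareProj hL d).toLp _
      map_add' := fun _ _ => rfl
      map_smul' := fun _ _ => rfl }
    ((squareMeasure L).real univ ^ (2 : ℝ≥0∞).toReal⁻¹) fun d => by
      refine Lp.norm_le_of_ae_bound (norm_nonneg d) ?_
      filter_upwards [(memLp_comp_squareProj hL d).coeFn_toLp] with x hx
      exact (congrArg norm hx).le.trans (d.norm_coe_le_norm _)

lemma coeFn_toL2 {L : ℝ} (hL : 0 < L) (d : C(square L, ℝ)) :
    toL2 hL d =ᵐ[squareMeasure L] fun x => d (squareProj hL x) :=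
  (memLp_comp_squareProj hL d).coeFn_toLp

/-- The value at the time `t` of a continuous function on `[0, T] × [0, L]²`, in `L²`. -/
def evalL2 {L T : ℝ} (hL : 0 < L) (t : Icc (0 : ℝ) T) : FieldSpace L T →L[ℝ] L2 L where
  toFun d := toL2 hL (d.curry t)
  map_add' d d' := (toL2 hL).map_add (d.curry t) (d'.curry t)
  map_smul' c d := (toL2 hL).map_smul c (d.curry t)
  cont := (toL2 hL).continuous.comp
    ((continuous_eval_const t).comp ContinuousMap.continuous_curry)

lemma continuous_evalL2 {L T : ℝ} (hL : 0 < L) (d : FieldSpace L T) :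
    Continuous fun t => evalL2 hL t d :=
  (toL2 hL).continuous.comp d.curry.continuous

lemma coeFn_evalL2 {L T : ℝ} (hL : 0 < L) (t : Icc (0 : ℝ) T) (d : FieldSpace L T) :
    ∀ᵐ x ∂(volume : Measure Plane), ∀ hx : x ∈ square L, evalL2 hL t d x = d (t, ⟨x, hx⟩) := by
  have h := (ae_restrict_iff' (isCompact_square L).measurableSet).1 (coeFn_toL2 hL (d.curry t))
  filter_upwards [h] with x hx hxs
  rw [← squareProj_of_mem hL hxs]
  exact hx hxs

/-- The product of a continuous function of time with a basis function. -/
def prodField (L T : ℝ) (k : Mode) (f : C(Icc (0 : ℝ) T, ℝ)) : FieldSpace L T :=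
  ⟨fun z => f z.1 * basis L k.1 z.2, (f.continuous.comp continuous_fst).mul
      ((continuous_basis L k.1).comp (continuous_subtype_val.comp continuous_snd))⟩

lemma norm_prodField_le {L T : ℝ} (hL : 0 < L) (k : Mode) (f : C(Icc (0 : ℝ) T, ℝ)) :
    ‖prodField L T k f‖ ≤ 2 / L * ‖f‖ := by
  rw [ContinuousMap.norm_le _ (by positivity)]
  intro z
  change ‖f z.1 * basis L k.1 z.2‖ ≤ _
  rw [norm_mul, mul_comm]
  exact mul_le_mul (abs_basis_le hL _ _) (f.norm_coe_le_norm _) (norm_nonneg _) (by positivity)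

lemma evalL2_prodField {L T : ℝ} (hL : 0 < L) (t : Icc (0 : ℝ) T) (k : Mode)
    (f : C(Icc (0 : ℝ) T, ℝ)) : evalL2 hL t (prodField L T k f) = f t • basisL2 L k.1 := by
  refine Lp.ext ?_
  have hsq : ∀ᵐ x ∂squareMeasure L, x ∈ square L :=
    ae_restrict_mem (isCompact_square L).measurableSet
  filter_upwards [coeFn_toL2 hL ((prodField L T k f).curry t), Lp.coeFn_smul (f t) (basisL2 L k.1),
    (memLp_basis L k.1).coeFn_toLp, hsq] with x h1 h2 h3 hx
  have h4 : (evalL2 hL t (prodField L T k f) : Plane → ℝ) x =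
    prodField L T k f (t, squareProj hL x) := h1
  rw [h4, h2, squareProj_of_mem hL hx, Pi.smul_apply, smul_eq_mul]
  exact congrArg (f t * ·) h3.symm

lemma coeffs_evalL2_prodField {L T : ℝ} (hL : 0 < L) (t : Icc (0 : ℝ) T) (k l : Mode)
    (f : C(Icc (0 : ℝ) T, ℝ)) :
    coeffs L (evalL2 hL t (prodField L T k f)) l = if l = k then f t else 0 := by
  rw [evalL2_prodField, coeffs_smul, coeffs, coeff_basisL2 hL]
  simp [Subtype.ext_iff]

lemma coeff_zero_evalL2_prodField {L T : ℝ} (hL : 0 < L) (t : Icc (0 : ℝ) T) (k : Mode)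
    (f : C(Icc (0 : ℝ) T, ℝ)) : coeff L (evalL2 hL t (prodField L T k f)) 0 = 0 := by
  rw [evalL2_prodField, coeff_smul, coeff_basisL2 hL, if_neg fun h => k.2 h.symm, mul_zero]

/-- The Fourier coefficient as a continuous linear functional. -/
def coeffCLM (L : ℝ) (k : ℤ × ℤ) : L2 L →L[ℝ] ℝ := innerSL ℝ (basisL2 L k)

lemma coeffCLM_apply (L : ℝ) (k : ℤ × ℤ) (v : L2 L) : coeffCLM L k v = coeff L v k :=
  inner_basisL2 L k v

/-- Fourier coefficients of a sum of products of functions of time with basis functions. -/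
lemma coeffs_evalL2_of_hasSum {L T : ℝ} (hL : 0 < L) {f : Mode → C(Icc (0 : ℝ) T, ℝ)}
    {d : FieldSpace L T} {F : Filter (Finset Mode)} [F.NeBot] (hF : F ≤ atTop)
    (h : Tendsto (fun s : Finset Mode => ∑ k ∈ s, prodField L T k (f k)) F (𝓝 d))
    (t : Icc (0 : ℝ) T) :
    coeff L (evalL2 hL t d) 0 = 0 ∧ ∀ l, coeffs L (evalL2 hL t d) l = f l t := by
  have key : ∀ l : ℤ × ℤ, Tendsto
      (fun s : Finset Mode => ∑ k ∈ s, coeff L (evalL2 hL t (prodField L T k (f k))) l) F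
      (𝓝 (coeff L (evalL2 hL t d) l)) := by
    intro l
    have := (((coeffCLM L l).comp (evalL2 hL t)).continuous.tendsto d).comp h
    simpa only [Function.comp_def, map_sum, ContinuousLinearMap.comp_apply, coeffCLM_apply] using this
  constructor
  · refine tendsto_nhds_unique (key 0) ?_
    simp only [coeff_zero_evalL2_prodField, Finset.sum_const_zero]
    exact tendsto_const_nhds
  · intro l
    refine tendsto_nhds_unique (key l.1) (tendsto_const_nhds.congr' ?_)
    -- Once the finite set contains `l`, the coefficient is constant. Only `F ≤ atTop` is needed, so
    -- convergence along a sequence of finite sets, as for the noise, is enough.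
    filter_upwards [hF (eventually_ge_atTop {l})] with s hs
    have e : ∀ k, coeff L (evalL2 hL t (prodField L T k (f k))) l.1 = if l = k then f k t else 0 :=
      fun k => coeffs_evalL2_prodField hL t k l (f k)
    simp only [e]
    rw [Finset.sum_ite_eq, if_pos (Finset.singleton_subset_iff.1 hs)]

/-! ### The stochastic convolution as a random field -/

/-- The Euclidean length dominates the sup norm, so the sum is compared with the Eisenstein lattice
sum. -/
lemma summable_modeNorm_rpow {s : ℝ} (hs : 2 < s) : Summable fun k : Mode => modeNorm k ^ (-s) := by
  have h := (EisensteinSeries.summable_one_div_norm_rpow hs).comp_injective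
    (i := fun k : Mode => (![k.1.1, k.1.2] : Fin 2 → ℤ)) (fun k l h => by
      have h0 := congrFun h 0
      have h1 := congrFun h 1
      exact Subtype.ext (Prod.ext h0 h1))
  refine Summable.of_nonneg_of_le (fun k => by have := one_le_modeNorm k; positivity) (fun k => ?_) h
  have hN := one_le_modeNorm k
  set x : Fin 2 → ℤ := ![k.1.1, k.1.2] with hx
  have h1 : ‖x‖ ≤ modeNorm k := by
    rw [pi_norm_le_iff_of_nonneg (by linarith)]
    intro i
    fin_cases i
    · simpa [hx, Int.norm_eq_abs] using abs_fst_le_modeNorm k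
    · simpa [hx, Int.norm_eq_abs] using abs_snd_le_modeNorm k
  have h2 : 0 < ‖x‖ := by
    rw [norm_pos_iff]
    intro h0
    exact k.2 (Prod.ext (congrFun h0 0) (congrFun h0 1))
  exact Real.rpow_le_rpow_of_nonpos h2 h1 (by linarith)

lemma summable_modeNorm_inv_pow {n : ℕ} (hn : 2 < n) : Summable fun k : Mode => 1 / modeNorm k ^ n := by
  refine (summable_modeNorm_rpow (s := n) (by exact_mod_cast hn)).congr fun k => ?_
  have hN := one_le_modeNorm k
  rw [Real.rpow_neg (by linarith), Real.rpow_natCast, one_div]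

section

variable {Ω : Type*} [MeasurableSpace Ω]

/-- `Φ` is the stochastic convolution `∑ a_k (∫_0^t e^{-(t-s) μ_k²} dβ_k(s)) e_k(x)` as a random
continuous function of `(t, x)`. -/
structure IsNoiseField (L T : ℝ) (hL : 0 < L) (P : Measure Ω) (β : Mode → ℝ≥0 → Ω → ℝ) (a : Mode → ℝ)
    (Φ : Ω → FieldSpace L T) : Prop where
  measurable : AEStronglyMeasurable Φ P
  moment : ∀ q : ℕ, 64 ≤ q → eLpNorm Φ q P ≤
    momentConst L T q * ENNReal.ofReal √(∑' k : Mode, a k ^ 2 / modeNorm k ^ 3)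
  coeff_zero : ∀ᵐ ω ∂P, ∀ t, coeff L (evalL2 hL t (Φ ω)) 0 = 0
  coeffs_eq : ∀ᵐ ω ∂P, ∀ t, ∀ k, coeffs L (evalL2 hL t (Φ ω)) k = a k * modeProcess L β k t ω

omit [MeasurableSpace Ω] in
lemma partialField_sub (L T : ℝ) (β : Mode → ℝ≥0 → Ω → ℝ) (a : Mode → ℝ) (F G : Finset Mode) :
    partialField L T β a F - partialField L T β a G =
      partialField L T β a (F \ G) - partialField L T β a (G \ F) := by
  ext1 ω
  simp only [Pi.sub_apply, partialField]
  rw [← Finset.sum_sdiff_sub_sum_sdiff]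

/-- Along suitable finite sets exhausting the modes, the tails of the weighted sum decay
geometrically. By the moment bound the partial sums are then summably Cauchy in `L^64`, hence
converge almost surely in the uniform norm. Fatou carries all moment bounds to the limit. -/
lemma exists_isNoiseField {P : Measure Ω} [IsProbabilityMeasure P] {β : Mode → ℝ≥0 → Ω → ℝ}
    (hβ : IsCylindricalWiener P β) {L T : ℝ} (hL : 0 < L) (hT : 0 < T) {a : Mode → ℝ}
    (ha : Summable fun k => a k ^ 2 / modeNorm k ^ 3) :
    ∃ Φ, IsNoiseField L T hL P β a Φ := by
  have hnn : ∀ k, 0 ≤ a k ^ 2 / modeNorm k ^ 3 := fun k => by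
    have := one_le_modeNorm k; positivity
  have hm := aestronglyMeasurable_partialField hβ L T a
  -- The tails are squared powers because the moment bound involves the square root of the sum.
  choose S hS using fun n : ℕ => summable_iff_vanishing_norm.1 ha (((1 / 2 : ℝ) ^ n) ^ 2) (by positivity)
  obtain ⟨G, hG⟩ := exists_seq_tendsto (atTop : Filter (Finset Mode))
  obtain ⟨φ, hφ, hφS⟩ := extraction_forall_of_eventually (P := fun n k => ∀ i ≤ n, S i ⊆ G k)
    (fun n => (eventually_all_finite (finite_Iic n)).2 fun i _ => hG.eventually (eventually_ge_atTop (S i)))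
  set F : ℕ → Finset Mode := fun n => G (φ n) with hF
  have hFt : Tendsto F atTop atTop := hG.comp hφ.tendsto_atTop
  have hd : ∀ N n m, N ≤ n → eLpNorm (partialField L T β a (F m \ F n)) (64 : ℕ) P ≤
      momentConst L T 64 * ENNReal.ofReal ((1 / 2) ^ N) := by
    intro N n m hn
    refine (eLpNorm_partialField_le hβ hL hT a _ le_rfl).trans ?_
    refine mul_le_mul_right (ENNReal.ofReal_le_ofReal ?_) _
    rw [Real.sqrt_le_left (by positivity)]
    have := hS N (F m \ F n) (Finset.disjoint_of_subset_right (hφS n N hn) Finset.sdiff_disjoint)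
    exact (le_abs_self _).trans this.le
  -- The additional `1` provides the strict inequality in the Cauchy criterion.
  set B : ℕ → ℝ≥0∞ := fun N => (2 * momentConst L T 64 + 1) * ENNReal.ofReal ((1 / 2) ^ N) with hB
  have hBs : ∑' N, B N ≠ ∞ := by
    rw [ENNReal.tsum_mul_left]
    refine ENNReal.mul_ne_top ?_ ?_
    · exact ENNReal.add_ne_top.2 ⟨ENNReal.mul_ne_top (by norm_num) (momentConst_ne_top L T 64), by norm_num⟩
    · rw [← ENNReal.ofReal_tsum_of_nonneg (fun n => by positivity) summable_geometric_two]
      exact ENNReal.ofReal_ne_top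
  have hcau : ∀ N n m : ℕ, N ≤ n → N ≤ m →
      eLpNorm (partialField L T β a (F n) - partialField L T β a (F m)) (64 : ℕ) P < B N := by
    intro N n m hn hm'
    rw [partialField_sub]
    refine (eLpNorm_sub_le (hm _) (hm _) (by norm_num)).trans_lt ?_
    refine (add_le_add (hd N m n hm') (hd N n m hn)).trans_lt ?_
    rw [← two_mul, ← mul_assoc, hB]
    refine ENNReal.mul_lt_mul_left ?_ ENNReal.ofReal_ne_top ?_
    · simp
    · refine ENNReal.lt_add_right ?_ one_ne_zero
      exact ENNReal.mul_ne_top (by norm_num) (momentConst_ne_top L T 64)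
  have hlim := Lp.ae_tendsto_of_cauchy_eLpNorm (fun n => hm (F n)) (by norm_num) hBs hcau
  obtain ⟨Φ, hΦm, hΦ⟩ := exists_stronglyMeasurable_limit_of_tendsto_ae (fun n => hm (F n)) hlim
  have hco : ∀ᵐ ω ∂P, ∀ t, coeff L (evalL2 hL t (Φ ω)) 0 = 0 ∧
      ∀ k, coeffs L (evalL2 hL t (Φ ω)) k = a k * modeProcess L β k t ω := by
    filter_upwards [hΦ] with ω hω t
    refine coeffs_evalL2_of_hasSum hL (f := fun k => ⟨fun t => a k * modeProcess L β k t ω,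
      continuous_const.mul ((continuous_ouProcess _ _ ω).comp continuous_subtype_val)⟩)
      (F := map F atTop) hFt ?_ t
    refine tendsto_map'_iff.2 (hω.congr fun n => ?_)
    refine Finset.sum_congr rfl fun k _ => ?_
    ext z
    exact (mul_assoc _ _ _).symm
  refine ⟨Φ, hΦm.aestronglyMeasurable, fun q hq => ?_, ?_, ?_⟩
  · refine Lp.eLpNorm_le_of_ae_tendsto (Eventually.of_forall fun n => ?_) (fun n => hm (F n)) hΦ
    refine (eLpNorm_partialField_le hβ hL hT a _ hq).trans ?_
    refine mul_le_mul_right (ENNReal.ofReal_le_ofReal (Real.sqrt_le_sqrt ?_)) _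
    exact ha.sum_le_tsum _ fun k _ => hnn k
  · filter_upwards [hco] with ω hω t using (hω t).1
  · filter_upwards [hco] with ω hω t using (hω t).2

end

/-! ### The linear equation -/

lemma exp_neg_mul_le_one {t lam : ℝ} (ht : 0 ≤ t) (hlam : 0 ≤ lam) : Real.exp (-t * lam) ≤ 1 :=
  Real.exp_le_one_iff.2 (by nlinarith)

lemma abs_semigroup_le {L t : ℝ} (ht : 0 ≤ t) (c : Mode → ℝ) (k : Mode) :
    |semigroup L t c k| ≤ |c k| := by
  rw [semigroup, abs_mul, Real.abs_exp]
  exact mul_le_of_le_one_left (abs_nonneg _) (exp_neg_mul_le_one ht (sq_nonneg _))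

lemma summable_semigroup_sq {L t : ℝ} (ht : 0 ≤ t) {c : Mode → ℝ} (hc : Summable fun k => c k ^ 2) :
    Summable fun k => semigroup L t c k ^ 2 :=
  Summable.of_nonneg_of_le (fun _ => sq_nonneg _) (fun k => sq_le_sq.2 (abs_semigroup_le ht c k)) hc

lemma norm_ofCoeffs_sub_sq {L : ℝ} (hL : 0 < L) {c c' : Mode → ℝ} (hc : Summable fun k => c k ^ 2)
    (hc' : Summable fun k => c' k ^ 2) :
    ‖ofCoeffs L c - ofCoeffs L c'‖ ^ 2 = ∑' k, (c k - c' k) ^ 2 := by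
  have h1 := summable_smul_basisL2 hL hc
  have h2 := summable_smul_basisL2 hL hc'
  have ho := orthonormal_basisL2_mode hL
  have hn : ∀ k : Mode, ‖(c k - c' k) • basisL2 L k.1‖ ^ 2 = (c k - c' k) ^ 2 := fun k => by
    rw [norm_smul, ho.1 k, mul_one, Real.norm_eq_abs, sq_abs]
  have hs : Summable fun k => (c k - c' k) ^ 2 :=
    Summable.of_nonneg_of_le (fun _ => sq_nonneg _)
      (fun k => by nlinarith [sq_nonneg (c k + c' k)]) ((hc.mul_left 2).add (hc'.mul_left 2))
  rw [ofCoeffs, ofCoeffs, ← h1.tsum_sub h2]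
  simp only [← sub_smul]
  rw [(summable_of_orthogonal (f := fun k : Mode => (c k - c' k) • basisL2 L k.1)
    (fun i j hij => ?_) (by simpa only [hn] using hs)).2]
  · simp only [hn]
  · change inner ℝ ((c i - c' i) • basisL2 L i.1) ((c j - c' j) • basisL2 L j.1) = 0
    rw [inner_smul_left, inner_smul_right, ho.2 hij]
    simp

/-- Parseval turns this into convergence of a series, dominated by `(2 * c k) ^ 2` because the
semigroup is a contraction on each mode. -/
lemma continuousOn_ofCoeffs_semigroup {L : ℝ} (hL : 0 < L) {c : Mode → ℝ}
    (hc : Summable fun k => c k ^ 2) :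
    ContinuousOn (fun t => ofCoeffs L (semigroup L t c)) (Ici 0) := by
  intro t ht
  rw [ContinuousWithinAt, tendsto_iff_norm_sub_tendsto_zero]
  have hsq : Tendsto (fun s => ‖ofCoeffs L (semigroup L s c) - ofCoeffs L (semigroup L t c)‖ ^ 2)
      (𝓝[Ici 0] t) (𝓝 0) := by
    have h0 : Tendsto (fun s => ∑' k, (semigroup L s c k - semigroup L t c k) ^ 2)
        (𝓝[Ici 0] t) (𝓝 (∑' _ : Mode, 0)) := by
      refine tendsto_tsum_of_dominated_convergence (bound := fun k => (2 * c k) ^ 2) ?_ ?_ ?_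
      · simpa only [mul_pow] using hc.mul_left (2 ^ 2)
      · intro k
        have : Continuous fun s => (semigroup L s c k - semigroup L t c k) ^ 2 := by
          unfold semigroup; fun_prop
        simpa using (this.tendsto t).mono_left nhdsWithin_le_nhds
      · filter_upwards [self_mem_nhdsWithin] with s hs k
        rw [Real.norm_eq_abs, abs_of_nonneg (sq_nonneg _), sq_le_sq, abs_mul, abs_two, two_mul]
        exact (abs_sub _ _).trans (add_le_add (abs_semigroup_le hs c k) (abs_semigroup_le ht c k))
    rw [tsum_zero] at h0
    refine h0.congr' ?_
    filter_upwards [self_mem_nhdsWithin] with s hs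
    exact (norm_ofCoeffs_sub_sq hL (summable_semigroup_sq hs hc) (summable_semigroup_sq ht hc)).symm
  simpa using hsq.sqrt

lemma memH_zero_iff {L : ℝ} (hL : 0 < L) (v : L2 L) : MemH L 0 v ↔ coeff L v 0 = 0 := by
  refine ⟨fun h => h.1, fun h => ⟨h, ?_⟩⟩
  simpa using summable_coeffs_sq hL v

lemma normH_zero_le_norm {L : ℝ} (hL : 0 < L) (v : L2 L) : normH L 0 v ≤ ‖v‖ := by
  rw [normH_zero, Real.sqrt_le_left (norm_nonneg _)]
  exact tsum_coeffs_sq_le hL v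

lemma continuousPathH_zero {L T : ℝ} (hL : 0 < L) {w : ℝ → L2 L}
    (h0 : ∀ t ∈ Icc 0 T, coeff L (w t) 0 = 0) (hw : ContinuousOn w (Icc 0 T)) :
    ContinuousPathH L 0 T w := by
  refine ⟨fun t ht => (memH_zero_iff hL _).2 (h0 t ht), fun t ht => ?_⟩
  exact squeeze_zero (fun _ => Real.sqrt_nonneg _) (fun s => normH_zero_le_norm hL _)
    (tendsto_iff_norm_sub_tendsto_zero.1 (hw t ht))

section

variable {Ω : Type*} [MeasurableSpace Ω] {P : Measure Ω}

lemma IsWienerIntegral.congr {B : ℝ≥0 → Ω → ℝ} {g : ℝ → ℝ} {t : ℝ} {X Y : Ω → ℝ}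
    (hX : IsWienerIntegral P B g t X) (h : X =ᵐ[P] Y) : IsWienerIntegral P B g t Y := by
  refine ⟨(memLp_congr_ae h).1 hX.1, hX.2.congr fun n => eLpNorm_congr_ae ?_⟩
  filter_upwards [h] with ω hω
  rw [hω]

lemma IsNoiseField.isStochasticConvolution [IsProbabilityMeasure P] {β : Mode → ℝ≥0 → Ω → ℝ}
    (hβ : IsCylindricalWiener P β) {L T : ℝ} {hL : 0 < L} {a : Mode → ℝ} {Φ : Ω → FieldSpace L T}
    (hΦ : IsNoiseField L T hL P β a Φ) (t : Icc (0 : ℝ) T) :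
    IsStochasticConvolution L P β a t (fun ω => evalL2 hL t (Φ ω)) where
  measurable := (evalL2 hL t).continuous.comp_aestronglyMeasurable hΦ.measurable
  mean_zero := hΦ.coeff_zero.mono fun ω h => h t
  coeffs_eq k := by
    refine (isWienerIntegral_ouProcess (hβ.brownian k) (sq_nonneg _) t.2.1 (a k)).congr ?_
    filter_upwards [hΦ.coeffs_eq] with ω h using (h t k).symm

/-- The solution of the linear equation. -/
def linearSolution {L T : ℝ} (hL : 0 < L) (hT : 0 < T) (σ : ℝ) (u₀ : L2 L) (Φ : Ω → FieldSpace L T)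
    (t : ℝ) (ω : Ω) : L2 L :=
  ofCoeffs L (semigroup L t (coeffs L u₀)) + σ • evalL2 hL (projIcc 0 T hT.le t) (Φ ω)

lemma coeff_zero_linearSolution {L T : ℝ} (hL : 0 < L) (hT : 0 < T) (σ : ℝ) (u₀ : L2 L)
    {Φ : Ω → FieldSpace L T} {β : Mode → ℝ≥0 → Ω → ℝ} {a : Mode → ℝ}
    (hΦ : IsNoiseField L T hL P β a Φ) :
    ∀ᵐ ω ∂P, ∀ t ∈ Icc 0 T, coeff L (linearSolution hL hT σ u₀ Φ t ω) 0 = 0 := by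
  filter_upwards [hΦ.coeff_zero] with ω h t ht
  rw [linearSolution, coeff_add, coeff_smul, h, mul_zero, add_zero,
    coeff_zero_ofCoeffs hL (summable_semigroup_sq ht.1 (summable_coeffs_sq hL u₀))]

omit [MeasurableSpace Ω] in
lemma coeffs_linearSolution {L T : ℝ} (hL : 0 < L) (hT : 0 < T) (σ : ℝ) (u₀ : L2 L)
    (Φ : Ω → FieldSpace L T) {t : ℝ} (ht : t ∈ Icc 0 T) (ω : Ω) (k : Mode) :
    coeffs L (linearSolution hL hT σ u₀ Φ t ω) k = semigroup L t (coeffs L u₀) k +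
      σ * coeffs L (evalL2 hL ⟨t, ht⟩ (Φ ω)) k := by
  rw [linearSolution, coeffs_add, coeffs_smul, projIcc_of_mem hT.le ht,
    coeffs_ofCoeffs hL (summable_semigroup_sq ht.1 (summable_coeffs_sq hL u₀))]

lemma isLinearSolution_linearSolution [IsProbabilityMeasure P] {β : Mode → ℝ≥0 → Ω → ℝ}
    (hβ : IsCylindricalWiener P β) {L T : ℝ} (hL : 0 < L) (hT : 0 < T) (σ : ℝ) (u₀ : L2 L)
    {Φ : Ω → FieldSpace L T} (hΦ : IsNoiseField L T hL P β (fun _ => 1) Φ) :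
    IsLinearSolution L T σ P β u₀ (linearSolution hL hT σ u₀ Φ) where
  measurable t _ := aestronglyMeasurable_const.add
    (((evalL2 hL _).continuous.comp_aestronglyMeasurable hΦ.measurable).const_smul σ)
  continuous := by
    filter_upwards [coeff_zero_linearSolution hL hT σ u₀ hΦ] with ω hω
    refine continuousPathH_zero hL hω ?_
    refine ((continuousOn_ofCoeffs_semigroup hL (summable_coeffs_sq hL u₀)).mono
      fun t ht => ht.1).add (Continuous.continuousOn ?_)
    exact ((continuous_evalL2 hL (Φ ω)).comp continuous_projIcc).const_smul σ
  equation := by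
    refine ⟨fun t ω => evalL2 hL (projIcc 0 T hT.le t) (Φ ω), fun t ht => ?_, fun t ht => ?_⟩
    · have := hΦ.isStochasticConvolution hβ (projIcc 0 T hT.le t)
      beta_reduce
      rw [projIcc_of_mem hT.le ht] at this ⊢
      exact this
    · refine Eventually.of_forall fun ω k => ?_
      beta_reduce
      rw [coeffs_linearSolution hL hT σ u₀ Φ ht, projIcc_of_mem hT.le ht]

end

/-! ### The nonlinearity -/

lemma slope_zero : slope 0 = 0 := by simp [slope]

lemma norm_slope (z : Plane) : ‖slope z‖ = (1 + ‖z‖ ^ 2)⁻¹ * ‖z‖ := by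
  rw [slope, norm_smul, Real.norm_of_nonneg (by positivity)]

lemma norm_slope_le (z : Plane) : ‖slope z‖ ≤ 1 / 2 := by
  rw [norm_slope, inv_mul_le_iff₀ (by positivity)]
  nlinarith [sq_nonneg (‖z‖ - 1)]

/-- The constant is crude; it only serves to make composition with `slope` measurable and a
continuous map of `L²` into itself. -/
lemma norm_slope_sub_le (z w : Plane) : ‖slope z - slope w‖ ≤ 3 * ‖z - w‖ := by
  have hz : 0 < 1 + ‖z‖ ^ 2 := by positivity
  have hw : 0 < 1 + ‖w‖ ^ 2 := by positivity
  have e : slope z - slope w = (1 + ‖z‖ ^ 2)⁻¹ • (z - w) +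
      ((1 + ‖z‖ ^ 2)⁻¹ * (‖w‖ ^ 2 - ‖z‖ ^ 2)) • slope w := by
    simp only [slope, smul_smul, smul_sub]
    have : (1 + ‖z‖ ^ 2)⁻¹ * (‖w‖ ^ 2 - ‖z‖ ^ 2) * (1 + ‖w‖ ^ 2)⁻¹ =
        (1 + ‖z‖ ^ 2)⁻¹ - (1 + ‖w‖ ^ 2)⁻¹ := by
      field_simp; ring
    rw [this, sub_smul]
    abel
  rw [e]
  refine (norm_add_le _ _).trans ?_
  rw [norm_smul, norm_smul, norm_slope, Real.norm_of_nonneg (by positivity), norm_mul,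
    Real.norm_of_nonneg (by positivity), Real.norm_eq_abs]
  have hd : |‖w‖ ^ 2 - ‖z‖ ^ 2| ≤ (‖w‖ + ‖z‖) * ‖z - w‖ := by
    rw [sq_sub_sq, abs_mul, abs_of_nonneg (by positivity), norm_sub_rev z w]
    exact mul_le_mul_of_nonneg_left (abs_norm_sub_norm_le w z) (by positivity)
  have h1 : (1 + ‖z‖ ^ 2)⁻¹ ≤ 1 := inv_le_one_of_one_le₀ (by nlinarith [sq_nonneg ‖z‖])
  have h2 : (1 + ‖z‖ ^ 2)⁻¹ * (‖w‖ + ‖z‖) * ((1 + ‖w‖ ^ 2)⁻¹ * ‖w‖) ≤ 2 := by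
    have : (1 + ‖z‖ ^ 2)⁻¹ * (‖w‖ + ‖z‖) * ((1 + ‖w‖ ^ 2)⁻¹ * ‖w‖) =
        ((‖w‖ + ‖z‖) * ‖w‖) / ((1 + ‖z‖ ^ 2) * (1 + ‖w‖ ^ 2)) := by field_simp
    rw [this, div_le_iff₀ (by positivity)]
    nlinarith [sq_nonneg (‖z‖ - ‖w‖), sq_nonneg (‖z‖ * ‖w‖), sq_nonneg ‖z‖, sq_nonneg ‖w‖]
  have hn := norm_nonneg (z - w)
  calc (1 + ‖z‖ ^ 2)⁻¹ * ‖z - w‖ +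
        (1 + ‖z‖ ^ 2)⁻¹ * |‖w‖ ^ 2 - ‖z‖ ^ 2| * ((1 + ‖w‖ ^ 2)⁻¹ * ‖w‖)
      ≤ 1 * ‖z - w‖ + (1 + ‖z‖ ^ 2)⁻¹ * ((‖w‖ + ‖z‖) * ‖z - w‖) * ((1 + ‖w‖ ^ 2)⁻¹ * ‖w‖) := by
        gcongr
    _ = ‖z - w‖ + ((1 + ‖z‖ ^ 2)⁻¹ * (‖w‖ + ‖z‖) * ((1 + ‖w‖ ^ 2)⁻¹ * ‖w‖)) * ‖z - w‖ := by ring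
    _ ≤ 3 * ‖z - w‖ := by nlinarith

lemma lipschitzWith_slope : LipschitzWith 3 slope :=
  LipschitzWith.of_dist_le_mul fun z w => by
    rw [dist_eq_norm, dist_eq_norm]; exact norm_slope_sub_le z w

/-- A pointwise bound for the nonlinearity relative to an approximate slope. -/
lemma norm_slope_le_add {M : ℝ} (hM : 0 < M) (z g : Plane) :
    ‖slope z‖ ≤ ‖z - g‖ / M + 1 / M + 4 * Real.exp (-(g 0 ^ 2 / (2 * M ^ 2))) := by
  have he := Real.exp_pos (-(g 0 ^ 2 / (2 * M ^ 2)))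
  have h0 : 0 ≤ ‖z - g‖ / M := by positivity
  have h1 : 0 < 1 / M := by positivity
  -- If `z` is large, the slope is at most `1 / M`. If `z` is far from `g`, the first term exceeds
  -- `1`. Otherwise `|g 0| ≤ 2 * M`, so the exponential is at least `e^{-2} ≥ 1 / 8`, and four times
  -- that covers the bound `1 / 2`.
  by_cases hz : M ≤ ‖z‖
  · have : ‖slope z‖ ≤ 1 / M := by
      rw [norm_slope, inv_mul_le_iff₀ (by positivity), mul_one_div, le_div_iff₀ hM]
      nlinarith [norm_nonneg z]
    linarith
  · by_cases hg : M ≤ ‖z - g‖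
    · have : 1 ≤ ‖z - g‖ / M := (one_le_div hM).2 hg
      linarith [norm_slope_le z]
    · have hg2 : ‖g‖ ≤ 2 * M := by
        have := norm_sub_norm_le g z
        rw [norm_sub_rev] at this
        linarith
      have hg3 : |g 0| ≤ 2 * M := (PiLp.norm_apply_le g 0).trans hg2
      have h4 : g 0 ^ 2 / (2 * M ^ 2) ≤ 2 := by
        rw [div_le_iff₀ (by positivity), ← sq_abs]
        nlinarith [abs_nonneg (g 0)]
      have h5 : Real.exp (-2) ≤ Real.exp (-(g 0 ^ 2 / (2 * M ^ 2))) := Real.exp_le_exp.2 (by linarith)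
      have h6 : 1 / 8 ≤ Real.exp (-2) := by
        rw [Real.exp_neg, ← one_div]
        refine one_div_le_one_div_of_le (Real.exp_pos _) ?_
        have := Real.exp_one_lt_d9
        rw [show (2 : ℝ) = 1 + 1 by norm_num, Real.exp_add]
        nlinarith [Real.exp_pos 1]
      linarith [norm_slope_le z]

/-- The vector field `∇v / (1 + |∇v|²)` as a function of the gradient. -/
def slopeLp {L : ℝ} (g : Lp Plane 2 (squareMeasure L)) : Lp Plane 2 (squareMeasure L) :=
  lipschitzWith_slope.compLp slope_zero g

lemma coeFn_slopeLp {L : ℝ} (g : Lp Plane 2 (squareMeasure L)) :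
    slopeLp g =ᵐ[squareMeasure L] fun x => slope (g x) :=
  lipschitzWith_slope.coeFn_compLp slope_zero g

lemma continuous_slopeLp {L : ℝ} : Continuous (slopeLp (L := L)) :=
  lipschitzWith_slope.continuous_compLp slope_zero

lemma squareMeasure_real_univ {L : ℝ} (hL : 0 < L) : (squareMeasure L).real univ = L ^ 2 := by
  have h := integral_square_mul hL (fun _ => 1) (fun _ => 1)
  simp only [mul_one, integral_const, intervalIntegral.integral_const, smul_eq_mul, sub_zero] at h
  rw [h, sq]

lemma norm_slopeLp_le {L : ℝ} (hL : 0 < L) (g : Lp Plane 2 (squareMeasure L)) :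
    ‖slopeLp g‖ ≤ L / 2 := by
  have h := Lp.norm_le_of_ae_bound (f := slopeLp g) (C := 1 / 2) (by norm_num) (by
    filter_upwards [coeFn_slopeLp g] with x hx
    rw [hx]; exact norm_slope_le _)
  have e : ((2 : ℝ≥0∞).toReal)⁻¹ = 1 / 2 := by simp
  have e2 : (measureUnivNNReal (squareMeasure L) : ℝ) = L ^ 2 := squareMeasure_real_univ hL
  rw [e2, e, ← Real.sqrt_eq_rpow, Real.sqrt_sq hL.le] at h
  linarith

lemma nonlinearity_eq_inner {L : ℝ} (v : L2 L) (k : Mode) :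
    nonlinearity L v k = -inner ℝ (slopeLp (grad L v)) (gradL2 L k) := by
  rw [nonlinearity, MeasureTheory.L2.inner_def]
  congr 1
  refine integral_congr_ae ?_
  filter_upwards [coeFn_slopeLp (grad L v), coeFn_gradL2 L k] with x h1 h2
  rw [h1, h2]

lemma norm_gradL2 {L : ℝ} (hL : 0 < L) (k : Mode) : ‖gradL2 L k‖ = √(eigenvalue L k) := by
  rw [← norm_gradL2_sq hL, Real.sqrt_sq (norm_nonneg _)]

/-- Cauchy-Schwarz with the bounded slope. The bound does not depend on `v`, which makes the
regularity of the drift deterministic. -/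
lemma abs_nonlinearity_le {L : ℝ} (hL : 0 < L) (v : L2 L) (k : Mode) :
    |nonlinearity L v k| ≤ L / 2 * √(eigenvalue L k) := by
  rw [nonlinearity_eq_inner, abs_neg, ← norm_gradL2 hL]
  exact (abs_real_inner_le_norm _ _).trans
    (mul_le_mul_of_nonneg_right (norm_slopeLp_le hL _) (norm_nonneg _))

lemma norm_gradient_basis_le {L : ℝ} (hL : 0 < L) (k : Mode) (x : Plane) :
    ‖∇ (basis L k.1) x‖ ≤ 2 / L * √(eigenvalue L k) := by
  have hs : √(2 / L) * √(2 / L) = 2 / L := Real.mul_self_sqrt (by positivity)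
  have hp : ∀ m n : ℤ, ∀ y z, (trig L m y * trig L n z) ^ 2 ≤ (2 / L) ^ 2 := by
    intro m n y z
    rw [← sq_abs, abs_mul]
    refine pow_le_pow_left₀ (by positivity) ?_ 2
    have := mul_le_mul (abs_trig_le hL m y) (abs_trig_le hL n z) (abs_nonneg _) (Real.sqrt_nonneg _)
    rwa [hs] at this
  rw [EuclideanSpace.norm_eq, Real.sqrt_le_left (by positivity), mul_pow,
    Real.sq_sqrt (eigenvalue_pos hL k).le, gradient_basis, Fin.sum_univ_two, eigenvalue_eq,
    modeNorm_sq]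
  simp only [Real.norm_eq_abs, sq_abs, Matrix.cons_val_zero, Matrix.cons_val_one]
  have h1 := mul_le_mul_of_nonneg_left (hp (-k.1.1) k.1.2 (x 0) (x 1))
    (sq_nonneg (2 * Real.pi * k.1.1 / L))
  have h2 := mul_le_mul_of_nonneg_left (hp k.1.1 (-k.1.2) (x 0) (x 1))
    (sq_nonneg (2 * Real.pi * k.1.2 / L))
  refine le_trans (le_of_eq (by ring)) ((add_le_add h1 h2).trans (le_of_eq (by ring)))

/-- This version keeps the spatial average of the slope, the quantity that becomes small in mean
when the gradient is rough. -/
lemma abs_nonlinearity_le_integral {L : ℝ} (hL : 0 < L) (v : L2 L) (k : Mode) :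
    |nonlinearity L v k| ≤
      2 / L * √(eigenvalue L k) * ∫ x, ‖slope (grad L v x)‖ ∂squareMeasure L := by
  rw [nonlinearity, abs_neg, ← integral_const_mul, ← Real.norm_eq_abs]
  refine norm_integral_le_of_norm_le ?_ (Eventually.of_forall fun x => ?_)
  · refine Integrable.const_mul ?_ _
    refine Integrable.of_bound (C := 1 / 2) ?_ (Eventually.of_forall fun x => ?_)
    · exact (lipschitzWith_slope.continuous.comp_aestronglyMeasurable (Lp.aestronglyMeasurable _)).norm
    · rw [norm_norm]; exact norm_slope_le _
  · rw [mul_comm]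
    exact (norm_inner_le_norm _ _).trans
      (mul_le_mul_of_nonneg_left (norm_gradient_basis_le hL k x) (norm_nonneg _))

/-- The coefficients of the nonlinearity are continuous along paths in `H¹`. -/
lemma continuous_nonlinearity {L T : ℝ} (hL : 0 < L) {w : ℝ → L2 L} (hw : ContinuousPathH L 1 T w)
    (k : Mode) : Continuous fun t : Icc (0 : ℝ) T => nonlinearity L (w t) k := by
  have hg : Continuous fun t : Icc (0 : ℝ) T => grad L (w t) := by
    refine continuous_iff_continuousAt.2 fun t => ?_
    rw [ContinuousAt, tendsto_iff_norm_sub_tendsto_zero]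
    have h1 := (hw.2 t t.2).comp (tendsto_nhdsWithin_iff.2
      ⟨continuous_subtype_val.tendsto t, Eventually.of_forall fun s : Icc (0 : ℝ) T => s.2⟩)
    refine h1.congr fun s => ?_
    exact (norm_grad_sub hL (hw.1 s s.2) (hw.1 t t.2)).symm
  simp only [nonlinearity_eq_inner]
  exact ((continuous_slopeLp.comp hg).inner continuous_const).neg

lemma ContinuousPathH.continuous_coeffs {L T : ℝ} (hL : 0 < L) {w : ℝ → L2 L}
    (hw : ContinuousPathH L 1 T w) (k : Mode) :
    Continuous fun t : Icc (0 : ℝ) T => coeffs L (w t) k := by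
  refine continuous_iff_continuousAt.2 fun t => ?_
  rw [ContinuousAt, tendsto_iff_norm_sub_tendsto_zero]
  have h1 := (hw.2 t t.2).comp (tendsto_nhdsWithin_iff.2
    ⟨continuous_subtype_val.tendsto t, Eventually.of_forall fun s : Icc (0 : ℝ) T => s.2⟩)
  have h2 := h1.div_const √(eigenvalue L k)
  rw [zero_div] at h2
  refine squeeze_zero (fun _ => norm_nonneg _) (fun s => ?_) h2
  rw [← coeffs_sub]
  exact abs_coeffs_le_normH hL (MemH.sub_one hL (hw.1 s s.2) (hw.1 t t.2)) k

open scoped Classical in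
/-- The coefficients of the nonlinearity along a path, as a continuous function of time. -/
def nonlinearityPath (L T : ℝ) (w : ℝ → L2 L) (k : Mode) : C(Icc (0 : ℝ) T, ℝ) :=
  -- The default value `0` lets the norm bounds below hold for every path, not just for continuous
  -- paths in `H¹`.
  if h : Continuous fun t : Icc (0 : ℝ) T => nonlinearity L (w t) k then ⟨_, h⟩ else 0

lemma nonlinearityPath_apply {L T : ℝ} (hL : 0 < L) {w : ℝ → L2 L} (hw : ContinuousPathH L 1 T w)
    (k : Mode) (t : Icc (0 : ℝ) T) : nonlinearityPath L T w k t = nonlinearity L (w t) k := by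
  rw [nonlinearityPath, dif_pos (continuous_nonlinearity hL hw k)]
  rfl

lemma norm_nonlinearityPath_le {L T : ℝ} (hL : 0 < L) (w : ℝ → L2 L) (k : Mode) :
    ‖nonlinearityPath L T w k‖ ≤ L / 2 * √(eigenvalue L k) := by
  rw [ContinuousMap.norm_le _ (by positivity)]
  intro t
  rw [nonlinearityPath]
  split_ifs
  · exact abs_nonlinearity_le hL _ k
  · simp; positivity

/-- The function `t ↦ ∫_0^t e^{-(t-s) lam} f(s) ds`. -/
def convPath {T : ℝ} (hT : 0 < T) (lam : ℝ) (f : C(Icc (0 : ℝ) T, ℝ)) : C(Icc (0 : ℝ) T, ℝ) where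
  toFun t := ∫ s in (0 : ℝ)..t, Real.exp (-(t - s) * lam) * f (projIcc 0 T hT.le s)
  continuous_toFun := by
    simp only [integral_exp_mul_eq]
    have hc : Continuous fun s => Real.exp (s * lam) * f (projIcc 0 T hT.le s) := by
      have := f.continuous.comp (continuous_projIcc (h := hT.le))
      exact Continuous.mul (by fun_prop) this
    have := intervalIntegral.continuous_primitive (μ := volume)
      (fun a b => hc.intervalIntegrable a b) 0
    exact Continuous.mul (by fun_prop) (this.comp continuous_subtype_val)

lemma convPath_apply {T : ℝ} (hT : 0 < T) (lam : ℝ) (f : C(Icc (0 : ℝ) T, ℝ)) (t : Icc (0 : ℝ) T) :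
    convPath hT lam f t =
      ∫ s in (0 : ℝ)..t, Real.exp (-(t - s) * lam) * f (projIcc 0 T hT.le s) := rfl

/-- The smoothing of the semigroup: the exponential kernel has mass at most `1 / lam`, which for
`lam = μ_k²` gains four derivatives. -/
lemma norm_convPath_le_div {T : ℝ} (hT : 0 < T) {lam : ℝ} (hlam : 0 < lam)
    (f : C(Icc (0 : ℝ) T, ℝ)) : ‖convPath hT lam f‖ ≤ ‖f‖ / lam := by
  rw [ContinuousMap.norm_le _ (by positivity)]
  intro t
  rw [convPath_apply]
  have h := intervalIntegral.norm_integral_le_of_norm_le (μ := volume) (a := 0) (b := t)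
    (f := fun s => Real.exp (-(t - s) * lam) * f (projIcc 0 T hT.le s))
    (g := fun s => ‖f‖ / lam * (lam * Real.exp (-(t - s) * lam))) t.2.1
    (Eventually.of_forall fun s _ => ?_) ((by fun_prop : Continuous _).intervalIntegrable _ _)
  · refine h.trans ?_
    rw [intervalIntegral.integral_const_mul, integral_lam_exp]
    refine mul_le_of_le_one_right (by positivity) ?_
    simp
    positivity
  · rw [norm_mul, Real.norm_of_nonneg (Real.exp_pos _).le]
    have := f.norm_coe_le_norm (projIcc 0 T hT.le s)
    calc _ ≤ Real.exp (-(t - s) * lam) * ‖f‖ := by gcongr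
      _ = _ := by field_simp

/-- No smoothing is used here, but the bound is linear in `|f|`, so smallness of the nonlinearity in
mean passes to the drift. -/
lemma norm_convPath_le_integral {T : ℝ} (hT : 0 < T) {lam : ℝ} (hlam : 0 ≤ lam)
    (f : C(Icc (0 : ℝ) T, ℝ)) :
    ‖convPath hT lam f‖ ≤ ∫ s in (0 : ℝ)..T, |f (projIcc 0 T hT.le s)| := by
  have hc : Continuous fun s => |f (projIcc 0 T hT.le s)| :=
    (f.continuous.comp (continuous_projIcc (h := hT.le))).abs
  have h0 : ∀ s, 0 ≤ |f (projIcc 0 T hT.le s)| := fun _ => abs_nonneg _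
  rw [ContinuousMap.norm_le _ (intervalIntegral.integral_nonneg hT.le fun s _ => h0 s)]
  intro t
  rw [convPath_apply]
  have h := intervalIntegral.norm_integral_le_of_norm_le (μ := volume) (a := 0) (b := t)
    (f := fun s => Real.exp (-(t - s) * lam) * f (projIcc 0 T hT.le s))
    (g := fun s => |f (projIcc 0 T hT.le s)|) t.2.1
    (Eventually.of_forall fun s hs => ?_) (hc.intervalIntegrable _ _)
  · refine h.trans ?_
    exact intervalIntegral.integral_mono_interval le_rfl t.2.1 t.2.2
      (Eventually.of_forall fun s => h0 s) (hc.intervalIntegrable _ _)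
  · rw [norm_mul, Real.norm_of_nonneg (Real.exp_pos _).le]
    exact mul_le_of_le_one_left (norm_nonneg _) (exp_neg_sub_mul_le_one hlam hs.2)

/-- The mode `k` of `-∫_0^t e^{-(t-s)Δ²} ∇ · (∇w / (1 + |∇w|²)) ds`. -/
def driftPath {T : ℝ} (hT : 0 < T) (L : ℝ) (w : ℝ → L2 L) (k : Mode) : C(Icc (0 : ℝ) T, ℝ) :=
  -convPath hT (eigenvalue L k ^ 2) (nonlinearityPath L T w k)

lemma driftPath_apply {L T : ℝ} (hL : 0 < L) (hT : 0 < T) {w : ℝ → L2 L}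
    (hw : ContinuousPathH L 1 T w) (k : Mode) (t : Icc (0 : ℝ) T) :
    driftPath hT L w k t =
      -∫ s in (0 : ℝ)..t, semigroup L (t - s) (nonlinearity L (w s)) k := by
  rw [driftPath, ContinuousMap.neg_apply, convPath_apply]
  congr 1
  refine intervalIntegral.integral_congr fun s hs => ?_
  rw [uIcc_of_le t.2.1] at hs
  have hs' : s ∈ Icc 0 T := ⟨hs.1, hs.2.trans t.2.2⟩
  simp only [semigroup, projIcc_of_mem hT.le hs', nonlinearityPath_apply hL hw]

lemma norm_driftPath_le {L T : ℝ} (hL : 0 < L) (hT : 0 < T) (w : ℝ → L2 L) (k : Mode) :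
    ‖driftPath hT L w k‖ ≤ L / 2 * (√(eigenvalue L k) / eigenvalue L k ^ 2) := by
  have := eigenvalue_pos hL k
  rw [driftPath, norm_neg]
  refine (norm_convPath_le_div hT (by positivity) _).trans ?_
  rw [← mul_div_assoc]
  exact div_le_div_of_nonneg_right (norm_nonlinearityPath_le hL w k) (by positivity)

lemma sqrt_eigenvalue_div {L : ℝ} (hL : 0 < L) (k : Mode) :
    √(eigenvalue L k) / eigenvalue L k ^ 2 = 1 / (2 * Real.pi / L) ^ 3 * (1 / modeNorm k ^ 3) := by
  have hN := one_le_modeNorm k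
  have hc : 0 < 2 * Real.pi / L := by positivity
  have h : √(eigenvalue L k) = 2 * Real.pi / L * modeNorm k := by
    rw [eigenvalue_eq, ← mul_pow, Real.sqrt_sq (by positivity)]
  rw [h, eigenvalue_eq]
  set c := 2 * Real.pi / L
  field_simp

lemma summable_sqrt_eigenvalue_div {L : ℝ} (hL : 0 < L) :
    Summable fun k => √(eigenvalue L k) / eigenvalue L k ^ 2 := by
  simp only [sqrt_eigenvalue_div hL]
  exact (summable_modeNorm_inv_pow (by norm_num)).mul_left _

/-! ### Roughness of the noise -/

/-- The mode `(±(i + 1), ±(j + 1))`. -/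
def signedMode (p : (Σ _ : ℕ, ℕ) × (Bool × Bool)) : Mode :=
  ⟨(bif p.2.1 then (p.1.1 + 1 : ℤ) else -(p.1.1 + 1 : ℤ),
    bif p.2.2 then (p.1.2 + 1 : ℤ) else -(p.1.2 + 1 : ℤ)), fun h => by
      have h0 := congrArg Prod.fst h
      rcases p with ⟨p, ⟨b, b'⟩⟩
      cases b <;> simp at h0 <;> omega⟩

lemma signedMode_injective : Function.Injective signedMode := by
  rintro ⟨⟨i, j⟩, ⟨b, c⟩⟩ ⟨⟨i', j'⟩, ⟨b', c'⟩⟩ h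
  have h0 := congrArg (fun k : Mode => k.1.1) h
  have h1 := congrArg (fun k : Mode => k.1.2) h
  have e0 : i = i' ∧ b = b' := by cases b <;> cases b' <;> simp [signedMode] at h0 ⊢ <;> omega
  have e1 : j = j' ∧ c = c' := by cases c <;> cases c' <;> simp [signedMode] at h1 ⊢ <;> omega
  rw [e0.1, e0.2, e1.1, e1.2]

lemma gradient_basis_zero (L : ℝ) (k : Mode) (x : Plane) :
    (∇ (basis L k.1) x) 0 = 2 * Real.pi * k.1.1 / L * trig L (-k.1.1) (x 0) * trig L k.1.2 (x 1) := by
  rw [gradient_basis]; rfl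

/-- The sum over the four sign patterns of the variances of the first partial derivatives does not
depend on the point. -/
lemma sum_signedMode {L : ℝ} (hL : 0 < L) (p : Σ _ : ℕ, ℕ) (x : Plane) :
    ∑ b : Bool × Bool, (∇ (basis L (signedMode (p, b)).1) x) 0 ^ 2 / eigenvalue L (signedMode (p, b)) ^ 2 =
      (2 * Real.pi / L * (p.1 + 1)) ^ 2 * (2 / L) ^ 2 /
        ((2 * Real.pi / L) ^ 2 * ((p.1 + 1) ^ 2 + (p.2 + 1) ^ 2)) ^ 2 := by
  have he : ∀ b, eigenvalue L (signedMode (p, b)) =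
      (2 * Real.pi / L) ^ 2 * ((p.1 + 1) ^ 2 + (p.2 + 1) ^ 2) := by
    rintro ⟨b, c⟩
    rw [eigenvalue_eq, modeNorm_sq]
    congr 1
    cases b <;> cases c <;>
      · simp only [signedMode, cond_true, cond_false]
        push_cast
        ring
  simp only [he, gradient_basis_zero]
  rw [← Finset.sum_div]
  congr 1
  have h1 := trig_sq_add_trig_neg_sq hL (p.1 + 1) (x 0)
  have h2 := trig_sq_add_trig_neg_sq hL (p.2 + 1) (x 1)
  simp only [Fintype.sum_prod_type, Fintype.sum_bool, signedMode, cond_true, cond_false, neg_neg]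
  push_cast
  -- Differentiation only flips one index, so the squares factor into sums over both signs in each
  -- variable; one factor `2 / L` stands for each of the two Pythagorean sums.
  rw [show (2 / L) ^ 2 = 2 / L * (2 / L) by ring]
  nth_rewrite 1 [← h1]
  rw [← h2]
  ring

/-- The gradient of the stochastic convolution has infinite variance: the divergence is uniform
in space. -/
lemma exists_modes_le_sum {L : ℝ} (hL : 0 < L) (Λ : ℝ) :
    ∃ F : Finset Mode, ∀ x : Plane,
      Λ ≤ ∑ k ∈ F, (∇ (basis L k.1) x) 0 ^ 2 / eigenvalue L k ^ 2 := by
  have hc : 0 < 2 * Real.pi / L := by positivity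
  set c := 2 * Real.pi / L with hcd
  -- For `j ≤ i` the four modes with `(|k₁|, |k₂|) = (i + 1, j + 1)` contribute at least `1 / (L² c²
  -- (i + 1)²)`. The `i + 1` choices of `j` produce the harmonic series.
  have h := (Real.tendsto_sum_range_one_div_nat_succ_atTop).const_mul_atTop
    (show 0 < 1 / (L ^ 2 * c ^ 2) by positivity)
  obtain ⟨n, hn⟩ := (h.eventually (eventually_ge_atTop Λ)).exists
  refine ⟨(((Finset.range n).sigma fun i => Finset.range (i + 1)) ×ˢ Finset.univ).map
    ⟨signedMode, signedMode_injective⟩, fun x => hn.trans ?_⟩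
  rw [Finset.sum_map, Finset.sum_product, Finset.sum_sigma, Finset.mul_sum]
  refine Finset.sum_le_sum fun i _ => ?_
  have hb : ∀ j ∈ Finset.range (i + 1), 1 / (L ^ 2 * c ^ 2) * (1 / ((i : ℝ) + 1) ^ 2) ≤
      ∑ b : Bool × Bool, (∇ (basis L (signedMode (⟨i, j⟩, b)).1) x) 0 ^ 2 /
        eigenvalue L (signedMode (⟨i, j⟩, b)) ^ 2 := by
    intro j hj
    rw [sum_signedMode hL, ← hcd]
    have hj' : (j : ℝ) ≤ i := by exact_mod_cast Nat.lt_succ_iff.1 (Finset.mem_range.1 hj)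
    have h1 : (c ^ 2 * (((i : ℝ) + 1) ^ 2 + ((j : ℝ) + 1) ^ 2)) ^ 2 ≤ (c ^ 2 * (2 * ((i : ℝ) + 1) ^ 2)) ^ 2 := by
      have : ((j : ℝ) + 1) ^ 2 ≤ ((i : ℝ) + 1) ^ 2 := pow_le_pow_left₀ (by positivity) (by linarith) 2
      refine pow_le_pow_left₀ (by positivity) ?_ 2
      exact mul_le_mul_of_nonneg_left (by linarith) (by positivity)
    refine le_trans (le_of_eq ?_) (div_le_div_of_nonneg_left (by positivity) (by positivity) h1)
    field_simp
  refine le_trans ?_ (Finset.sum_le_sum hb)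
  rw [Finset.sum_const, Finset.card_range, nsmul_eq_mul]
  refine le_of_eq ?_
  push_cast
  field_simp

/-- The sum of `|k|^{-2}` over the planar lattice diverges only logarithmically, so any decay `δ >
0` of the coefficients makes the gradient of the regularized convolution square integrable. -/
lemma summable_sq_div_eigenvalue {L δ C : ℝ} (hL : 0 < L) (hδ : 0 < δ) {a : Mode → ℝ}
    (ha : ∀ k, |a k| ≤ C * modeNorm k ^ (-δ)) : Summable fun k => a k ^ 2 / eigenvalue L k := by
  refine Summable.of_nonneg_of_le (fun k => div_nonneg (sq_nonneg _) (eigenvalue_pos hL k).le)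
    (fun k => ?_) ((summable_modeNorm_rpow (s := 2 + 2 * δ) (by linarith)).mul_left
      (C ^ 2 / (2 * Real.pi / L) ^ 2))
  have hN := one_le_modeNorm k
  have hN0 : 0 < modeNorm k := by linarith
  have h1 : a k ^ 2 ≤ (C * modeNorm k ^ (-δ)) ^ 2 := by
    rw [← sq_abs]; exact pow_le_pow_left₀ (abs_nonneg _) (ha k) 2
  have h2 : modeNorm k ^ (-(2 + 2 * δ)) = (modeNorm k ^ (-δ)) ^ 2 / modeNorm k ^ 2 := by
    rw [← Real.rpow_natCast, ← Real.rpow_mul hN0.le, ← Real.rpow_natCast, ← Real.rpow_sub hN0]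
    congr 1; push_cast; ring
  rw [h2, eigenvalue_eq]
  refine (div_le_div_of_nonneg_right h1 (by positivity)).trans (le_of_eq ?_)
  rw [mul_pow, mul_div_mul_comm]

section

variable {Ω : Type*} [MeasurableSpace Ω] {P : Measure Ω}

/-- A Gaussian variable with large variance is unlikely to be small. -/
lemma lintegral_exp_neg_sq_le {Y : Ω → ℝ} {v : ℝ≥0} (hv : v ≠ 0) (hY : HasLaw Y (gaussianReal 0 v) P)
    {M : ℝ} (hM : 0 < M) :
    ∫⁻ ω, ENNReal.ofReal (Real.exp (-(Y ω ^ 2 / (2 * M ^ 2)))) ∂P ≤ ENNReal.ofReal (M / √v) := by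
  have hm : Measurable fun y : ℝ => ENNReal.ofReal (Real.exp (-(y ^ 2 / (2 * M ^ 2)))) := by fun_prop
  have hv0 : (0 : ℝ) < v := by positivity
  rw [show (∫⁻ ω, ENNReal.ofReal (Real.exp (-(Y ω ^ 2 / (2 * M ^ 2)))) ∂P) =
    ∫⁻ y, ENNReal.ofReal (Real.exp (-(y ^ 2 / (2 * M ^ 2)))) ∂(gaussianReal 0 v) by
      rw [← hY.map_eq, lintegral_map' hm.aemeasurable hY.aemeasurable]]
  rw [gaussianReal_of_var_ne_zero 0 hv, lintegral_withDensity_eq_lintegral_mul _ (by fun_prop) hm]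
  have hint : Integrable fun y : ℝ => Real.exp (-(1 / (2 * M ^ 2)) * y ^ 2) :=
    integrable_exp_neg_mul_sq (by positivity)
  -- The density is replaced by its maximum `(2πv)^{-1/2}`; the remaining Gaussian integral is
  -- `√(2π) * M`.
  calc ∫⁻ y, (gaussianPDF 0 v * fun y => ENNReal.ofReal (Real.exp (-(y ^ 2 / (2 * M ^ 2))))) y
      ≤ ∫⁻ y, ENNReal.ofReal ((√(2 * Real.pi * v))⁻¹ * Real.exp (-(1 / (2 * M ^ 2)) * y ^ 2)) := by
        refine lintegral_mono fun y => ?_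
        rw [Pi.mul_apply, gaussianPDF, ← ENNReal.ofReal_mul (gaussianPDFReal_nonneg _ _ _)]
        refine ENNReal.ofReal_le_ofReal ?_
        have e : -(y ^ 2 / (2 * M ^ 2)) = -(1 / (2 * M ^ 2)) * y ^ 2 := by ring
        rw [e]
        refine mul_le_mul_of_nonneg_right ?_ (Real.exp_pos _).le
        rw [gaussianPDFReal]
        refine mul_le_of_le_one_right (by positivity) (Real.exp_le_one_iff.2 ?_)
        exact div_nonpos_of_nonpos_of_nonneg (neg_nonpos.2 (sq_nonneg _)) (by positivity)
    _ = ENNReal.ofReal ((√(2 * Real.pi * v))⁻¹ * √(Real.pi / (1 / (2 * M ^ 2)))) := by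
        rw [← ofReal_integral_eq_lintegral_ofReal (hint.const_mul _)
          (Eventually.of_forall fun y => by positivity), integral_const_mul, integral_gaussian]
    _ = ENNReal.ofReal (M / √v) := by
        congr 1
        have e1 : Real.pi / (1 / (2 * M ^ 2)) = 2 * Real.pi * M ^ 2 := by field_simp
        rw [e1, Real.sqrt_mul' (2 * Real.pi) hv0.le, Real.sqrt_mul' (2 * Real.pi) (sq_nonneg M),
          Real.sqrt_sq hM.le]
        have : √(2 * Real.pi) ≠ 0 := by positivity
        have : √(v : ℝ) ≠ 0 := by positivity
        field_simp

/-- Fubini for a random field with finitely many random coefficients. -/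
lemma lintegral_integral_exp_le [IsProbabilityMeasure P] {L : ℝ} (hL : 0 < L) {ι : Type*}
    (F : Finset ι) {c : ι → Plane → ℝ} (hc : ∀ k, Continuous (c k)) {X : ι → Ω → ℝ}
    (hX : ∀ k, AEStronglyMeasurable (X k) P) {M : ℝ} {B : ℝ}
    (hB : ∀ x, ∫⁻ ω, ENNReal.ofReal
      (Real.exp (-((∑ k ∈ F, c k x * X k ω) ^ 2 / (2 * M ^ 2)))) ∂P ≤ ENNReal.ofReal B) :
    ∫⁻ ω, ENNReal.ofReal (∫ x, Real.exp (-((∑ k ∈ F, c k x * X k ω) ^ 2 / (2 * M ^ 2)))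
      ∂squareMeasure L) ∂P ≤ ENNReal.ofReal (B * L ^ 2) := by
  have h1 : ∀ ω, Continuous fun x : Plane =>
      Real.exp (-((∑ k ∈ F, c k x * X k ω) ^ 2 / (2 * M ^ 2))) := by
    intro ω; fun_prop
  have h2 : ∀ ω, ENNReal.ofReal (∫ x, Real.exp (-((∑ k ∈ F, c k x * X k ω) ^ 2 / (2 * M ^ 2)))
      ∂squareMeasure L) = ∫⁻ x, ENNReal.ofReal
        (Real.exp (-((∑ k ∈ F, c k x * X k ω) ^ 2 / (2 * M ^ 2)))) ∂squareMeasure L := by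
    intro ω
    refine ofReal_integral_eq_lintegral_ofReal ?_ (Eventually.of_forall fun x => (Real.exp_pos _).le)
    exact memLp_one_iff_integrable.1 (memLp_of_continuous (h1 ω) inferInstance 1)
  simp only [h2]
  rw [lintegral_lintegral_swap]
  · refine (lintegral_mono hB).trans ?_
    rw [lintegral_const, ← ofReal_measureReal, squareMeasure_real_univ hL,
      ← ENNReal.ofReal_mul' (by positivity)]
  · have hs : AEStronglyMeasurable (fun p : Ω × Plane => ∑ k ∈ F, c k p.2 * X k p.1)
        (P.prod (squareMeasure L)) :=
      Finset.aestronglyMeasurable_fun_sum _ fun k _ =>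
        ((hc k).measurable.comp measurable_snd).aestronglyMeasurable.mul ((hX k).comp_fst)
    have := hs.aemeasurable
    exact (((this.pow_const 2).div_const _).neg.exp).ennreal_ofReal

/-- The spatial average of the nonlinearity relative to an approximate slope. -/
lemma integral_norm_slope_le {L M : ℝ} (hL : 0 < L) (hM : 0 < M)
    (z g : Lp Plane 2 (squareMeasure L)) {G : Plane → ℝ} (hG : Continuous G)
    (hg : ∀ᵐ x ∂squareMeasure L, g x 0 = G x) :
    ∫ x, ‖slope (z x)‖ ∂squareMeasure L ≤ (2 * L ^ 2 + ‖z - g‖ ^ 2) / M +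
      4 * ∫ x, Real.exp (-(G x ^ 2 / (2 * M ^ 2))) ∂squareMeasure L := by
  have hn : ‖z - g‖ ^ 2 = ∫ x, ‖(z - g) x‖ ^ 2 ∂squareMeasure L := by
    rw [← real_inner_self_eq_norm_sq, MeasureTheory.L2.inner_def]
    simp only [real_inner_self_eq_norm_sq]
  have hi1 : Integrable (fun x => ‖(z - g) x‖ ^ 2) (squareMeasure L) :=
    (Lp.memLp (z - g)).norm.integrable_sq
  have hcE : Continuous fun x : Plane => Real.exp (-(G x ^ 2 / (2 * M ^ 2))) := by fun_prop
  have hi2 : Integrable (fun x : Plane => Real.exp (-(G x ^ 2 / (2 * M ^ 2)))) (squareMeasure L) :=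
    memLp_one_iff_integrable.1 (memLp_of_continuous hcE inferInstance 1)
  have hi3 : Integrable (fun x => ‖slope (z x)‖) (squareMeasure L) := by
    refine Integrable.of_bound (C := 1 / 2) ?_ (Eventually.of_forall fun x => ?_)
    · exact (lipschitzWith_slope.continuous.comp_aestronglyMeasurable (Lp.aestronglyMeasurable _)).norm
    · rw [norm_norm]; exact norm_slope_le _
  have hi4 : Integrable (fun _ : Plane => (2 : ℝ)) (squareMeasure L) := integrable_const _
  calc ∫ x, ‖slope (z x)‖ ∂squareMeasure L
      ≤ ∫ x, ((2 + ‖(z - g) x‖ ^ 2) / M + 4 * Real.exp (-(G x ^ 2 / (2 * M ^ 2)))) ∂squareMeasure L := by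
        refine integral_mono_ae hi3 (((hi4.add hi1).div_const M).add (hi2.const_mul 4)) ?_
        filter_upwards [hg, Lp.coeFn_sub z g] with x hx hs
        have h := norm_slope_le_add hM (z x) (g x)
        rw [hx] at h
        rw [hs, Pi.sub_apply]
        refine h.trans (add_le_add_left ?_ _)
        rw [← add_div]
        refine div_le_div_of_nonneg_right ?_ hM.le
        -- The linear term is traded for the square by `y ≤ 1 + y²`, since only the `L²` distance is
        -- controlled.
        nlinarith [sq_nonneg (‖z x - g x‖ - 1)]
    _ = _ := by
        rw [integral_add (f := fun x => (2 + ‖(z - g) x‖ ^ 2) / M) ((hi4.add hi1).div_const M)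
          (hi2.const_mul 4), integral_div, integral_add hi4 hi1, integral_const, squareMeasure_real_univ hL, ← hn, integral_const_mul,
          smul_eq_mul, mul_comm (L ^ 2)]

end

/-! ### Mild solutions -/

section

variable {Ω : Type*} [MeasurableSpace Ω] {P : Measure Ω}

/-- The mild formulation, mode by mode and simultaneously for all times. -/
lemma IsMildSolution.coeffs_eq [IsProbabilityMeasure P] {β : Mode → ℝ≥0 → Ω → ℝ}
    (hβ : IsCylindricalWiener P β) {L T σ : ℝ} (hL : 0 < L) (hT : 0 < T) {a : Mode → ℝ} {u₀ : L2 L}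
    {u : ℝ → Ω → L2 L} (hu : IsMildSolution L T σ P β a u₀ u) :
    ∀ᵐ ω ∂P, ∀ t : Icc (0 : ℝ) T, ∀ k, coeffs L (u t ω) k = semigroup L t (coeffs L u₀) k +
      driftPath hT L (fun s => u s ω) k t + σ * (a k * modeProcess L β k t ω) := by
  obtain ⟨Z, hZ, hZe⟩ := hu.equation
  have h1 : ∀ t : Icc (0 : ℝ) T, ∀ᵐ ω ∂P, ∀ k, coeffs L (u t ω) k = semigroup L t (coeffs L u₀) k +
      driftPath hT L (fun s => u s ω) k t + σ * (a k * modeProcess L β k t ω) := by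
    intro t
    have h2 : ∀ᵐ ω ∂P, ∀ k, coeffs L (Z t ω) k = a k * modeProcess L β k t ω :=
      ae_all_iff.2 fun k => IsWienerIntegral.ae_eq (hβ.brownian k) ((hZ t t.2).coeffs_eq k)
        (isWienerIntegral_ouProcess (hβ.brownian k) (sq_nonneg _) t.2.1 (a k))
    filter_upwards [hZe t t.2, h2, hu.continuous] with ω e1 e2 hc k
    rw [e1 k, e2 k, driftPath_apply hL hT hc, sub_eq_add_neg]
  -- The equation holds almost surely at each time; countably many dense times and continuity in `t`
  -- of both sides give all times at once.
  obtain ⟨D, hDc, hDd⟩ := TopologicalSpace.exists_countable_dense (Icc (0 : ℝ) T)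
  have h2 := (ae_ball_iff hDc).2 fun t (_ : t ∈ D) => h1 t
  filter_upwards [h2, hu.continuous] with ω hω hc t k
  refine hDd.induction (P := fun t => coeffs L (u t ω) k = semigroup L t (coeffs L u₀) k +
    driftPath hT L (fun s => u s ω) k t + σ * (a k * modeProcess L β k t ω))
    (fun t ht => hω t ht k) ?_ t
  refine isClosed_eq (hc.continuous_coeffs hL k) ?_
  have e1 : Continuous fun t : Icc (0 : ℝ) T => semigroup L t (coeffs L u₀) k := by
    unfold semigroup; fun_prop
  have e2 : Continuous fun t : Icc (0 : ℝ) T => modeProcess L β k t ω :=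
    (continuous_ouProcess _ _ ω).comp continuous_subtype_val
  exact (e1.add (driftPath hT L _ k).continuous).add (continuous_const.mul (continuous_const.mul e2))

lemma aestronglyMeasurable_grad {L : ℝ} (hL : 0 < L) {w : Ω → L2 L} (hw : AEStronglyMeasurable w P)
    (h : ∀ᵐ ω ∂P, MemH L 1 (w ω)) : AEStronglyMeasurable (fun ω => grad L (w ω)) P := by
  refine aestronglyMeasurable_of_tendsto_ae (atTop : Filter (Finset Mode))
    (f := fun F ω => ∑ k ∈ F, coeffs L (w ω) k • gradL2 L k) (fun F => ?_) ?_
  · refine Finset.aestronglyMeasurable_fun_sum _ fun k _ => ?_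
    exact ((continuous_coeffs L k).comp_aestronglyMeasurable hw).smul_const _
  · filter_upwards [h] with ω hω
    exact (summable_smul_gradL2 hL hω.summable_one).1.hasSum

lemma aestronglyMeasurable_nonlinearity {L : ℝ} (hL : 0 < L) {w : Ω → L2 L}
    (hw : AEStronglyMeasurable w P) (h : ∀ᵐ ω ∂P, MemH L 1 (w ω)) (k : Mode) :
    AEStronglyMeasurable (fun ω => nonlinearity L (w ω) k) P := by
  simp only [nonlinearity_eq_inner]
  exact ((continuous_slopeLp.comp_aestronglyMeasurable (aestronglyMeasurable_grad hL hw h)).inner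
    aestronglyMeasurable_const).neg

lemma IsMildSolution.aestronglyMeasurable_nonlinearityPath {β : Mode → ℝ≥0 → Ω → ℝ} {L T σ : ℝ}
    (hL : 0 < L) {a : Mode → ℝ} {u₀ : L2 L} {u : ℝ → Ω → L2 L}
    (hu : IsMildSolution L T σ P β a u₀ u) (k : Mode) (t : Icc (0 : ℝ) T) :
    AEStronglyMeasurable (fun ω => nonlinearityPath L T (fun s => u s ω) k t) P := by
  refine (aestronglyMeasurable_nonlinearity hL (hu.measurable t t.2)
    (hu.continuous.mono fun ω h => h.1 t t.2) k).congr ?_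
  filter_upwards [hu.continuous] with ω h
  exact (nonlinearityPath_apply hL h k t).symm

lemma IsMildSolution.aestronglyMeasurable_driftPath [IsProbabilityMeasure P]
    {β : Mode → ℝ≥0 → Ω → ℝ} {L T σ : ℝ} (hL : 0 < L) (hT : 0 < T) {a : Mode → ℝ} {u₀ : L2 L}
    {u : ℝ → Ω → L2 L} (hu : IsMildSolution L T σ P β a u₀ u) (k : Mode) :
    AEStronglyMeasurable (fun ω => driftPath hT L (fun s => u s ω) k) P := by
  refine aestronglyMeasurable_continuousMap fun t => ?_
  have h := eLpNorm_intervalIntegral_le (P := P) (Y := fun s ω => Real.exp (-(t - s) * eigenvalue L k ^ 2) *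
    nonlinearityPath L T (fun s => u s ω) k (projIcc 0 T hT.le s)) t.2.1 (p := 1) le_rfl
    (Eventually.of_forall fun ω => ?_) (fun s _ => ?_) (w := fun _ => L / 2 * √(eigenvalue L k))
    continuousOn_const (fun _ _ => by positivity) (fun s hs => ?_)
  · exact h.1.neg
  · refine Continuous.continuousOn (Continuous.mul (by fun_prop) ?_)
    exact (ContinuousMap.continuous _).comp continuous_projIcc
  · exact (hu.aestronglyMeasurable_nonlinearityPath hL k _).const_mul _
  · refine (eLpNorm_le_of_ae_bound (C := L / 2 * √(eigenvalue L k)) (Eventually.of_forall fun ω => ?_)).trans ?_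
    · rw [norm_mul, Real.norm_of_nonneg (Real.exp_pos _).le]
      refine (mul_le_of_le_one_left (norm_nonneg _) (exp_neg_sub_mul_le_one (sq_nonneg _) hs.2)).trans ?_
      exact ((nonlinearityPath L T _ k).norm_coe_le_norm _).trans (norm_nonlinearityPath_le hL _ k)
    · simp

/-- A bound for the contributions of the initial value and of the drift to the mode `k`. -/
def regularBound (L : ℝ) (u₀ : L2 L) (k : Mode) : ℝ :=
  |coeffs L u₀ k| + L / 2 * (√(eigenvalue L k) / eigenvalue L k ^ 2)

/-- The initial value is in `H¹`, and the drift coefficients of order `|k|^{-3}` become `|k|^{-4}`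
after squaring and weighting by `μ_k`. The bound depends neither on the regularization nor on
chance. -/
lemma summable_regularBound {L : ℝ} (hL : 0 < L) {u₀ : L2 L} (hu₀ : MemH L 1 u₀) :
    Summable fun k => eigenvalue L k * regularBound L u₀ k ^ 2 := by
  have h1 := hu₀.summable_one.mul_left 2
  have h2 : Summable fun k => 2 * (L / 2) ^ 2 * (1 / (2 * Real.pi / L) ^ 4 * (1 / modeNorm k ^ 4)) :=
    ((summable_modeNorm_inv_pow (by norm_num)).mul_left _).mul_left _
  refine Summable.of_nonneg_of_le (fun k => mul_nonneg (eigenvalue_pos hL k).le (sq_nonneg _))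
    (fun k => ?_) (h1.add h2)
  have hk := eigenvalue_pos hL k
  have hN := one_le_modeNorm k
  have e : eigenvalue L k * (√(eigenvalue L k) / eigenvalue L k ^ 2) ^ 2 =
      1 / (2 * Real.pi / L) ^ 4 * (1 / modeNorm k ^ 4) := by
    have e1 : 1 / (2 * Real.pi / L) ^ 4 * (1 / modeNorm k ^ 4) = 1 / eigenvalue L k ^ 2 := by
      rw [eigenvalue_eq, mul_pow, ← pow_mul, ← pow_mul, one_div_mul_one_div]
    rw [e1, div_pow, Real.sq_sqrt hk.le]
    field_simp
  rw [← e, regularBound]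
  have h3 : (|coeffs L u₀ k| + L / 2 * (√(eigenvalue L k) / eigenvalue L k ^ 2)) ^ 2 ≤
      2 * coeffs L u₀ k ^ 2 + 2 * (L / 2 * (√(eigenvalue L k) / eigenvalue L k ^ 2)) ^ 2 := by
    rw [← sq_abs (coeffs L u₀ k)]
    nlinarith [sq_nonneg (|coeffs L u₀ k| - L / 2 * (√(eigenvalue L k) / eigenvalue L k ^ 2))]
  refine (mul_le_mul_of_nonneg_left h3 hk.le).trans (le_of_eq (by ring))

lemma abs_regular_le {L T : ℝ} (hL : 0 < L) (hT : 0 < T) (u₀ : L2 L) (w : ℝ → L2 L) (k : Mode)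
    (t : Icc (0 : ℝ) T) :
    |semigroup L t (coeffs L u₀) k + driftPath hT L w k t| ≤ regularBound L u₀ k :=
  (abs_add_le _ _).trans (add_le_add (abs_semigroup_le t.2.1 _ k)
    (((driftPath hT L w k).norm_coe_le_norm t).trans (norm_driftPath_le hL hT w k)))

lemma lintegral_modeProcess_sq_le [IsProbabilityMeasure P] {β : Mode → ℝ≥0 → Ω → ℝ}
    (hβ : IsCylindricalWiener P β) {L : ℝ} (hL : 0 < L) {t : ℝ} (ht : 0 ≤ t) (k : Mode) :
    ∫⁻ ω, ENNReal.ofReal (modeProcess L β k t ω ^ 2) ∂P ≤ ENNReal.ofReal (1 / eigenvalue L k ^ 2) := by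
  have hk := eigenvalue_pos hL k
  have h := eLpNorm_modeProcess_le hβ hL ht k
  rw [← eigenvalue_eq] at h
  have h2 := eLpNorm_nnreal_pow_eq_lintegral (μ := P) (f := modeProcess L β k t) (p := 2) (by norm_num)
  have e : ∀ x : ℝ, ENNReal.ofReal (x ^ 2) = ‖x‖ₑ ^ (2 : ℝ) := fun x => by
    rw [Real.enorm_eq_ofReal_abs, ← sq_abs, ENNReal.ofReal_pow (abs_nonneg _)]
    exact (ENNReal.rpow_natCast _ 2).symm
  simp only [e]
  rw [show (1 / eigenvalue L k ^ 2) = (1 / eigenvalue L k) ^ 2 by rw [one_div_pow],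
    ENNReal.ofReal_pow (by positivity)]
  have h3 := pow_le_pow_left' h 2
  refine le_trans (le_of_eq ?_) h3
  rw [← ENNReal.rpow_natCast]
  exact h2.symm

end

/-! ### Averaging of the nonlinearity -/

section

variable {Ω : Type*} [MeasurableSpace Ω] {P : Measure Ω}

/-- The finite-dimensional approximation of the gradient of the stochastic convolution. -/
def roughGrad (L : ℝ) (β : Mode → ℝ≥0 → Ω → ℝ) (c : Mode → ℝ) (F : Finset Mode) (t : ℝ) (ω : Ω) :
    Lp Plane 2 (squareMeasure L) := ∑ k ∈ F, (c k * modeProcess L β k t ω) • gradL2 L k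

lemma aestronglyMeasurable_roughGrad {β : Mode → ℝ≥0 → Ω → ℝ} (hβ : IsCylindricalWiener P β)
    (L : ℝ) (c : Mode → ℝ) (F : Finset Mode) {t : ℝ} (ht : 0 ≤ t) :
    AEStronglyMeasurable (roughGrad L β c F t) P :=
  Finset.aestronglyMeasurable_fun_sum _ fun k _ =>
    ((aestronglyMeasurable_modeProcess hβ L ht k).const_mul _).smul_const _

omit [MeasurableSpace Ω] in
lemma coeFn_roughGrad (L : ℝ) (β : Mode → ℝ≥0 → Ω → ℝ) (c : Mode → ℝ) (F : Finset Mode) (t : ℝ)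
    (ω : Ω) : ∀ᵐ x ∂squareMeasure L, (roughGrad L β c F t ω) x 0 =
      ∑ k ∈ F, (c k * (∇ (basis L k.1) x) 0) * modeProcess L β k t ω := by
  have h1 : ∀ᵐ x ∂squareMeasure L, ∀ k, ((c k * modeProcess L β k t ω) • gradL2 L k :
      Lp Plane 2 (squareMeasure L)) x = (c k * modeProcess L β k t ω) • ∇ (basis L k.1) x := by
    refine ae_all_iff.2 fun k => ?_
    filter_upwards [Lp.coeFn_smul (c k * modeProcess L β k t ω) (gradL2 L k), coeFn_gradL2 L k]
      with x h2 h3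
    rw [h2, Pi.smul_apply, h3]
  filter_upwards [h1, Lp.coeFn_fun_finsetSum F
    (fun k => (c k * modeProcess L β k t ω) • gradL2 L k)] with x hx hs
  rw [roughGrad, hs]
  simp only [hx]
  rw [WithLp.ofLp_sum, Finset.sum_apply]
  refine Finset.sum_congr rfl fun k _ => ?_
  rw [PiLp.smul_apply, smul_eq_mul]
  ring

-- Orthogonality of the `∇e_k` reduces this to coefficients: on `F` the noise cancels and leaves
-- `b`, off `F` one uses `(x + y)² ≤ 2x² + 2y²`. Extended nonnegative reals allow the tail to be
-- infinite.
omit [MeasurableSpace Ω] in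
lemma norm_grad_sub_roughGrad_le {L : ℝ} (hL : 0 < L) {β : Mode → ℝ≥0 → Ω → ℝ} {c b B : Mode → ℝ}
    {F : Finset Mode} {t : ℝ} {ω : Ω} {v : L2 L} (hv : MemH L 1 v)
    (hvb : ∀ k, coeffs L v k = b k + c k * modeProcess L β k t ω) (hb : ∀ k, |b k| ≤ B k)
    (hB : Summable fun k => eigenvalue L k * B k ^ 2) :
    ENNReal.ofReal (‖grad L v - roughGrad L β c F t ω‖ ^ 2) ≤
      ENNReal.ofReal (2 * ∑' k, eigenvalue L k * B k ^ 2) +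
      ∑' k : {k // k ∉ F}, ENNReal.ofReal (2 * eigenvalue L k * c k ^ 2) *
        ENNReal.ofReal (modeProcess L β k t ω ^ 2) := by
  classical
  set d : Mode → ℝ := fun k => if k ∈ F then c k * modeProcess L β k t ω else 0 with hd
  have hd0 : ∀ k ∉ F, d k = 0 := fun k hk => if_neg hk
  have hds : Summable fun k => eigenvalue L k * d k ^ 2 :=
    summable_of_ne_finset_zero (s := F) fun k hk => by rw [hd0 k hk]; ring
  have hr : roughGrad L β c F t ω = ∑' k, d k • gradL2 L k := by
    rw [tsum_eq_sum (s := F) fun k hk => by rw [hd0 k hk, zero_smul]]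
    exact Finset.sum_congr rfl fun k hk => by rw [hd]; simp only [if_pos hk]
  rw [hr, norm_grad_sub_tsum hL hv hds]
  have hμ := fun k => (eigenvalue_pos hL k).le
  have hle : ENNReal.ofReal (∑' k, eigenvalue L k * (coeffs L v k - d k) ^ 2) ≤
      ∑' k, ENNReal.ofReal (eigenvalue L k * (coeffs L v k - d k) ^ 2) := by
    by_cases hs : Summable fun k => eigenvalue L k * (coeffs L v k - d k) ^ 2
    · exact (ENNReal.ofReal_tsum_of_nonneg (fun k => mul_nonneg (hμ k) (sq_nonneg _)) hs).le
    · rw [tsum_eq_zero_of_not_summable hs]; simp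
  refine hle.trans ?_
  have e1 : ENNReal.ofReal (2 * ∑' k, eigenvalue L k * B k ^ 2) =
      ∑' k, ENNReal.ofReal (2 * (eigenvalue L k * B k ^ 2)) := by
    rw [← tsum_mul_left, ENNReal.ofReal_tsum_of_nonneg _ (hB.mul_left 2)]
    exact fun k => mul_nonneg zero_le_two (mul_nonneg (hμ k) (sq_nonneg _))
  have e2 : ∑' k : {k // k ∉ F}, ENNReal.ofReal (2 * eigenvalue L k * c k ^ 2) *
        ENNReal.ofReal (modeProcess L β k t ω ^ 2) =
      ∑' k, {k | k ∉ F}.indicator (fun k => ENNReal.ofReal (2 * eigenvalue L k * c k ^ 2) *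
        ENNReal.ofReal (modeProcess L β k t ω ^ 2)) k :=
    tsum_subtype {k | k ∉ F} (fun k => ENNReal.ofReal (2 * eigenvalue L k * c k ^ 2) *
        ENNReal.ofReal (modeProcess L β k t ω ^ 2))
  rw [e1, e2, ← ENNReal.tsum_add]
  refine ENNReal.tsum_le_tsum fun k => ?_
  have hbk : b k ^ 2 ≤ B k ^ 2 := by
    rw [← sq_abs]; exact pow_le_pow_left₀ (abs_nonneg _) (hb k) 2
  by_cases hk : k ∈ F
  · rw [indicator_of_notMem (by simpa using hk), add_zero]
    refine ENNReal.ofReal_le_ofReal ?_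
    have : coeffs L v k - d k = b k := by rw [hvb k]; simp only [hd, if_pos hk]; ring
    rw [this]
    nlinarith [hμ k, mul_le_mul_of_nonneg_left hbk (hμ k), mul_nonneg (hμ k) (sq_nonneg (B k))]
  · rw [indicator_of_mem (by simpa using hk),
      ← ENNReal.ofReal_mul (by have := hμ k; positivity), ← ENNReal.ofReal_add
        (mul_nonneg zero_le_two (mul_nonneg (hμ k) (sq_nonneg _))) (by have := hμ k; positivity)]
    refine ENNReal.ofReal_le_ofReal ?_
    rw [hd0 k hk, sub_zero, hvb k]
    set X := modeProcess L β k t ω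
    have h1 : (b k + c k * X) ^ 2 ≤ 2 * B k ^ 2 + 2 * (c k ^ 2 * X ^ 2) := by
      nlinarith [sq_nonneg (b k - c k * X)]
    refine (mul_le_mul_of_nonneg_left h1 (hμ k)).trans (le_of_eq (by ring))

/-- The variance of a mode is at most `1 / μ_k²`, so the noise outside `F` contributes at most twice
the sum in `hF`. The resulting bound depends neither on `F` nor on the coefficients `a`. -/
lemma lintegral_norm_grad_sub_le [IsProbabilityMeasure P] {β : Mode → ℝ≥0 → Ω → ℝ}
    (hβ : IsCylindricalWiener P β) {L T σ : ℝ} (hL : 0 < L) (hT : 0 < T) {a : Mode → ℝ} {u₀ : L2 L}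
    (hu₀ : MemH L 1 u₀) {u : ℝ → Ω → L2 L} (hu : IsMildSolution L T σ P β a u₀ u)
    (F : Finset Mode)
    (hF : ∑' k : {k // k ∉ F}, ENNReal.ofReal ((σ * a k) ^ 2 / eigenvalue L k) ≤ 1)
    (t : Icc (0 : ℝ) T) :
    ∫⁻ ω, ENNReal.ofReal
      (‖grad L (u t ω) - roughGrad L β (fun k => σ * a k) F t ω‖ ^ 2) ∂P ≤
      ENNReal.ofReal (2 * (∑' k, eigenvalue L k * regularBound L u₀ k ^ 2) + 2) := by
  have hS : 0 ≤ ∑' k, eigenvalue L k * regularBound L u₀ k ^ 2 :=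
    tsum_nonneg fun k => mul_nonneg (eigenvalue_pos hL k).le (sq_nonneg _)
  have h1 : ∀ᵐ ω ∂P, ENNReal.ofReal
      (‖grad L (u t ω) - roughGrad L β (fun k => σ * a k) F t ω‖ ^ 2) ≤
      ENNReal.ofReal (2 * ∑' k, eigenvalue L k * regularBound L u₀ k ^ 2) +
      ∑' k : {k // k ∉ F}, ENNReal.ofReal (2 * eigenvalue L k * (σ * a k) ^ 2) *
        ENNReal.ofReal (modeProcess L β k t ω ^ 2) := by
    filter_upwards [hu.coeffs_eq hβ hL hT, hu.continuous] with ω e hc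
    refine norm_grad_sub_roughGrad_le hL (hc.1 t t.2) (b := fun k => semigroup L t (coeffs L u₀) k +
      driftPath hT L (fun s => u s ω) k t) (fun k => ?_) (fun k => abs_regular_le hL hT u₀ _ k t)
      (summable_regularBound hL hu₀)
    rw [e t k]; ring
  have hm : ∀ k, AEMeasurable (fun ω => ENNReal.ofReal (modeProcess L β k t ω ^ 2)) P := fun k =>
    ((aestronglyMeasurable_modeProcess hβ L t.2.1 k).aemeasurable.pow_const 2).ennreal_ofReal
  refine (lintegral_mono_ae h1).trans ?_
  rw [lintegral_add_left measurable_const, lintegral_const, measure_univ, mul_one,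
    lintegral_tsum fun k : {k // k ∉ F} => (hm k).const_mul _, ENNReal.ofReal_add (by positivity) zero_le_two]
  refine add_le_add le_rfl ?_
  calc ∑' k : {k // k ∉ F}, ∫⁻ ω, ENNReal.ofReal (2 * eigenvalue L k * (σ * a k) ^ 2) *
        ENNReal.ofReal (modeProcess L β k t ω ^ 2) ∂P
      ≤ ∑' k : {k // k ∉ F}, 2 * ENNReal.ofReal ((σ * a k) ^ 2 / eigenvalue L k) := by
        refine ENNReal.tsum_le_tsum fun k => ?_
        have hk := eigenvalue_pos hL k
        rw [lintegral_const_mul' _ _ ENNReal.ofReal_ne_top]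
        refine (mul_le_mul_right (lintegral_modeProcess_sq_le hβ hL t.2.1 k) _).trans ?_
        rw [← ENNReal.ofReal_mul (by positivity), ← ENNReal.ofReal_ofNat, ← ENNReal.ofReal_mul (by norm_num)]
        refine ENNReal.ofReal_le_ofReal (le_of_eq ?_)
        field_simp
    _ ≤ 2 * 1 := by rw [ENNReal.tsum_mul_left]; exact mul_le_mul_right hF _
    _ = ENNReal.ofReal 2 := by simp

lemma eLpNorm_const_mul_modeProcess [IsProbabilityMeasure P] {β : Mode → ℝ≥0 → Ω → ℝ}
    (hβ : IsCylindricalWiener P β) {L : ℝ} (hL : 0 < L) {t : ℝ} (ht : 0 ≤ t) (k : Mode) (c : ℝ) :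
    ((eLpNorm (fun ω => c * modeProcess L β k t ω + 0 * modeProcess L β k t ω) 2 P).toNNReal ^ 2 : ℝ) =
      c ^ 2 * ((1 - Real.exp (-(2 * eigenvalue L k ^ 2 * t))) / (2 * eigenvalue L k ^ 2)) := by
  have hk := eigenvalue_pos hL k
  have e : (fun ω => c * modeProcess L β k t ω + 0 * modeProcess L β k t ω) =
      c • modeProcess L β k t := by
    ext ω; simp
  have h := eLpNorm_ouProcess (hβ.brownian k) (lam := eigenvalue L k ^ 2) (by positivity) ht
  have h0 : 0 ≤ (1 - Real.exp (-(2 * eigenvalue L k ^ 2 * t))) / (2 * eigenvalue L k ^ 2) := by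
    refine div_nonneg (sub_nonneg.2 (Real.exp_le_one_iff.2 ?_)) (by positivity)
    have : 0 ≤ 2 * eigenvalue L k ^ 2 * t := by positivity
    linarith
  have h' : eLpNorm (modeProcess L β k t) 2 P = _ := h
  rw [e, eLpNorm_const_smul, h', Real.enorm_eq_ofReal_abs, ← ENNReal.ofReal_mul (abs_nonneg _),
    ENNReal.coe_toNNReal_eq_toReal, ENNReal.toReal_ofReal (by positivity), mul_pow, sq_abs,
    Real.sq_sqrt h0]

/-- The nonlinearity is small in mean if the gradient has a rough Gaussian part. -/
lemma lintegral_nonlinearity_le [IsProbabilityMeasure P] {β : Mode → ℝ≥0 → Ω → ℝ}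
    (hβ : IsCylindricalWiener P β) {L T σ : ℝ} (hL : 0 < L) (hT : 0 < T) {a : Mode → ℝ} {u₀ : L2 L}
    (hu₀ : MemH L 1 u₀) {u : ℝ → Ω → L2 L} (hu : IsMildSolution L T σ P β a u₀ u)
    (F : Finset Mode)
    (hF : ∑' k : {k // k ∉ F}, ENNReal.ofReal ((σ * a k) ^ 2 / eigenvalue L k) ≤ 1)
    (t : Icc (0 : ℝ) T) {M V : ℝ} (hM : 0 < M) (hV : 0 < V)
    (hFV : ∀ x : Plane, V ≤ ∑ k ∈ F, (σ * a k * (∇ (basis L k.1) x) 0) ^ 2 *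
      ((1 - Real.exp (-(2 * eigenvalue L k ^ 2 * t))) / (2 * eigenvalue L k ^ 2))) (k : Mode) :
    ∫⁻ ω, ‖nonlinearity L (u t ω) k‖ₑ ∂P ≤ ENNReal.ofReal (2 / L * √(eigenvalue L k) *
      ((2 * L ^ 2 + (2 * (∑' k, eigenvalue L k * regularBound L u₀ k ^ 2) + 2)) / M +
        4 * (M / √V * L ^ 2))) := by
  have hS : 0 ≤ ∑' k, eigenvalue L k * regularBound L u₀ k ^ 2 :=
    tsum_nonneg fun k => mul_nonneg (eigenvalue_pos hL k).le (sq_nonneg _)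
  set S := ∑' k, eigenvalue L k * regularBound L u₀ k ^ 2 with hSd
  set g : Ω → Lp Plane 2 (squareMeasure L) := roughGrad L β (fun k => σ * a k) F t with hg
  set G : Plane → Ω → ℝ := fun x ω =>
    ∑ k ∈ F, (σ * a k * (∇ (basis L k.1) x) 0) * modeProcess L β k t ω with hG
  have hgc : ∀ k : Mode, Continuous fun x : Plane => σ * a k * (∇ (basis L k.1) x) 0 := fun k => by
    have := continuous_gradient_basis L k.1
    fun_prop
  have hGc : ∀ ω, Continuous fun x => G x ω := fun ω => by
    refine continuous_finsetSum _ fun k _ => (hgc k).mul continuous_const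
  have h1 : ∀ ω, ‖nonlinearity L (u t ω) k‖ₑ ≤ ENNReal.ofReal (2 / L * √(eigenvalue L k)) *
      (ENNReal.ofReal (1 / M) * (ENNReal.ofReal (2 * L ^ 2) +
        ENNReal.ofReal (‖grad L (u t ω) - g ω‖ ^ 2)) +
      ENNReal.ofReal 4 * ENNReal.ofReal (∫ x, Real.exp (-(G x ω ^ 2 / (2 * M ^ 2))) ∂squareMeasure L)) := by
    intro ω
    have hE : 0 ≤ ∫ x, Real.exp (-(G x ω ^ 2 / (2 * M ^ 2))) ∂squareMeasure L :=
      integral_nonneg fun x => (Real.exp_pos _).le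
    rw [← ENNReal.ofReal_add (by positivity) (by positivity), ← ENNReal.ofReal_mul (by positivity),
      ← ENNReal.ofReal_mul (by norm_num), ← ENNReal.ofReal_add (by positivity) (by positivity), ← ENNReal.ofReal_mul (by positivity),
      Real.enorm_eq_ofReal_abs]
    refine ENNReal.ofReal_le_ofReal ?_
    refine (abs_nonlinearity_le_integral hL (u t ω) k).trans ?_
    refine mul_le_mul_of_nonneg_left ?_ (by positivity)
    refine (integral_norm_slope_le hL hM (grad L (u t ω)) (g ω) (hGc ω)
      (coeFn_roughGrad L β _ F t ω)).trans (le_of_eq (by ring))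
  have hgm : AEMeasurable (fun ω => ENNReal.ofReal (‖grad L (u t ω) - g ω‖ ^ 2)) P :=
    (((aestronglyMeasurable_grad hL (hu.measurable t t.2) (hu.continuous.mono fun ω h => h.1 t t.2)).sub
      (aestronglyMeasurable_roughGrad hβ L _ F t.2.1)).norm.aemeasurable.pow_const 2).ennreal_ofReal
  -- At a fixed point the sum over `F` is centered Gaussian with variance at least `V`; only its
  -- marginal law enters, not its dependence on the remainder of the gradient.
  have hexp : ∫⁻ ω, ENNReal.ofReal (∫ x, Real.exp (-(G x ω ^ 2 / (2 * M ^ 2))) ∂squareMeasure L) ∂P ≤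
      ENNReal.ofReal (M / √V * L ^ 2) := by
    refine lintegral_integral_exp_le hL F hgc
      (fun k => aestronglyMeasurable_modeProcess hβ L t.2.1 k) fun x => ?_
    have hlaw := hasLaw_sum_modeProcess hβ L t.2.1 t.2.1
      (fun k => σ * a k * (∇ (basis L k.1) x) 0) (fun _ => 0) F
    set v : ℝ≥0 := ∑ k ∈ F, (eLpNorm (fun ω => (σ * a k * (∇ (basis L k.1) x) 0) *
      modeProcess L β k t ω + 0 * modeProcess L β k t ω) 2 P).toNNReal ^ 2 with hv
    have hvV : V ≤ v := by
      rw [hv, NNReal.coe_sum]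
      refine (hFV x).trans (Finset.sum_le_sum fun k _ => ?_)
      rw [NNReal.coe_pow, eLpNorm_const_mul_modeProcess hβ hL t.2.1]
    have hv0 : v ≠ 0 := by
      rintro h
      rw [h, NNReal.coe_zero] at hvV
      linarith
    have e : ∀ ω, ∑ k ∈ F, (σ * a k * (∇ (basis L k.1) x) 0 * modeProcess L β k t ω +
        0 * modeProcess L β k t ω) = G x ω := fun ω => by simp [hG]
    simp only [e] at hlaw
    refine (lintegral_exp_neg_sq_le hv0 hlaw hM).trans (ENNReal.ofReal_le_ofReal ?_)
    exact div_le_div_of_nonneg_left hM.le (Real.sqrt_pos.2 hV) (Real.sqrt_le_sqrt hvV)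
  refine (lintegral_mono h1).trans ?_
  rw [lintegral_const_mul' _ _ ENNReal.ofReal_ne_top,
    lintegral_add_left' (AEMeasurable.const_mul (AEMeasurable.fun_add aemeasurable_const hgm) _),
    lintegral_const_mul' _ _ ENNReal.ofReal_ne_top, lintegral_add_left measurable_const,
    lintegral_const, measure_univ, mul_one, lintegral_const_mul' _ _ ENNReal.ofReal_ne_top]
  have hgr := lintegral_norm_grad_sub_le hβ hL hT hu₀ hu F hF t
  rw [← hSd] at hgr
  calc _ ≤ ENNReal.ofReal (2 / L * √(eigenvalue L k)) *
      (ENNReal.ofReal (1 / M) * (ENNReal.ofReal (2 * L ^ 2) + ENNReal.ofReal (2 * S + 2)) +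
        ENNReal.ofReal 4 * ENNReal.ofReal (M / √V * L ^ 2)) := by gcongr
    _ = _ := by
      rw [← ENNReal.ofReal_add (by positivity) (by positivity), ← ENNReal.ofReal_mul (by positivity),
        ← ENNReal.ofReal_mul (by norm_num), ← ENNReal.ofReal_add (by positivity) (by positivity), ← ENNReal.ofReal_mul (by positivity)]
      congr 1
      ring

end

/-! ### Convergence -/

section

variable {Ω : Type*} [MeasurableSpace Ω] {P : Measure Ω}

/-- The noise vanishes at time zero, so on the initial layer `[0, s₀]` only the deterministic bound
is available; the averaging estimate is used afterwards. -/
lemma lintegral_driftPath_le [IsProbabilityMeasure P] {β : Mode → ℝ≥0 → Ω → ℝ} {L T σ : ℝ}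
    (hL : 0 < L) (hT : 0 < T) {a : Mode → ℝ} {u₀ : L2 L} {u : ℝ → Ω → L2 L}
    (hu : IsMildSolution L T σ P β a u₀ u) (k : Mode) {s₀ b : ℝ} (hs₀ : 0 ≤ s₀) (hs₀T : s₀ ≤ T)
    (hb : 0 ≤ b)
    (h : ∀ t : Icc (0 : ℝ) T, s₀ ≤ t → ∫⁻ ω, ‖nonlinearity L (u t ω) k‖ₑ ∂P ≤ ENNReal.ofReal b) :
    ∫⁻ ω, ‖driftPath hT L (fun s => u s ω) k‖ₑ ∂P ≤
      ENNReal.ofReal (s₀ * (L / 2 * √(eigenvalue L k)) + (T - s₀) * b) := by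
  set Y : ℝ → Ω → ℝ := fun s ω => |nonlinearityPath L T (fun s => u s ω) k (projIcc 0 T hT.le s)| with hY
  have hYc : ∀ ω, Continuous fun s => Y s ω := fun ω =>
    ((ContinuousMap.continuous _).comp continuous_projIcc).abs
  have hYm : ∀ s, AEStronglyMeasurable (Y s) P := fun s =>
    (hu.aestronglyMeasurable_nonlinearityPath hL k _).norm
  have hY0 : ∀ s ω, 0 ≤ Y s ω := fun s ω => abs_nonneg _
  have h1 := eLpNorm_intervalIntegral_le hs₀ (p := 1) le_rfl
    (Eventually.of_forall fun ω => (hYc ω).continuousOn) (fun s _ => hYm s)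
    (w := fun _ => L / 2 * √(eigenvalue L k)) continuousOn_const (fun _ _ => by positivity) (by
      intro s _
      refine (eLpNorm_le_of_ae_bound (C := L / 2 * √(eigenvalue L k)) (Eventually.of_forall fun ω => ?_)).trans ?_
      · rw [Real.norm_of_nonneg (hY0 s ω)]
        exact ((nonlinearityPath L T _ k).norm_coe_le_norm _).trans (norm_nonlinearityPath_le hL _ k)
      · simp)
  have h2 := eLpNorm_intervalIntegral_le hs₀T (p := 1) le_rfl
    (Eventually.of_forall fun ω => (hYc ω).continuousOn) (fun s _ => hYm s)
    (w := fun _ => b) continuousOn_const (fun _ _ => hb) (by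
      intro s hs
      have hs' : s ∈ Icc 0 T := ⟨hs₀.trans hs.1, hs.2⟩
      rw [eLpNorm_one_eq_lintegral_enorm]
      refine le_trans (le_of_eq (lintegral_congr_ae ?_)) (h ⟨s, hs'⟩ hs.1)
      filter_upwards [hu.continuous] with ω hω
      simp only [hY, projIcc_of_mem hT.le hs', nonlinearityPath_apply hL hω]
      exact enorm_norm (nonlinearity L (u s ω) k))
  have h3 : ∀ ω, ‖driftPath hT L (fun s => u s ω) k‖ₑ ≤
      ‖∫ s in (0 : ℝ)..s₀, Y s ω‖ₑ + ‖∫ s in s₀..T, Y s ω‖ₑ := by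
    intro ω
    refine le_trans ?_ (enorm_add_le _ _)
    rw [intervalIntegral.integral_add_adjacent_intervals ((hYc ω).intervalIntegrable _ _)
      ((hYc ω).intervalIntegrable _ _), ← ofReal_norm, ← ofReal_norm]
    refine ENNReal.ofReal_le_ofReal ?_
    rw [driftPath, norm_neg]
    exact (norm_convPath_le_integral hT (sq_nonneg _) _).trans (Real.le_norm_self _)
  refine (lintegral_mono h3).trans ?_
  rw [lintegral_add_left' h1.1.enorm, ← eLpNorm_one_eq_lintegral_enorm,
    ← eLpNorm_one_eq_lintegral_enorm]
  refine (add_le_add h1.2 h2.2).trans (le_of_eq ?_)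
  rw [intervalIntegral.integral_const, intervalIntegral.integral_const, sub_zero, smul_eq_mul,
    smul_eq_mul, ENNReal.ofReal_add (by positivity) (mul_nonneg (by linarith) hb)]

/-- The decay makes the weighted sum finite for each fixed `ε`, so its tail can be made small. The
set depends on `ε`, which is harmless because enlarging `F₁` only increases the variance. -/
lemma IsRegularization.exists_finset {α : ℝ → Mode → ℝ} (hα : IsRegularization α) {L σ : ℝ}
    (hL : 0 < L) {ε : ℝ} (hε : 0 < ε) (F₁ : Finset Mode) :
    ∃ F : Finset Mode, F₁ ⊆ F ∧
      ∑' k : {k // k ∉ F}, ENNReal.ofReal ((σ * α ε k) ^ 2 / eigenvalue L k) ≤ 1 := by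
  obtain ⟨δ, hδ, C, hC⟩ := hα.decay ε hε
  have hs : Summable fun k => (σ * α ε k) ^ 2 / eigenvalue L k := by
    refine ((summable_sq_div_eigenvalue hL hδ hC).mul_left (σ ^ 2)).congr fun k => ?_
    rw [mul_pow, mul_div_assoc]
  have hfin : ∑' k, ENNReal.ofReal ((σ * α ε k) ^ 2 / eigenvalue L k) ≠ ∞ := by
    rw [← ENNReal.ofReal_tsum_of_nonneg
      (fun k => div_nonneg (sq_nonneg _) (eigenvalue_pos hL k).le) hs]
    exact ENNReal.ofReal_ne_top
  have h := ENNReal.tendsto_tsum_compl_atTop_zero hfin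
  obtain ⟨F, h1, h2⟩ := ((h.eventually (Iic_mem_nhds zero_lt_one)).and
    (eventually_ge_atTop F₁)).exists
  exact ⟨F, h2, h1⟩

/-- Modes outside `F₁` are dropped. The factor `8` is `4` from `|a k| ≥ 1 / 2` times `2` from the
stationary variance; the exponential is worst at the earliest time `s₀` and the lower bound
`(2π/L)²` for the eigenvalues. -/
lemma variance_lower_bound {L σ Λ s₀ s : ℝ} (hL : 0 < L) (hs₀ : 0 < s₀) (hs : s₀ ≤ s)
    {a : Mode → ℝ} {F₁ F : Finset Mode} (hF : F₁ ⊆ F) (ha : ∀ k ∈ F₁, 1 / 2 ≤ |a k|) (x : Plane)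
    (hΛ : Λ ≤ ∑ k ∈ F₁, (∇ (basis L k.1) x) 0 ^ 2 / eigenvalue L k ^ 2) :
    σ ^ 2 * (1 - Real.exp (-(2 * ((2 * Real.pi / L) ^ 2) ^ 2 * s₀))) / 8 * Λ ≤
      ∑ k ∈ F, (σ * a k * (∇ (basis L k.1) x) 0) ^ 2 *
      ((1 - Real.exp (-(2 * eigenvalue L k ^ 2 * s))) / (2 * eigenvalue L k ^ 2)) := by
  have hexp : ∀ y : ℝ, 0 ≤ y → 0 ≤ 1 - Real.exp (-y) := fun y hy =>
    sub_nonneg.2 (Real.exp_le_one_iff.2 (by linarith))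
  have hs0 : 0 ≤ s := hs₀.le.trans hs
  have he := hexp (2 * ((2 * Real.pi / L) ^ 2) ^ 2 * s₀) (by positivity)
  set E := 1 - Real.exp (-(2 * ((2 * Real.pi / L) ^ 2) ^ 2 * s₀)) with hE
  refine (mul_le_mul_of_nonneg_left hΛ (by positivity)).trans ?_
  rw [Finset.mul_sum]
  refine (Finset.sum_le_sum fun k hk => ?_).trans (Finset.sum_le_sum_of_subset_of_nonneg hF
    fun k _ _ => mul_nonneg (sq_nonneg _) (div_nonneg (hexp _ (by positivity)) (by positivity)))
  have hμ := eigenvalue_pos hL k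
  have h1 : E ≤ 1 - Real.exp (-(2 * eigenvalue L k ^ 2 * s)) := by
    refine sub_le_sub_left (Real.exp_le_exp.2 (neg_le_neg ?_)) 1
    have : (2 * Real.pi / L) ^ 2 ≤ eigenvalue L k := by
      rw [eigenvalue_eq]
      exact le_mul_of_one_le_right (by positivity) (one_le_pow₀ (one_le_modeNorm k))
    gcongr
  have h2 : 1 / 4 ≤ a k ^ 2 := by
    rw [← sq_abs]; nlinarith [ha k hk]
  set d := (∇ (basis L k.1) x) 0
  calc σ ^ 2 * E / 8 * (d ^ 2 / eigenvalue L k ^ 2)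
      = (σ ^ 2 * (1 / 4) * d ^ 2) * (E / (2 * eigenvalue L k ^ 2)) := by field_simp; ring
    _ ≤ (σ ^ 2 * a k ^ 2 * d ^ 2) *
        ((1 - Real.exp (-(2 * eigenvalue L k ^ 2 * s))) / (2 * eigenvalue L k ^ 2)) := by gcongr
    _ = _ := by ring

/-- The drift vanishes in the limit, mode by mode. -/
lemma tendsto_lintegral_driftPath [IsProbabilityMeasure P] {β : Mode → ℝ≥0 → Ω → ℝ}
    (hβ : IsCylindricalWiener P β) {L T σ : ℝ} (hL : 0 < L) (hT : 0 < T) (hσ : 0 < σ) {u₀ : L2 L}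
    (hu₀ : MemH L 1 u₀) {α : ℝ → Mode → ℝ} (hα : IsRegularization α) {v : ℝ → ℝ → Ω → L2 L}
    (hv : ∀ ε > 0, IsMildSolution L T σ P β (α ε) u₀ (v ε)) (k : Mode) :
    Tendsto (fun ε => ∫⁻ ω, ‖driftPath hT L (fun s => v ε s ω) k‖ₑ ∂P) (𝓝[>] 0) (𝓝 0) := by
  rw [ENNReal.tendsto_nhds_zero]
  intro η hη
  obtain ⟨r, hr0, hr⟩ := ENNReal.lt_iff_exists_nnreal_btwn.1 hη
  have hr0' : (0 : ℝ) < r := by exact_mod_cast hr0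
  have hk := Real.sqrt_pos.2 (eigenvalue_pos hL k)
  set m := L / 2 * √(eigenvalue L k) with hm
  set A := 2 / L * √(eigenvalue L k) with hA
  have hm0 : 0 < m := by positivity
  have hA0 : 0 < A := by positivity
  set S := ∑' k, eigenvalue L k * regularBound L u₀ k ^ 2 with hS
  have hS0 : 0 ≤ S := tsum_nonneg fun k => mul_nonneg (eigenvalue_pos hL k).le (sq_nonneg _)
  -- The error `r` is split in thirds: `s₀` handles the initial layer, `M` the remainder of the
  -- gradient, and the standard deviation `R` of the Gaussian part, chosen after `M`, the small-ball
  -- term.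
  set s₀ := min T (r / (3 * m)) with hs₀
  have hs₀0 : 0 < s₀ := lt_min hT (by positivity)
  have hs₀T : s₀ ≤ T := min_le_left _ _
  have hs₀m : s₀ * m ≤ r / 3 := by
    refine (mul_le_mul_of_nonneg_right (min_le_right _ _) hm0.le).trans (le_of_eq ?_)
    field_simp
  set K := 2 * L ^ 2 + (2 * S + 2) with hK
  have hK0 : 0 < K := by positivity
  set M := 3 * T * A * K / r with hM
  have hM0 : 0 < M := by positivity
  set R := 12 * T * A * M * L ^ 2 / r with hR
  have hR0 : 0 < R := by positivity
  have hb : T * (A * (K / M + 4 * (M / √(R ^ 2) * L ^ 2))) = 2 * (r / 3) := by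
    rw [Real.sqrt_sq hR0.le]
    have e1 : T * A * (K / M) = r / 3 := by rw [hM]; field_simp
    have e2 : T * A * (4 * (M / R * L ^ 2)) = r / 3 := by rw [hR]; field_simp; norm_num
    linear_combination e1 + e2
  set E := 1 - Real.exp (-(2 * ((2 * Real.pi / L) ^ 2) ^ 2 * s₀)) with hE
  have hE0 : 0 < E := by
    have : 0 < 2 * ((2 * Real.pi / L) ^ 2) ^ 2 * s₀ := by positivity
    exact sub_pos.2 (Real.exp_lt_one_iff.2 (by linarith))
  -- The threshold is such that the lower bound for the variance becomes exactly `R ^ 2`. `F₁` does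
  -- not depend on `ε`, so `|α ε k| ≥ 1 / 2` holds on all of it for small `ε`.
  obtain ⟨F₁, hF₁⟩ := exists_modes_le_sum hL (R ^ 2 / (σ ^ 2 * E / 8))
  have hev : ∀ᶠ ε in 𝓝[>] (0 : ℝ), ∀ k ∈ F₁, 1 / 2 ≤ |α ε k| := by
    refine (Filter.eventually_all_finset F₁).2 fun k _ => ?_
    filter_upwards [(hα.tendsto_one k).eventually (Ioi_mem_nhds (by norm_num : (1 / 2 : ℝ) < 1))]
      with ε hε
    exact (le_of_lt hε).trans (le_abs_self _)
  filter_upwards [hev, self_mem_nhdsWithin] with ε hε1 hε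
  obtain ⟨F, hF₁F, hF⟩ := hα.exists_finset (σ := σ) hL hε F₁
  have hmain : ∀ t : Icc (0 : ℝ) T, s₀ ≤ t → ∫⁻ ω, ‖nonlinearity L (v ε t ω) k‖ₑ ∂P ≤
      ENNReal.ofReal (A * (K / M + 4 * (M / √(R ^ 2) * L ^ 2))) := by
    intro t ht
    refine lintegral_nonlinearity_le hβ hL hT hu₀ (hv ε hε) F hF t hM0 (by positivity) (fun x => ?_) k
    refine le_trans (le_of_eq ?_) (variance_lower_bound (σ := σ) hL hs₀0 ht hF₁F hε1 x (hF₁ x))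
    rw [← hE]
    field_simp
  have h := lintegral_driftPath_le hL hT (hv ε hε) k hs₀0.le hs₀T (by positivity) hmain
  refine h.trans ((ENNReal.ofReal_le_ofReal ?_).trans (ENNReal.ofReal_coe_nnreal.le.trans hr.le))
  have h5 : (T - s₀) * (A * (K / M + 4 * (M / √(R ^ 2) * L ^ 2))) ≤
      T * (A * (K / M + 4 * (M / √(R ^ 2) * L ^ 2))) :=
    mul_le_mul_of_nonneg_right (by linarith) (by positivity)
  rw [← hm]
  linarith

end

/-! ### The drift as a continuous field and the decomposition of the difference -/

section

variable {Ω : Type*} [MeasurableSpace Ω] {P : Measure Ω}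

/-- Moments of a bounded random variable. -/
lemma eLpNorm_le_of_enorm_le {E : Type*} [NormedAddCommGroup E] {f : Ω → E} {C : ℝ≥0∞}
    (hC : ∀ ω, ‖f ω‖ₑ ≤ C) (hC' : C ≠ ∞) {p : ℝ} (hp : 1 < p) :
    eLpNorm f (ENNReal.ofReal p) P ≤ (C ^ (p - 1) * ∫⁻ ω, ‖f ω‖ₑ ∂P) ^ (1 / p) := by
  have hp0 : 0 < p := by linarith
  rw [eLpNorm_eq_lintegral_rpow_enorm_toReal (by simpa using hp0) ENNReal.ofReal_ne_top,
    ENNReal.toReal_ofReal hp0.le,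
    ← lintegral_const_mul' _ _ (ENNReal.rpow_ne_top_of_nonneg (by linarith) hC')]
  refine ENNReal.rpow_le_rpow (lintegral_mono fun ω => ?_) (by positivity)
  calc ‖f ω‖ₑ ^ p = ‖f ω‖ₑ ^ (p - 1) * ‖f ω‖ₑ ^ (1 : ℝ) := by
        rw [← ENNReal.rpow_add_of_nonneg _ _ (by linarith) zero_le_one, sub_add_cancel]
    _ ≤ C ^ (p - 1) * ‖f ω‖ₑ := by
        rw [ENNReal.rpow_one]
        exact mul_le_mul_left (ENNReal.rpow_le_rpow (hC ω) (by linarith)) _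

/-- The function `-∫_0^t e^{-(t-s)Δ²} ∇ · (∇w / (1 + |∇w|²)) ds` on `[0, T] × [0, L]²`. -/
def driftField {T : ℝ} (hT : 0 < T) (L : ℝ) (w : ℝ → L2 L) : FieldSpace L T :=
  ∑' k, prodField L T k (driftPath hT L w k)

lemma norm_prodField_driftPath_le {L T : ℝ} (hL : 0 < L) (hT : 0 < T) (w : ℝ → L2 L) (k : Mode) :
    ‖prodField L T k (driftPath hT L w k)‖ ≤ √(eigenvalue L k) / eigenvalue L k ^ 2 := by
  refine (norm_prodField_le hL k _).trans
    ((mul_le_mul_of_nonneg_left (norm_driftPath_le hL hT w k) (by positivity)).trans (le_of_eq ?_))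
  field_simp

lemma hasSum_driftField {L T : ℝ} (hL : 0 < L) (hT : 0 < T) (w : ℝ → L2 L) :
    HasSum (fun k => prodField L T k (driftPath hT L w k)) (driftField hT L w) :=
  (Summable.of_norm_bounded (summable_sqrt_eigenvalue_div hL)
    (norm_prodField_driftPath_le hL hT w)).hasSum

lemma norm_driftField_le {L T : ℝ} (hL : 0 < L) (hT : 0 < T) (w : ℝ → L2 L) :
    ‖driftField hT L w‖ ≤ ∑' k, √(eigenvalue L k) / eigenvalue L k ^ 2 :=
  tsum_of_norm_bounded (summable_sqrt_eigenvalue_div hL).hasSum (norm_prodField_driftPath_le hL hT w)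

lemma enorm_driftField_le {L T : ℝ} (hL : 0 < L) (hT : 0 < T) (w : ℝ → L2 L) :
    ‖driftField hT L w‖ₑ ≤ ∑' k, ENNReal.ofReal (2 / L) * ‖driftPath hT L w k‖ₑ := by
  refine (enorm_tsum_le_tsum_enorm (f := fun k => prodField L T k (driftPath hT L w k))).trans
    (ENNReal.tsum_le_tsum fun k => ?_)
  rw [← ofReal_norm, ← ofReal_norm, ← ENNReal.ofReal_mul (by positivity)]
  exact ENNReal.ofReal_le_ofReal (norm_prodField_le hL k _)

lemma coeffs_driftField {L T : ℝ} (hL : 0 < L) (hT : 0 < T) (w : ℝ → L2 L) (t : Icc (0 : ℝ) T) :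
    coeff L (evalL2 hL t (driftField hT L w)) 0 = 0 ∧
      ∀ k, coeffs L (evalL2 hL t (driftField hT L w)) k = driftPath hT L w k t :=
  coeffs_evalL2_of_hasSum hL le_rfl (hasSum_driftField hL hT w) t

lemma IsMildSolution.aestronglyMeasurable_driftField [IsProbabilityMeasure P]
    {β : Mode → ℝ≥0 → Ω → ℝ} {L T σ : ℝ} (hL : 0 < L) (hT : 0 < T) {a : Mode → ℝ} {u₀ : L2 L}
    {u : ℝ → Ω → L2 L} (hu : IsMildSolution L T σ P β a u₀ u) :
    AEStronglyMeasurable (fun ω => driftField hT L (fun s => u s ω)) P := by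
  refine aestronglyMeasurable_of_tendsto_ae (atTop : Filter (Finset Mode))
    (f := fun F ω => ∑ k ∈ F, prodField L T k (driftPath hT L (fun s => u s ω) k)) (fun F => ?_)
    (Eventually.of_forall fun ω => hasSum_driftField hL hT _)
  refine Finset.aestronglyMeasurable_fun_sum _ fun k _ => ?_
  refine aestronglyMeasurable_continuousMap fun z => ?_
  exact ((continuous_eval_const z.1).comp_aestronglyMeasurable
    (hu.aestronglyMeasurable_driftPath hL hT k)).mul_const _

/-- The drift vanishes in the limit, uniformly in space and time. -/
lemma tendsto_lintegral_driftField [IsProbabilityMeasure P] {β : Mode → ℝ≥0 → Ω → ℝ}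
    (hβ : IsCylindricalWiener P β) {L T σ : ℝ} (hL : 0 < L) (hT : 0 < T) (hσ : 0 < σ) {u₀ : L2 L}
    (hu₀ : MemH L 1 u₀) {α : ℝ → Mode → ℝ} (hα : IsRegularization α) {v : ℝ → ℝ → Ω → L2 L}
    (hv : ∀ ε > 0, IsMildSolution L T σ P β (α ε) u₀ (v ε)) :
    Tendsto (fun ε => ∫⁻ ω, ‖driftField hT L (fun s => v ε s ω)‖ₑ ∂P) (𝓝[>] 0) (𝓝 0) := by
  set J : ℝ → Mode → ℝ≥0∞ := fun ε k => ∫⁻ ω, ‖driftPath hT L (fun s => v ε s ω) k‖ₑ ∂P with hJ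
  set m : Mode → ℝ := fun k => L / 2 * (√(eigenvalue L k) / eigenvalue L k ^ 2) with hm
  have hms : Summable m := (summable_sqrt_eigenvalue_div hL).mul_left _
  have hm0 : ∀ k, 0 ≤ m k := fun k => by have := eigenvalue_pos hL k; positivity
  have hJm : ∀ ε k, J ε k ≤ ENNReal.ofReal (m k) := by
    intro ε k
    have h : ∀ ω, ‖driftPath hT L (fun s => v ε s ω) k‖ₑ ≤ ENNReal.ofReal (m k) := fun ω => by
      rw [← ofReal_norm]
      exact ENNReal.ofReal_le_ofReal (norm_driftPath_le hL hT _ k)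
    refine (lintegral_mono h).trans ?_
    rw [lintegral_const, measure_univ, mul_one]
  have hJtop : ∀ ε k, J ε k ≠ ∞ := fun ε k => ne_top_of_le_ne_top ENNReal.ofReal_ne_top (hJm ε k)
  have hJr : ∀ ε k, (J ε k).toReal ≤ m k := fun ε k =>
    ENNReal.toReal_le_of_le_ofReal (hm0 k) (hJm ε k)
  -- Dominated convergence over the modes, with the summable majorant of order `|k|^{-3}`.
  have h1 : Tendsto (fun ε => ∑' k, (J ε k).toReal) (𝓝[>] 0) (𝓝 (∑' _ : Mode, 0)) := by
    refine tendsto_tsum_of_dominated_convergence hms (fun k => ?_) (Eventually.of_forall fun ε k => ?_)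
    · exact (ENNReal.tendsto_toReal ENNReal.zero_ne_top).comp
        (tendsto_lintegral_driftPath hβ hL hT hσ hu₀ hα hv k)
    · rw [Real.norm_of_nonneg ENNReal.toReal_nonneg]
      exact hJr ε k
  rw [tsum_zero] at h1
  have h2 : Tendsto (fun ε => ENNReal.ofReal (2 / L) * ENNReal.ofReal (∑' k, (J ε k).toReal)) (𝓝[>] 0)
      (𝓝 0) := by
    have := ENNReal.Tendsto.const_mul (a := ENNReal.ofReal (2 / L)) (ENNReal.tendsto_ofReal h1)
      (Or.inr ENNReal.ofReal_ne_top)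
    simpa using this
  refine tendsto_of_tendsto_of_tendsto_of_le_of_le' tendsto_const_nhds h2
    (Eventually.of_forall fun _ => zero_le) ?_
  filter_upwards [self_mem_nhdsWithin] with ε hε
  refine (lintegral_mono fun ω => enorm_driftField_le hL hT _).trans (le_of_eq ?_)
  rw [lintegral_tsum fun k => (((hv ε hε).aestronglyMeasurable_driftPath hL hT k).enorm).const_mul _]
  simp only [lintegral_const_mul' _ _ ENNReal.ofReal_ne_top]
  rw [ENNReal.tsum_mul_left, ENNReal.ofReal_tsum_of_nonneg (fun k => ENNReal.toReal_nonneg)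
    (Summable.of_nonneg_of_le (fun k => ENNReal.toReal_nonneg) (hJr ε) hms)]
  simp only [ENNReal.ofReal_toReal (hJtop ε _)]
  rfl

/-- The drift field is bounded by a deterministic constant independent of `ε`, so convergence in
mean implies convergence in `L^p`. -/
lemma tendsto_eLpNorm_driftField [IsProbabilityMeasure P] {β : Mode → ℝ≥0 → Ω → ℝ}
    (hβ : IsCylindricalWiener P β) {L T σ : ℝ} (hL : 0 < L) (hT : 0 < T) (hσ : 0 < σ) {u₀ : L2 L}
    (hu₀ : MemH L 1 u₀) {α : ℝ → Mode → ℝ} (hα : IsRegularization α) {v : ℝ → ℝ → Ω → L2 L}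
    (hv : ∀ ε > 0, IsMildSolution L T σ P β (α ε) u₀ (v ε)) {p : ℝ} (hp : 1 < p) :
    Tendsto (fun ε => eLpNorm (fun ω => driftField hT L (fun s => v ε s ω)) (ENNReal.ofReal p) P)
      (𝓝[>] 0) (𝓝 0) := by
  set C := ENNReal.ofReal (∑' k, √(eigenvalue L k) / eigenvalue L k ^ 2) with hC
  have hp0 : 0 < p := by linarith
  have h1 := ENNReal.Tendsto.const_mul (a := C ^ (p - 1))
    (tendsto_lintegral_driftField hβ hL hT hσ hu₀ hα hv)
    (Or.inr (ENNReal.rpow_ne_top_of_nonneg (by linarith) ENNReal.ofReal_ne_top))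
  have h2 := h1.ennrpow_const (1 / p)
  rw [mul_zero, ENNReal.zero_rpow_of_pos (by positivity)] at h2
  refine tendsto_of_tendsto_of_tendsto_of_le_of_le tendsto_const_nhds h2 (fun _ => zero_le)
    fun ε => ?_
  refine eLpNorm_le_of_enorm_le (fun ω => ?_) ENNReal.ofReal_ne_top hp
  rw [← ofReal_norm]
  exact ENNReal.ofReal_le_ofReal (norm_driftField_le hL hT _)

lemma summable_of_abs_le {a : Mode → ℝ} {C : ℝ} (ha : ∀ k, |a k| ≤ C) :
    Summable fun k => a k ^ 2 / modeNorm k ^ 3 := by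
  refine Summable.of_nonneg_of_le (fun k => ?_) (fun k => ?_)
    ((summable_modeNorm_inv_pow (n := 3) (by norm_num)).mul_left (C ^ 2))
  · have := one_le_modeNorm k; positivity
  · have := one_le_modeNorm k
    rw [mul_one_div]
    refine div_le_div_of_nonneg_right ?_ (by positivity)
    rw [← sq_abs]
    exact pow_le_pow_left₀ (abs_nonneg _) (ha k) 2

/-- The chaining bound needs an integer exponent of at least `64`; on a probability space smaller
exponents are dominated by larger ones. -/
lemma IsNoiseField.eLpNorm_le [IsProbabilityMeasure P] {β : Mode → ℝ≥0 → Ω → ℝ} {L T : ℝ}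
    {hL : 0 < L} {a : Mode → ℝ} {Φ : Ω → FieldSpace L T} (hΦ : IsNoiseField L T hL P β a Φ) (p : ℝ) :
    eLpNorm Φ (ENNReal.ofReal p) P ≤ momentConst L T (max 64 ⌈p⌉₊) *
      ENNReal.ofReal √(∑' k : Mode, a k ^ 2 / modeNorm k ^ 3) := by
  refine (eLpNorm_le_eLpNorm_of_exponent_le ?_ hΦ.measurable).trans (hΦ.moment _ (le_max_left _ _))
  rw [← ENNReal.ofReal_natCast]
  refine ENNReal.ofReal_le_ofReal ((Nat.le_ceil p).trans ?_)
  exact_mod_cast le_max_right _ _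

lemma eLpNorm_real_smul_le {E : Type*} [NormedAddCommGroup E] [NormedSpace ℝ E] (c : ℝ) (f : Ω → E)
    (p : ℝ≥0∞) : eLpNorm (fun ω => c • f ω) p P ≤ ‖c‖ₑ * eLpNorm f p P :=
  eLpNorm_const_smul_le (c := c) (f := f)

lemma IsNoiseField.eLpNorm_smul_le [IsProbabilityMeasure P] {β : Mode → ℝ≥0 → Ω → ℝ} {L T : ℝ}
    {hL : 0 < L} {a : Mode → ℝ} {Φ : Ω → FieldSpace L T} (hΦ : IsNoiseField L T hL P β a Φ)
    (c p : ℝ) : eLpNorm (fun ω => c • Φ ω) (ENNReal.ofReal p) P ≤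
      ‖c‖ₑ * (momentConst L T (max 64 ⌈p⌉₊) *
        ENNReal.ofReal √(∑' k : Mode, a k ^ 2 / modeNorm k ^ 3)) :=
  (eLpNorm_real_smul_le c Φ _).trans (mul_le_mul_right (hΦ.eLpNorm_le p) _)

/-- The terms vanish one by one, and the uniform bound on `α` gives the summable majorant `(C + 1)²
|k|^{-3}`. -/
lemma IsRegularization.tendsto_tsum {α : ℝ → Mode → ℝ} (hα : IsRegularization α) :
    Tendsto (fun ε => ∑' k : Mode, (α ε k - 1) ^ 2 / modeNorm k ^ 3) (𝓝[>] 0) (𝓝 0) := by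
  obtain ⟨C, hC⟩ := hα.bounded
  have h : Tendsto (fun ε => ∑' k : Mode, (α ε k - 1) ^ 2 / modeNorm k ^ 3) (𝓝[>] 0)
      (𝓝 (∑' _ : Mode, 0)) := by
    refine tendsto_tsum_of_dominated_convergence
      ((summable_modeNorm_inv_pow (n := 3) (by norm_num)).mul_left ((C + 1) ^ 2)) (fun k => ?_) ?_
    · have := (((hα.tendsto_one k).sub_const 1).pow 2).div_const (modeNorm k ^ 3)
      simpa using this
    · filter_upwards [self_mem_nhdsWithin] with ε hε k
      have hN := one_le_modeNorm k
      rw [Real.norm_of_nonneg (by positivity), mul_one_div]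
      refine div_le_div_of_nonneg_right ?_ (by positivity)
      rw [← sq_abs]
      refine pow_le_pow_left₀ (abs_nonneg _) ((abs_sub _ _).trans ?_) 2
      rw [abs_one]
      exact add_le_add (hC ε hε k) le_rfl
  rwa [tsum_zero] at h

/-- The difference of the mild solution and the solution of the linear equation is represented by a
continuous function. -/
lemma represents_sub [IsProbabilityMeasure P] {β : Mode → ℝ≥0 → Ω → ℝ}
    (hβ : IsCylindricalWiener P β) {L T σ : ℝ} (hL : 0 < L) (hT : 0 < T) {a : Mode → ℝ} {u₀ : L2 L}
    {u : ℝ → Ω → L2 L} (hu : IsMildSolution L T σ P β a u₀ u) {Φ Ψ : Ω → FieldSpace L T}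
    (hΦ : IsNoiseField L T hL P β (fun _ => 1) Φ)
    (hΨ : IsNoiseField L T hL P β (fun k => a k - 1) Ψ) :
    ∀ᵐ ω ∂P, Represents L T (fun t => u t ω - linearSolution hL hT σ u₀ Φ t ω)
      (driftField hT L (fun s => u s ω) + σ • Ψ ω) := by
  filter_upwards [hu.coeffs_eq hβ hL hT, hu.continuous, coeff_zero_linearSolution hL hT σ u₀ hΦ,
    hΦ.coeffs_eq, hΨ.coeffs_eq, hΨ.coeff_zero] with ω h1 h2 h3 h4 h5 h6 t
  have e : u t ω - linearSolution hL hT σ u₀ Φ t ω =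
      evalL2 hL t (driftField hT L (fun s => u s ω) + σ • Ψ ω) := by
    obtain ⟨h7, h8⟩ := coeffs_driftField hL hT (fun s => u s ω) t
    -- The initial values cancel and the noise coefficients subtract to `a k - 1`.
    refine ext_coeffs hL ?_ fun k => ?_
    · rw [map_add, map_smul, coeff_sub, coeff_add, coeff_smul, (h2.1 t t.2).1, h3 t t.2, h7, h6]
      ring
    · rw [map_add, map_smul, coeffs_sub, coeffs_add, coeffs_smul, h1 t k,
        coeffs_linearSolution hL hT σ u₀ Φ t.2, h8 k, h5 t k, h4 t k]
      ring
  beta_reduce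
  rw [e]
  exact coeFn_evalL2 hL t _

end

end SurfaceGrowth

end

/-! ### The main theorem -/

open SurfaceGrowth
theorem mainTheorem1 {Ω : Type*} [MeasurableSpace Ω] (P : Measure Ω) [IsProbabilityMeasure P]
    (L T σ : ℝ) (hL : 0 < L) (hT : 0 < T) (hσ : 0 < σ)
    (β : Mode → ℝ≥0 → Ω → ℝ) (hβ : IsCylindricalWiener P β)
    (u₀ : L2 L) (hu₀ : MemH L 1 u₀) :
    ∃ u : ℝ → Ω → L2 L, IsLinearSolution L T σ P β u₀ u ∧
      ∀ α : ℝ → Mode → ℝ, IsRegularization α →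
      ∀ v : ℝ → ℝ → Ω → L2 L, (∀ ε > 0, IsMildSolution L T σ P β (α ε) u₀ (v ε)) →
      ∃ D : ℝ → Ω → C(Icc (0 : ℝ) T × square L, ℝ),
        (∀ ε > 0, ∀ᵐ ω ∂P, Represents L T (fun t => v ε t ω - u t ω) (D ε ω)) ∧
        ∀ p : ℝ, 1 < p →
          (∀ ε > 0, MemLp (D ε) (ENNReal.ofReal p) P) ∧
          Tendsto (fun ε => eLpNorm (D ε) (ENNReal.ofReal p) P) (𝓝[>] 0) (𝓝 0) := by
  obtain ⟨Φ, hΦ⟩ := exists_isNoiseField hβ hL hT (a := fun _ => 1)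
    (summable_of_abs_le (C := 1) fun _ => by simp)
  refine ⟨linearSolution hL hT σ u₀ Φ, isLinearSolution_linearSolution hβ hL hT σ u₀ hΦ,
    fun α hα v hv => ?_⟩
  obtain ⟨C, hC⟩ := hα.bounded
  -- The condition `0 < ε` is placed inside so that the choice is a total function of `ε`; the value
  -- `0` elsewhere is never used.
  have hex : ∀ ε, ∃ Ψ : Ω → FieldSpace L T,
      0 < ε → IsNoiseField L T hL P β (fun k => α ε k - 1) Ψ := fun ε => by
    by_cases hε : 0 < ε
    · obtain ⟨Ψ, hΨ⟩ := exists_isNoiseField hβ hL hT (a := fun k => α ε k - 1)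
        (summable_of_abs_le (C := C + 1) fun k => (abs_sub _ _).trans (by
          rw [abs_one]; exact add_le_add (hC ε hε k) le_rfl))
      exact ⟨Ψ, fun _ => hΨ⟩
    · exact ⟨0, fun h => absurd h hε⟩
  choose Ψ hΨ using hex
  refine ⟨fun ε ω => driftField hT L (fun s => v ε s ω) + σ • Ψ ε ω,
    fun ε hε => represents_sub hβ hL hT (hv ε hε) hΦ (hΨ ε hε), fun p hp => ⟨fun ε hε => ?_, ?_⟩⟩
  · refine MemLp.add ?_ (MemLp.const_smul ⟨(hΨ ε hε).measurable, ?_⟩ σ)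
    · exact MemLp.of_bound ((hv ε hε).aestronglyMeasurable_driftField hL hT) _
        (Eventually.of_forall fun ω => norm_driftField_le hL hT _)
    · exact ((hΨ ε hε).eLpNorm_le p).trans_lt
        (ENNReal.mul_lt_top (momentConst_ne_top _ _ _).lt_top ENNReal.ofReal_lt_top)
  · have h1 := tendsto_eLpNorm_driftField hβ hL hT hσ hu₀ hα hv hp
    have h2 := ENNReal.Tendsto.const_mul (a := momentConst L T (max 64 ⌈p⌉₊))
      (ENNReal.tendsto_ofReal hα.tendsto_tsum.sqrt) (Or.inr (momentConst_ne_top _ _ _))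
    have h3 := h1.add (ENNReal.Tendsto.const_mul (a := ‖σ‖ₑ) h2 (Or.inr enorm_ne_top))
    rw [Real.sqrt_zero, ENNReal.ofReal_zero, mul_zero, mul_zero, add_zero] at h3
    refine tendsto_of_tendsto_of_tendsto_of_le_of_le' tendsto_const_nhds h3
      (Eventually.of_forall fun _ => zero_le) ?_
    filter_upwards [self_mem_nhdsWithin] with ε hε
    refine (eLpNorm_add_le ((hv ε hε).aestronglyMeasurable_driftField hL hT)
      ((hΨ ε hε).measurable.const_smul σ) (ENNReal.one_le_ofReal.2 hp.le)).trans ?_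
    exact add_le_add le_rfl ((hΨ ε hε).eLpNorm_smul_le σ p)
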